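/- **Setting.** Write $\mathbb N=\{1,2,\dots\}$, let $\mathbb T$ be the flat $2\pi$-periodic torus, and let $\gamma\in\mathbb R$, $k_*\in\mathbb N$, $\lambda_*<1$ and $$\alpha=\frac{2\sqrt{1-\lambda_*}}{k_*}>0 .$$ Consider, for $V(\lambda,y)=\lambda+\alpha\delta_0(y)$ and $\Gamma=\gamma\delta_0$, the equation $$-\Phi_{yy}-(1-V(\lambda,y))\Phi_{xx}+\Gamma(y)(\Phi^3)_{xx}=0\qquad\text{on }\mathbb T\times\mathbb R. \tag{E}$$ A (real-valued) function $\Phi\in H^2(\mathbb T;L^2(\mathbb R))\cap H^1(\mathbb T;H^1(\mathbb R))\cap C(\mathbb R;H^2(\mathbb T))$ is a weak solution of (E) if $$\int_{\mathbb T}\int_{\mathbb R}\Phi_y\Psi_y-(1-\lambda)\Phi_{xx}\Psi\,dy\,dx+\int_{\mathbb T}\bigl(\alpha\Phi_{xx}(x,0)+\gamma(\Phi^3)_{xx}(x,0)\bigr)\Psi(x,0)\,dx=0\qquad\text{for all }\Psi\in H^1(\mathbb T;H^1(\mathbb R)).$$ For $k\in\mathbb N$, $\lambda\in\mathbb R$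 let $L^\lambda_{0,k}=-\frac{d^2}{dy^2}+k^2(1-\lambda)$ on $L^2(\mathbb R)$ with domain $H^2(\mathbb R)$, and let $L^\lambda_k=-\frac{d^2}{dy^2}+k^2(1-\lambda-\alpha\delta_0)$, i.e. the operator acting as $-\frac{d^2}{dy^2}+k^2(1-\lambda)$ off $y=0$ with domain $\{u\in H^1(\mathbb R)\cap H^2(-\infty,0)\cap H^2(0,\infty): u'(0_+)-u'(0_-)=-k^2\alpha u(0)\}$. Denote by $\rho$ the resolvent set. Put $$\phi^*(y)=e^{-k_*\sqrt{1-\lambda_*}\,|y|}.$$ **Statement.** There are an interval $I\subset\mathbb R$ and an open interval $I_{\lambda_*}\subset I$ containing $\lambda_*$ such that the following holds. 1. (Hypotheses of the bifurcation theorem, with $V_0=1$ and $W=0$, which are even functions in $L^\infty(\mathbb R)$.) - $0\in\rho(L^\lambda_{0,k})$ for all $k\in\mathbb N$ and $\lambda\in I$. - Zero is an isolated simple eigenvalue of $L^{\lambda_*}_{k_*}$, its kernel is spanned by $\phi^*$, and $0\in\rho(L^\lambda_k)$ for all $(k,\lambda)\in\mathbb N\times I_{\lambda_*}$ with $(k,\lambda)\ne(k_*,\lambda_*)$.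 - For all $k\in\mathbb N$ and $\lambda\in I_{\lambda_*}$ there is a solution $\phi_k(\cdot;\lambda)\in H^2(0,\infty)$ of $-\phi_k''+k^2(1-\lambda)\phi_k=0$ on $(0,\infty)$ with $\phi_k(0;\lambda)=1$, and there is $C>0$, independent of $k\in\mathbb N$ and $\lambda\in I_{\lambda_*}$, such that $\|\phi_k(\cdot;\lambda)\|_{L^2(0,\infty)}\le C$ for every such solution. - $\langle V_0\phi^*,\phi^*\rangle_{L^2(\mathbb R)}=\int_{\mathbb R}(\phi^*)^2\,dy\neq0$. 2. There are $\varepsilon_0>0$ and a smooth ($C^\infty$) curve $$(-\varepsilon_0,\varepsilon_0)\ni\varepsilon\mapsto(\Phi(\varepsilon),\lambda(\varepsilon))\in\bigl(H^2(\mathbb T;L^2(\mathbb R))\cap H^1(\mathbb T;H^1(\mathbb R))\cap\{\Phi(\cdot,0)\in H^2(\mathbb T)\}\bigr)\times I_{\lambda_*}$$ such that, for every $|\varepsilon|<\varepsilon_0$, $\Phi(\varepsilon)$ is a weak solution of (E) with $\lambda=\lambda(\varepsilon)$, with $\Phi(\varepsilon)\ne0$ if $\varepsilon\neq0$, and $$\Phi(0)=0,\qquad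 D_\varepsilon\Phi(0)(x,y)=e^{-k_*\sqrt{1-\lambda_*}\,|y|}\sin(k_*x),$$ $$\lambda(0)=\lambda_*,\qquad\dot\lambda(0)=0,\qquad\ddot\lambda(0)=-\tfrac32\,\gamma\,k_*\sqrt{1-\lambda_*}.$$ 3. The solutions of this curve have the form $$\Phi(\varepsilon)(x,y)=\sum_{k\in\mathbb N}a_k(\varepsilon)\,e^{-k\sqrt{1-\lambda(\varepsilon)}\,|y|}\sin(kx)$$ with real coefficients satisfying $\sum_{k\in\mathbb N}|k^2a_k(\varepsilon)|^2<\infty$; the series converges absolutely for all $(x,y)$ to the continuous representative of $\Phi(\varepsilon)$. -/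

import Mathlib

open MeasureTheory Set Filter Topology
open scoped ContDiff

noncomputable section

namespace DeltaWave

/-! ## Weak derivatives on open subsets of the line -/

/-- `g` is the weak derivative of `u` on the open set `Ω ⊆ ℝ`:
`∫_Ω u ψ' = - ∫_Ω g ψ` for all `ψ ∈ C_c^∞(Ω)`. -/
structure HasWeakDerivOn {𝕜 : Type} [RCLike 𝕜] (Ω : Set ℝ) (u g : ℝ → 𝕜) : Prop where
  locInt : LocallyIntegrableOn u Ω
  locInt_deriv : LocallyIntegrableOn g Ω
  integral_eq : ∀ ψ : ℝ → ℝ, ContDiff ℝ ∞ ψ → HasCompactSupport ψ → tsupport ψ ⊆ Ω →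
    (∫ y in Ω, ((deriv ψ y : ℝ) : 𝕜) * u y) = - (∫ y in Ω, ((ψ y : ℝ) : 𝕜) * g y)

/-! ## The linear wave operators on `L²(ℝ)` -/

/-- The complex Hilbert space `L²(ℝ)`. -/
abbrev LineL2 : Type := Lp ℂ 2 (volume : Measure ℝ)

/-- `u` lies in the domain of `-d²/dy² + q(y) - c δ₀` and is mapped to `f`. The domain is
`{u ∈ H¹(ℝ) ∩ H²(-∞,0) ∩ H²(0,∞) : u'(0+) - u'(0-) = - c u(0)}`, and the operator acts as
`-u'' + q u` away from `0`. For `c = 0` the domain is `H²(ℝ)`. Here `v` is the continuous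
representative of `u`, `v₁` the representative of `u'` that is continuous off `0`, with one-sided
limits `l`, `r` at `0`, and `v₂` is the second derivative off `0`. -/
def OpMapsTo (q : ℝ → ℝ) (c : ℝ) (u f : LineL2) : Prop :=
  ∃ (v v₁ v₂ : ℝ → ℂ) (l r : ℂ),
    (u =ᵐ[volume] v) ∧ Continuous v ∧
    HasWeakDerivOn univ v v₁ ∧ MemLp v₁ 2 volume ∧
    HasWeakDerivOn (Iio 0) v₁ v₂ ∧ HasWeakDerivOn (Ioi 0) v₁ v₂ ∧ MemLp v₂ 2 volume ∧
    ContinuousOn v₁ {0}ᶜ ∧ Tendsto v₁ (𝓝[<] 0) (𝓝 l) ∧ Tendsto v₁ (𝓝[>] 0) (𝓝 r) ∧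
    r - l = - (c : ℂ) * v 0 ∧
    (f =ᵐ[volume] fun y => - v₂ y + (q y : ℂ) * v y)

/-- The graph of the unbounded operator `-d²/dy² + q(y) - c δ₀` on `L²(ℝ)`. -/
def opGraph (q : ℝ → ℝ) (c : ℝ) : Set (LineL2 × LineL2) := {p | OpMapsTo q c p.1 p.2}

/-- `z` belongs to the resolvent set of the operator `L` with graph `G`: the operator
`z - L : D(L) → L²(ℝ)` has a bounded inverse `R`. -/
def InResolventSet (G : Set (LineL2 × LineL2)) (z : ℂ) : Prop :=
  ∃ R : LineL2 →L[ℂ] LineL2, ∀ u g : LineL2,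
    (∃ f, (u, f) ∈ G ∧ z • u - f = g) ↔ u = R g

/-- `e` is a nonzero vector that spans the kernel of the operator with graph `G`. -/
def SpansKernel (G : Set (LineL2 × LineL2)) (e : LineL2) : Prop :=
  e ≠ 0 ∧ ∀ u, (u, 0) ∈ G ↔ ∃ c : ℂ, u = c • e

/-- Zero is an isolated simple eigenvalue of the operator with graph `G`: the kernel is
one-dimensional and a punctured neighbourhood of `0` in `ℂ` belongs to the resolvent set.
(The operators considered are self-adjoint, so that simplicity is a statement on the kernel.) -/
def ZeroIsolatedSimple (G : Set (LineL2 × LineL2)) : Prop :=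
  (∃ e, SpansKernel G e) ∧ ∃ δ > 0, ∀ z : ℂ, z ≠ 0 → ‖z‖ < δ → InResolventSet G z

/-- The bounded part `k² (1 - lam V₀(y) - W(y))` of the potential. -/
def pot (V₀ W : ℝ → ℝ) (k : ℕ) (lam : ℝ) (y : ℝ) : ℝ := (k : ℝ) ^ 2 * (1 - lam * V₀ y - W y)

/-- `-d²/dy² + k² (1 - lam V₀ - W)`, with domain `H²(ℝ)`. -/
def regularOp (V₀ W : ℝ → ℝ) (k : ℕ) (lam : ℝ) : Set (LineL2 × LineL2) :=
  opGraph (pot V₀ W k lam) 0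

/-- `-d²/dy² + k² (1 - lam V₀ - W - α δ₀)`. -/
def deltaOp (V₀ W : ℝ → ℝ) (α : ℝ) (k : ℕ) (lam : ℝ) : Set (LineL2 × LineL2) :=
  opGraph (pot V₀ W k lam) ((k : ℝ) ^ 2 * α)

/-- `φ` (only its values on `[0,∞)` matter) is in `H²(0,∞)`, solves `-φ'' + q φ = 0` on `(0,∞)`
and satisfies `φ(0) = 1`. -/
def IsDecayingMode (q : ℝ → ℝ) (φ : ℝ → ℝ) : Prop :=
  ContinuousOn φ (Ici 0) ∧ φ 0 = 1 ∧ MemLp φ 2 (volume.restrict (Ioi 0)) ∧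
    ∃ φ₁ φ₂ : ℝ → ℝ,
      HasWeakDerivOn (Ioi 0) φ φ₁ ∧ MemLp φ₁ 2 (volume.restrict (Ioi 0)) ∧
      HasWeakDerivOn (Ioi 0) φ₁ φ₂ ∧ MemLp φ₂ 2 (volume.restrict (Ioi 0)) ∧
      ∀ᵐ y ∂(volume.restrict (Ioi (0 : ℝ))), - φ₂ y + q y * φ y = 0

/-- The conditions on the linear wave operator for the potential
`V(lam, y) = lam V₀(y) + W(y) + α δ₀(y)`, at the wavenumber `kstar` and the parameter `lamstar`,
with the interval `I`, the open interval `Istar` around `lamstar`, and the kernel function `φstar`.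
Wavenumbers are the integers `k ≥ 1`. -/
structure BifurcationHypotheses (V₀ W : ℝ → ℝ) (α : ℝ) (kstar : ℕ) (lamstar : ℝ)
    (I Istar : Set ℝ) (φstar : ℝ → ℝ) : Prop where
  /-- `V₀, W ∈ L^∞(ℝ)` are even. -/
  memLp_V₀ : MemLp V₀ ⊤ volume
  memLp_W : MemLp W ⊤ volume
  even_V₀ : ∀ᵐ y, V₀ (-y) = V₀ y
  even_W : ∀ᵐ y, W (-y) = W y
  /-- `0` is in the resolvent set of the regular part for all `k` and all `lam ∈ I`. -/
  interval : I.OrdConnected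
  regular_resolvent : ∀ k : ℕ, 1 ≤ k → ∀ lam ∈ I, InResolventSet (regularOp V₀ W k lam) 0
  /-- `0` is an isolated simple eigenvalue exactly at `(kstar, lamstar)`. -/
  one_le_kstar : 1 ≤ kstar
  isOpen_Istar : IsOpen Istar
  interval_star : Istar.OrdConnected
  mem_star : lamstar ∈ Istar
  star_subset : Istar ⊆ I
  isolated_simple : ZeroIsolatedSimple (deltaOp V₀ W α kstar lamstar)
  resolvent : ∀ k : ℕ, 1 ≤ k → ∀ lam ∈ Istar, (k, lam) ≠ (kstar, lamstar) →
    InResolventSet (deltaOp V₀ W α k lam) 0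
  /-- The decaying modes exist and are bounded in `L²(0,∞)` uniformly in `k` and `lam`. -/
  modes : ∃ C : ℝ, 0 < C ∧ ∀ lam ∈ Istar, ∀ k : ℕ, 1 ≤ k →
    (∃ φ, IsDecayingMode (pot V₀ W k lam) φ) ∧
    ∀ φ, IsDecayingMode (pot V₀ W k lam) φ →
      eLpNorm φ 2 (volume.restrict (Ioi 0)) ≤ ENNReal.ofReal C
  /-- `φstar` spans the kernel of the operator at `(kstar, lamstar)`. -/
  kernel : ∃ e : LineL2, (e =ᵐ[volume] fun y => (φstar y : ℂ)) ∧
    SpansKernel (deltaOp V₀ W α kstar lamstar) e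
  /-- Transversality. -/
  integrable : Integrable (fun y => V₀ y * φstar y ^ 2) volume
  transversality : (∫ y, V₀ y * φstar y ^ 2) ≠ 0

/-! ## Function spaces on `𝕋` and on `𝕋 × ℝ`

`𝕋` is the flat `2π`-periodic torus. Elements of `L²(𝕋)` and `L²(𝕋 × ℝ)` are described on the
fundamental domain `(0, 2π]`; periodicity is encoded in the test functions. -/

/-- The measure of `𝕋`. -/
def torusMeasure : Measure ℝ := volume.restrict (Ioc 0 (2 * Real.pi))

/-- The measure of `𝕋 × ℝ`. -/
def stripMeasure : Measure (ℝ × ℝ) := torusMeasure.prod volume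

/-- `L²(𝕋)`. -/
abbrev TorusL2 : Type := Lp ℝ 2 torusMeasure

/-- `L²(𝕋 × ℝ)`. -/
abbrev StripL2 : Type := Lp ℝ 2 stripMeasure

/-- `g` is the weak derivative of `f` on `𝕋`. -/
def HasWeakDerivTorus (f g : ℝ → ℝ) : Prop :=
  ∀ ψ : ℝ → ℝ, ContDiff ℝ ∞ ψ → (∀ x, ψ (x + 2 * Real.pi) = ψ x) →
    (∫ x, f x * deriv ψ x ∂torusMeasure) = - (∫ x, g x * ψ x ∂torusMeasure)

/-- Test functions on `𝕋 × ℝ`: smooth, `2π`-periodic in `x`, compactly supported in `y`. -/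
structure IsStripTest (ψ : ℝ × ℝ → ℝ) : Prop where
  smooth : ContDiff ℝ ∞ ψ
  periodic : ∀ x y, ψ (x + 2 * Real.pi, y) = ψ (x, y)
  supp : ∃ R : ℝ, ∀ x y, R < |y| → ψ (x, y) = 0

/-- `G` is the weak derivative of `F` on `𝕋 × ℝ` in the direction `d`. -/
def HasWeakDerivStrip (d : ℝ × ℝ) (F G : ℝ × ℝ → ℝ) : Prop :=
  ∀ ψ : ℝ × ℝ → ℝ, IsStripTest ψ →
    (∫ p, F p * fderiv ℝ ψ p d ∂stripMeasure) = - (∫ p, G p * ψ p ∂stripMeasure)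

/-- `G = ∂ₓ F` weakly. -/
abbrev HasWeakDx (F G : ℝ × ℝ → ℝ) : Prop := HasWeakDerivStrip (1, 0) F G

/-- `G = ∂_y F` weakly. -/
abbrev HasWeakDy (F G : ℝ × ℝ → ℝ) : Prop := HasWeakDerivStrip (0, 1) F G

instance : IsFiniteMeasure torusMeasure := by
  unfold torusMeasure; infer_instance

instance : SFinite stripMeasure := by
  unfold stripMeasure; infer_instance

lemma integrable_torus_mul (f : TorusL2) {g : ℝ → ℝ} (hg : Continuous g) :
    Integrable (fun x => f x * g x) torusMeasure := by
  have hf : Integrable f torusMeasure := (Lp.memLp f).integrable (by norm_num)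
  have h2 : IntegrableOn f (Icc 0 (2 * Real.pi)) torusMeasure := hf.integrableOn
  have h3 : IntegrableOn (fun x => f x * g x) (Icc 0 (2 * Real.pi)) torusMeasure :=
    h2.mul_continuousOn hg.continuousOn isCompact_Icc
  have h4 : torusMeasure.restrict (Icc 0 (2 * Real.pi)) = torusMeasure := by
    unfold torusMeasure
    rw [Measure.restrict_restrict measurableSet_Icc, inter_eq_right.mpr Ioc_subset_Icc_self]
  rwa [IntegrableOn, h4] at h3

lemma HasWeakDerivTorus.add {f f' g g' : TorusL2} (h : HasWeakDerivTorus f g)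
    (h' : HasWeakDerivTorus f' g') :
    HasWeakDerivTorus (f + f' : TorusL2) (g + g' : TorusL2) := by
  intro ψ hψ hp
  have hd : Continuous (deriv ψ) := hψ.continuous_deriv (by norm_num)
  have e1 : ∫ x, (f + f' : TorusL2) x * deriv ψ x ∂torusMeasure
      = ∫ x, (f x * deriv ψ x + f' x * deriv ψ x) ∂torusMeasure := by
    refine integral_congr_ae ?_
    filter_upwards [Lp.coeFn_add f f'] with x hx
    rw [hx, Pi.add_apply, add_mul]
  have e2 : ∫ x, (g + g' : TorusL2) x * ψ x ∂torusMeasure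
      = ∫ x, (g x * ψ x + g' x * ψ x) ∂torusMeasure := by
    refine integral_congr_ae ?_
    filter_upwards [Lp.coeFn_add g g'] with x hx
    rw [hx, Pi.add_apply, add_mul]
  rw [e1, e2, integral_add (integrable_torus_mul f hd) (integrable_torus_mul f' hd),
    integral_add (integrable_torus_mul g hψ.continuous) (integrable_torus_mul g' hψ.continuous),
    h ψ hψ hp, h' ψ hψ hp]
  ring

lemma HasWeakDerivTorus.smul {f g : TorusL2} (c : ℝ) (h : HasWeakDerivTorus f g) :
    HasWeakDerivTorus (c • f : TorusL2) (c • g : TorusL2) := by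
  intro ψ hψ hp
  have e1 : ∫ x, (c • f : TorusL2) x * deriv ψ x ∂torusMeasure
      = ∫ x, c * (f x * deriv ψ x) ∂torusMeasure := by
    refine integral_congr_ae ?_
    filter_upwards [Lp.coeFn_smul c f] with x hx
    rw [hx, Pi.smul_apply, smul_eq_mul, mul_assoc]
  have e2 : ∫ x, (c • g : TorusL2) x * ψ x ∂torusMeasure
      = ∫ x, c * (g x * ψ x) ∂torusMeasure := by
    refine integral_congr_ae ?_
    filter_upwards [Lp.coeFn_smul c g] with x hx
    rw [hx, Pi.smul_apply, smul_eq_mul, mul_assoc]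
  rw [e1, e2, integral_const_mul, integral_const_mul, h ψ hψ hp]
  ring

lemma HasWeakDerivTorus.zero :
    HasWeakDerivTorus (0 : TorusL2) (0 : TorusL2) := by
  have h := Lp.coeFn_zero ℝ 2 torusMeasure
  intro ψ _ _
  rw [integral_eq_zero_of_ae, integral_eq_zero_of_ae, neg_zero] <;>
  · filter_upwards [h] with x hx
    rw [hx]; simp

/-- `H²(𝕋)`, an element being given together with its first and second weak derivatives;
the norm is (equivalent to) the usual one. -/
def H2Torus : Submodule ℝ (TorusL2 × TorusL2 × TorusL2) where
  carrier := {t | HasWeakDerivTorus t.1 t.2.1 ∧ HasWeakDerivTorus t.2.1 t.2.2}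
  add_mem' := fun ha hb => ⟨ha.1.add hb.1, ha.2.add hb.2⟩
  zero_mem' := ⟨HasWeakDerivTorus.zero, HasWeakDerivTorus.zero⟩
  smul_mem' := fun c _ ha => ⟨ha.1.smul c, ha.2.smul c⟩

/-- The underlying element of `L²(𝕋)`. -/
def H2Torus.fn (t : H2Torus) : TorusL2 := t.1.1

/-- The second weak derivative. -/
def H2Torus.dxx (t : H2Torus) : TorusL2 := t.1.2.2

lemma integrable_strip_mul (F : StripL2) {g : ℝ × ℝ → ℝ} (hg : Continuous g)
    (hs : ∃ R : ℝ, ∀ x y, R < |y| → g (x, y) = 0) :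
    Integrable (fun p => F p * g p) stripMeasure := by
  obtain ⟨R, hR⟩ := hs
  set K : Set (ℝ × ℝ) := Icc 0 (2 * Real.pi) ×ˢ Icc (-R) R with hK
  have hKc : IsCompact K := isCompact_Icc.prod isCompact_Icc
  have hfin : stripMeasure K < ⊤ := by
    rw [hK, stripMeasure, Measure.prod_prod]
    exact ENNReal.mul_lt_top (measure_lt_top _ _) (by simp)
  have hF : IntegrableOn F K stripMeasure := by
    have : IsFiniteMeasure (stripMeasure.restrict K) := ⟨by simpa using hfin⟩
    exact ((Lp.memLp F).restrict K).integrable (by norm_num)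
  have h3 : IntegrableOn (fun p => F p * g p) K stripMeasure :=
    hF.mul_continuousOn hg.continuousOn hKc
  rw [← integrable_indicator_iff hKc.measurableSet] at h3
  refine h3.congr ?_
  have hx : ∀ᵐ p ∂stripMeasure, p.1 ∈ Icc 0 (2 * Real.pi) := by
    have h : ∀ᵐ x ∂torusMeasure, x ∈ Icc 0 (2 * Real.pi) := by
      unfold torusMeasure
      filter_upwards [ae_restrict_mem measurableSet_Ioc] with x hx
      exact Ioc_subset_Icc_self hx
    exact (Measure.quasiMeasurePreserving_fst (μ := torusMeasure) (ν := volume)).ae h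
  filter_upwards [hx] with p hp
  by_cases hpK : p ∈ K
  · rw [indicator_of_mem hpK]
  · rw [indicator_of_notMem hpK]
    have : R < |p.2| := by
      by_contra hcon
      exact hpK ⟨hp, abs_le.mp (not_lt.mp hcon)⟩
    rw [show g p = 0 from hR p.1 p.2 this, mul_zero]

lemma IsStripTest.fderiv_supp {ψ : ℝ × ℝ → ℝ} (h : IsStripTest ψ) (d : ℝ × ℝ) :
    ∃ R : ℝ, ∀ x y, R < |y| → fderiv ℝ ψ (x, y) d = 0 := by
  obtain ⟨R, hR⟩ := h.supp
  refine ⟨R, fun x y hy => ?_⟩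
  have ho : IsOpen {p : ℝ × ℝ | R < |p.2|} :=
    isOpen_lt continuous_const (continuous_abs.comp continuous_snd)
  have he : ψ =ᶠ[𝓝 (x, y)] fun _ => (0 : ℝ) := by
    filter_upwards [ho.mem_nhds (show (x, y) ∈ {p : ℝ × ℝ | R < |p.2|} from hy)] with p hp
    exact hR p.1 p.2 hp
  rw [he.fderiv_eq]; simp

lemma HasWeakDerivStrip.add {d : ℝ × ℝ} {f f' g g' : StripL2} (h : HasWeakDerivStrip d f g)
    (h' : HasWeakDerivStrip d f' g') :
    HasWeakDerivStrip d (f + f' : StripL2) (g + g' : StripL2) := by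
  intro ψ hψ
  have hd : Continuous (fun p => fderiv ℝ ψ p d) :=
    (hψ.smooth.continuous_fderiv (by norm_num)).clm_apply continuous_const
  have hds := hψ.fderiv_supp d
  have e1 : ∫ p, (f + f' : StripL2) p * fderiv ℝ ψ p d ∂stripMeasure
      = ∫ p, (f p * fderiv ℝ ψ p d + f' p * fderiv ℝ ψ p d) ∂stripMeasure := by
    refine integral_congr_ae ?_
    filter_upwards [Lp.coeFn_add f f'] with x hx
    rw [hx, Pi.add_apply, add_mul]
  have e2 : ∫ p, (g + g' : StripL2) p * ψ p ∂stripMeasure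
      = ∫ p, (g p * ψ p + g' p * ψ p) ∂stripMeasure := by
    refine integral_congr_ae ?_
    filter_upwards [Lp.coeFn_add g g'] with x hx
    rw [hx, Pi.add_apply, add_mul]
  rw [e1, e2, integral_add (integrable_strip_mul f hd hds) (integrable_strip_mul f' hd hds),
    integral_add (integrable_strip_mul g hψ.smooth.continuous hψ.supp)
      (integrable_strip_mul g' hψ.smooth.continuous hψ.supp), h ψ hψ, h' ψ hψ]
  ring

lemma HasWeakDerivStrip.smul {d : ℝ × ℝ} {f g : StripL2} (c : ℝ) (h : HasWeakDerivStrip d f g) :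
    HasWeakDerivStrip d (c • f : StripL2) (c • g : StripL2) := by
  intro ψ hψ
  have e1 : ∫ p, (c • f : StripL2) p * fderiv ℝ ψ p d ∂stripMeasure
      = ∫ p, c * (f p * fderiv ℝ ψ p d) ∂stripMeasure := by
    refine integral_congr_ae ?_
    filter_upwards [Lp.coeFn_smul c f] with x hx
    rw [hx, Pi.smul_apply, smul_eq_mul, mul_assoc]
  have e2 : ∫ p, (c • g : StripL2) p * ψ p ∂stripMeasure
      = ∫ p, c * (g p * ψ p) ∂stripMeasure := by
    refine integral_congr_ae ?_
    filter_upwards [Lp.coeFn_smul c g] with x hx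
    rw [hx, Pi.smul_apply, smul_eq_mul, mul_assoc]
  rw [e1, e2, integral_const_mul, integral_const_mul, h ψ hψ]
  ring

lemma HasWeakDerivStrip.zero (d : ℝ × ℝ) :
    HasWeakDerivStrip d (0 : StripL2) (0 : StripL2) := by
  have h := Lp.coeFn_zero ℝ 2 stripMeasure
  intro ψ _
  rw [integral_eq_zero_of_ae, integral_eq_zero_of_ae, neg_zero] <;>
  · filter_upwards [h] with x hx
    rw [hx]; simp

/-- `u` is the continuous, `2π`-periodic (in `x`) representative of `F ∈ L²(𝕋 × ℝ)`. -/
structure IsContRep (F : StripL2) (u : ℝ → ℝ → ℝ) : Prop where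
  cont : Continuous (fun p : ℝ × ℝ => u p.1 p.2)
  periodic : ∀ x y, u (x + 2 * Real.pi) y = u x y
  ae_eq : F =ᵐ[stripMeasure] fun p => u p.1 p.2

lemma IsContRep.add {F G : StripL2} {u v : ℝ → ℝ → ℝ} (hu : IsContRep F u) (hv : IsContRep G v) :
    IsContRep (F + G) (fun x y => u x y + v x y) where
  cont := hu.cont.add hv.cont
  periodic x y := by rw [hu.periodic, hv.periodic]
  ae_eq := by
    filter_upwards [Lp.coeFn_add F G, hu.ae_eq, hv.ae_eq] with p h1 h2 h3
    rw [h1, Pi.add_apply, h2, h3]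

lemma IsContRep.smul {F : StripL2} {u : ℝ → ℝ → ℝ} (c : ℝ) (hu : IsContRep F u) :
    IsContRep (c • F) (fun x y => c * u x y) where
  cont := continuous_const.mul hu.cont
  periodic x y := by rw [hu.periodic]
  ae_eq := by
    filter_upwards [Lp.coeFn_smul c F, hu.ae_eq] with p h1 h2
    rw [h1, Pi.smul_apply, h2, smul_eq_mul]

lemma IsContRep.zero : IsContRep 0 (fun _ _ => 0) where
  cont := continuous_const
  periodic _ _ := rfl
  ae_eq := by
    filter_upwards [Lp.coeFn_zero ℝ 2 stripMeasure] with p h1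
    rw [h1]; rfl

/-- `F ∈ H¹(𝕋; H¹(ℝ))` with weak derivatives `∂ₓF = Fx`, `∂_yF = Fy`, `∂_y∂ₓF = Fxy`, i.e.
`F` and `∂ₓF` belong to `L²(𝕋; H¹(ℝ))`. -/
structure IsH1H1 (F Fx Fy Fxy : StripL2) : Prop where
  dx : HasWeakDx F Fx
  dy : HasWeakDy F Fy
  dxy : HasWeakDy Fx Fxy

/-- The space `{Φ ∈ H²(𝕋; L²(ℝ)) ∩ H¹(𝕋; H¹(ℝ)) : Φ(·,0) ∈ H²(𝕋)}` with its natural norm.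
An element is stored as `(Φ, Φₓ, Φₓₓ, Φ_y, Φ_xy, Φ(·,0))`, and the norm is (equivalent to) the
sum of the `L²`-norms of the first five components and the `H²(𝕋)`-norm of `Φ(·,0)`. The trace
at `y = 0` is the value of the continuous representative, which exists for all elements of
`H¹(𝕋; H¹(ℝ))`. -/
def WaveSpace :
    Submodule ℝ (StripL2 × StripL2 × StripL2 × StripL2 × StripL2 × H2Torus) where
  carrier := {Φ | IsH1H1 Φ.1 Φ.2.1 Φ.2.2.2.1 Φ.2.2.2.2.1 ∧ HasWeakDx Φ.2.1 Φ.2.2.1 ∧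
    ∃ u, IsContRep Φ.1 u ∧ (H2Torus.fn Φ.2.2.2.2.2 =ᵐ[torusMeasure] fun x => u x 0)}
  add_mem' := by
    rintro a b ⟨ha, ha', u, hu, hu'⟩ ⟨hb, hb', v, hv, hv'⟩
    refine ⟨⟨ha.dx.add hb.dx, ha.dy.add hb.dy, ha.dxy.add hb.dxy⟩, ha'.add hb', _, hu.add hv, ?_⟩
    filter_upwards [Lp.coeFn_add (H2Torus.fn a.2.2.2.2.2) (H2Torus.fn b.2.2.2.2.2), hu', hv'] with x h1 h2 h3
    exact h1.trans (by rw [Pi.add_apply, h2, h3])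
  zero_mem' := by
    refine ⟨⟨.zero _, .zero _, .zero _⟩, .zero _, _, IsContRep.zero, ?_⟩
    filter_upwards [Lp.coeFn_zero ℝ 2 torusMeasure] with x h1
    exact h1.trans rfl
  smul_mem' := by
    rintro c a ⟨ha, ha', u, hu, hu'⟩
    refine ⟨⟨ha.dx.smul c, ha.dy.smul c, ha.dxy.smul c⟩, ha'.smul c, _, hu.smul c, ?_⟩
    filter_upwards [Lp.coeFn_smul c (H2Torus.fn a.2.2.2.2.2), hu'] with x h1 h2
    exact h1.trans (by rw [Pi.smul_apply, h2, smul_eq_mul])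

namespace WaveSpace

/-- The underlying element of `L²(𝕋 × ℝ)`. -/
def fn (Φ : WaveSpace) : StripL2 := Φ.1.1

/-- `Φₓₓ`. -/
def dxx (Φ : WaveSpace) : StripL2 := Φ.1.2.2.1

/-- `Φ_y`. -/
def dy (Φ : WaveSpace) : StripL2 := Φ.1.2.2.2.1

/-- `Φ(·,0) ∈ H²(𝕋)`. -/
def trace (Φ : WaveSpace) : H2Torus := Φ.1.2.2.2.2.2

end WaveSpace

/-- Weak solutions `Φ ∈ H²(𝕋; L²(ℝ)) ∩ H¹(𝕋; H¹(ℝ)) ∩ C(ℝ; H²(𝕋))` of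
`-Φ_yy - (1 - V(lam, y)) Φₓₓ + Γ(y) (Φ³)ₓₓ = 0` for `V = lam V₀ + W + α δ₀` and `Γ = γ δ₀`.
Here `u` is the continuous representative of `Φ`, and `cube` is `Φ(·,0)³` as an element of
`H²(𝕋)`. The test functions are all `Ψ ∈ H¹(𝕋; H¹(ℝ))`, with continuous representative `v`. -/
def IsWeakSolution (V₀ W : ℝ → ℝ) (α γ lam : ℝ) (Φ : WaveSpace) : Prop :=
  ∃ u : ℝ → ℝ → ℝ, IsContRep (WaveSpace.fn Φ) u ∧
    (∃ c : ℝ → H2Torus, Continuous c ∧ ∀ y, H2Torus.fn (c y) =ᵐ[torusMeasure] fun x => u x y) ∧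
    ∃ cube : H2Torus, (H2Torus.fn cube =ᵐ[torusMeasure] fun x => u x 0 ^ 3) ∧
      ∀ (Ψ Ψx Ψy Ψxy : StripL2) (v : ℝ → ℝ → ℝ), IsH1H1 Ψ Ψx Ψy Ψxy → IsContRep Ψ v →
        (∫ p, (WaveSpace.dy Φ p * Ψy p
            - (1 - lam * V₀ p.2 - W p.2) * WaveSpace.dxx Φ p * Ψ p) ∂stripMeasure)
          + (∫ x, (α * H2Torus.dxx (WaveSpace.trace Φ) x + γ * H2Torus.dxx cube x) * v x 0
            ∂torusMeasure) = 0

end DeltaWave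

end

open MeasureTheory Set Filter Topology
open scoped ContDiff

noncomputable section

namespace DeltaWave

/-! ## Calculus of weak derivatives on the line -/

/-! Away from `y = 0` the equation is linear with constant coefficients, so with `s = √(1 - λ)`
every mode `e^{-ks|y|} sin(kx)` solves it there. For a superposition with coefficients `a_k` only
the condition at `y = 0` remains: the jump of the normal derivative balances `α Φ_xx + γ (Φ³)_xx`.
For `x_k = k² a_k` this is an equation in sequence space, `2s D x - α x - γ T(x, x, x) = 0`, where
`D` is diagonal with entries `1/k` and `T` is the product of three sine series
(`linear_form_expWave`, `isWeakSolution_expWave`).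

The space is `ℓ¹` in the variable `x`. It controls two `x`-derivatives of the trace, `T` is bounded
on it because the weight `k²` is submultiplicative up to a constant (`norm_triVec_le`), and a
bounded operator on it is given by any bounded values on the basis (`lift`, `clm_ext`). Linear
identities such as weak derivatives, or the bilinear form tested with a fixed function, therefore
need checking only on single modes.

Since `α = 2 s_*/κ`, the linear part at `s = s_*` has entries `2 s_* (1/k - 1/κ)`. They vanish only
at `k = κ` and stay away from zero otherwise, as `1/k → 0`. In place of an abstract
Crandall-Rabinowitz theorem the amplitude is scaled out: `x = ε w` with `w_κ = κ²`. Because the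
nonlinearity is cubic, only `τ = ε²` survives in `2σ D w - α w - γ τ T(w, w, w) = 0`. The slot `κ`
fixed by the normalization is reused for the unknown `σ - s_*`. The linearization is then diagonal
and invertible, with entry `2κ` in that slot, and the implicit function theorem gives `w(τ), σ(τ)`
(`exists_branch`).

Thus `λ(ε) = 1 - σ(ε²)²` has vanishing first derivative at `0`. The `κ` component reads `2κ (σ -
s_*) = γ τ T(w, w, w)_κ`, and `sin³ = (3 sin - sin(3·))/4` makes the right side `(3/4) γ κ² τ` to
first order. Hence `σ'(0) = 3γκ/8` and `λ''(0) = -(3/2) γ κ s_*`.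

Smoothness of the curve in the wave space also needs smooth dependence on the decay rate. All modes
share one profile evaluated at `r = k|y|`, and differentiating `e^{-sr}` in `s` only produces powers
of `r`, bounded uniformly in `k` (`norm_wave_le`, `hasDerivAt_expWave`).

The spectral hypotheses are explicit. For `Re μ > 0` and `μ² = q - z` the resolvent of `-d²/dy² + q
- c δ₀` is the free Green operator plus a rank-one term, and it exists unless `2μ = c`
(`inResolventSet_opGraph`). -/

lemma integrable_test_mul {𝕜 : Type} [RCLike 𝕜] {Ω : Set ℝ} {u : ℝ → 𝕜} {ψ : ℝ → ℝ}
    (hu : LocallyIntegrableOn u Ω) (hψ : Continuous ψ) (hc : HasCompactSupport ψ)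
    (hs : tsupport ψ ⊆ Ω) : Integrable (fun y => ((ψ y : ℝ) : 𝕜) * u y) := by
  have h1 : IntegrableOn u (tsupport ψ) := hu.integrableOn_compact_subset hs hc
  have h2 : IntegrableOn (fun y => ((ψ y : ℝ) : 𝕜) * u y) (tsupport ψ) :=
    h1.continuousOn_mul (RCLike.continuous_ofReal.comp hψ).continuousOn hc
  refine (integrableOn_iff_integrable_of_support_subset fun y hy => ?_).mp h2
  refine subset_tsupport ψ fun h0 => hy ?_
  simp [h0]

lemma setIntegral_test_mul {𝕜 : Type} [RCLike 𝕜] {Ω : Set ℝ} (u : ℝ → 𝕜) {ψ : ℝ → ℝ}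
    (hs : tsupport ψ ⊆ Ω) :
    ∫ y in Ω, ((ψ y : ℝ) : 𝕜) * u y = ∫ y, ((ψ y : ℝ) : 𝕜) * u y := by
  refine setIntegral_eq_integral_of_forall_compl_eq_zero fun y hy => ?_
  have : ψ y = 0 := image_eq_zero_of_notMem_tsupport fun h => hy (hs h)
  simp [this]

lemma tsupport_deriv_subset' (ψ : ℝ → ℝ) : tsupport (deriv ψ) ⊆ tsupport ψ :=
  closure_minimal support_deriv_subset isClosed_closure

namespace HasWeakDerivOn

variable {𝕜 : Type} [RCLike 𝕜] {Ω Ω' : Set ℝ} {u g u' g' : ℝ → 𝕜}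

lemma integral_line (h : HasWeakDerivOn Ω u g) {ψ : ℝ → ℝ} (hψ : ContDiff ℝ ∞ ψ)
    (hc : HasCompactSupport ψ) (hs : tsupport ψ ⊆ Ω) :
    (∫ y, ((deriv ψ y : ℝ) : 𝕜) * u y) = - (∫ y, ((ψ y : ℝ) : 𝕜) * g y) := by
  rw [← setIntegral_test_mul u ((tsupport_deriv_subset' ψ).trans hs),
    ← setIntegral_test_mul g hs, h.integral_eq ψ hψ hc hs]

lemma of_integral_line (hu : LocallyIntegrableOn u Ω) (hg : LocallyIntegrableOn g Ω)
    (h : ∀ ψ : ℝ → ℝ, ContDiff ℝ ∞ ψ → HasCompactSupport ψ → tsupport ψ ⊆ Ω →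
      (∫ y, ((deriv ψ y : ℝ) : 𝕜) * u y) = - (∫ y, ((ψ y : ℝ) : 𝕜) * g y)) :
    HasWeakDerivOn Ω u g := by
  refine ⟨hu, hg, fun ψ hψ hc hs => ?_⟩
  rw [setIntegral_test_mul u ((tsupport_deriv_subset' ψ).trans hs), setIntegral_test_mul g hs,
    h ψ hψ hc hs]

lemma mono (h : HasWeakDerivOn Ω u g) (hΩ : Ω' ⊆ Ω) : HasWeakDerivOn Ω' u g :=
  of_integral_line (h.locInt.mono_set hΩ) (h.locInt_deriv.mono_set hΩ)
    fun _ hψ hc hs => h.integral_line hψ hc (hs.trans hΩ)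

lemma integrable_left (h : HasWeakDerivOn Ω u g) {ψ : ℝ → ℝ} (hψ : ContDiff ℝ ∞ ψ)
    (hc : HasCompactSupport ψ) (hs : tsupport ψ ⊆ Ω) :
    Integrable (fun y => ((deriv ψ y : ℝ) : 𝕜) * u y) :=
  integrable_test_mul h.locInt (hψ.continuous_deriv (by norm_num)) hc.deriv
    ((tsupport_deriv_subset' ψ).trans hs)

lemma integrable_right (h : HasWeakDerivOn Ω u g) {ψ : ℝ → ℝ} (hψ : ContDiff ℝ ∞ ψ)
    (hc : HasCompactSupport ψ) (hs : tsupport ψ ⊆ Ω) :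
    Integrable (fun y => ((ψ y : ℝ) : 𝕜) * g y) :=
  integrable_test_mul h.locInt_deriv hψ.continuous hc hs

lemma add (h : HasWeakDerivOn Ω u g) (h' : HasWeakDerivOn Ω u' g') :
    HasWeakDerivOn Ω (fun y => u y + u' y) (fun y => g y + g' y) := by
  refine of_integral_line (h.locInt.add h'.locInt) (h.locInt_deriv.add h'.locInt_deriv)
    fun ψ hψ hc hs => ?_
  simp only [mul_add]
  rw [integral_add (h.integrable_left hψ hc hs) (h'.integrable_left hψ hc hs),
    integral_add (h.integrable_right hψ hc hs) (h'.integrable_right hψ hc hs),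
    h.integral_line hψ hc hs, h'.integral_line hψ hc hs]
  ring

lemma const_mul (h : HasWeakDerivOn Ω u g) (c : 𝕜) :
    HasWeakDerivOn Ω (fun y => c * u y) (fun y => c * g y) := by
  refine of_integral_line (h.locInt.smul c) (h.locInt_deriv.smul c) fun ψ hψ hc hs => ?_
  simp only [mul_left_comm _ c]
  rw [integral_const_mul, integral_const_mul, h.integral_line hψ hc hs]
  ring

lemma sub (h : HasWeakDerivOn Ω u g) (h' : HasWeakDerivOn Ω u' g') :
    HasWeakDerivOn Ω (fun y => u y - u' y) (fun y => g y - g' y) := by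
  simpa [sub_eq_add_neg] using h.add (h'.const_mul (-1))

lemma congr (h : HasWeakDerivOn Ω u g)
    (hu : u =ᵐ[volume.restrict Ω] u') (hg : g =ᵐ[volume.restrict Ω] g') :
    HasWeakDerivOn Ω u' g' := by
  refine ⟨h.locInt.congr hu, h.locInt_deriv.congr hg, fun ψ hψ hc hs => ?_⟩
  have e1 : ∫ y in Ω, ((deriv ψ y : ℝ) : 𝕜) * u y = ∫ y in Ω, ((deriv ψ y : ℝ) : 𝕜) * u' y :=
    integral_congr_ae (hu.mono fun y hy => congrArg _ hy)
  have e2 : ∫ y in Ω, ((ψ y : ℝ) : 𝕜) * g y = ∫ y in Ω, ((ψ y : ℝ) : 𝕜) * g' y :=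
    integral_congr_ae (hg.mono fun y hy => congrArg _ hy)
  rw [← e1, ← e2, h.integral_eq ψ hψ hc hs]

lemma ofReal {u g : ℝ → ℝ} (h : HasWeakDerivOn Ω u g) :
    HasWeakDerivOn Ω (fun y => (u y : ℂ)) (fun y => (g y : ℂ)) := by
  have loc : ∀ {w : ℝ → ℝ}, LocallyIntegrableOn w Ω →
      LocallyIntegrableOn (fun y => (w y : ℂ)) Ω := fun hw x hx => by
    obtain ⟨t, ht, hi⟩ := hw x hx
    exact ⟨t, ht, hi.ofReal⟩
  refine of_integral_line (loc h.locInt) (loc h.locInt_deriv) fun ψ hψ hc hs => ?_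
  have := congrArg (fun r : ℝ => (r : ℂ)) (h.integral_line hψ hc hs)
  simp only [Complex.ofReal_neg] at this
  rw [← integral_complex_ofReal, ← integral_complex_ofReal] at this
  simpa using this

/-- Product rule with a smooth complex factor. -/
lemma smooth_mul {u g : ℝ → ℂ} (h : HasWeakDerivOn Ω u g) (hΩ : IsOpen Ω) {e : ℝ → ℂ}
    (he : ContDiff ℝ ∞ e) :
    HasWeakDerivOn Ω (fun y => e y * u y) (fun y => deriv e y * u y + e y * g y) := by
  have hec : Continuous e := he.continuous
  have hdc : Continuous (deriv e) := he.continuous_deriv (by norm_num)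
  have hre : ContDiff ℝ ∞ fun y => (e y).re := Complex.reCLM.contDiff.comp he
  have him : ContDiff ℝ ∞ fun y => (e y).im := Complex.imCLM.contDiff.comp he
  have hd : ∀ y, HasDerivAt e (deriv e y) y := fun y =>
    (he.differentiable (by norm_num) y).hasDerivAt
  have hdre : ∀ y, HasDerivAt (fun y => (e y).re) (deriv e y).re y := fun y =>
    Complex.reCLM.hasFDerivAt.comp_hasDerivAt y (hd y)
  have hdim : ∀ y, HasDerivAt (fun y => (e y).im) (deriv e y).im y := fun y =>
    Complex.imCLM.hasFDerivAt.comp_hasDerivAt y (hd y)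
  have loc : ∀ {f w : ℝ → ℂ}, Continuous f → LocallyIntegrableOn w Ω →
      LocallyIntegrableOn (fun y => f y * w y) Ω := fun hf hw =>
    hw.continuousOn_mul hf.continuousOn hΩ.isLocallyClosed
  refine of_integral_line (loc hec h.locInt)
    ((loc hdc h.locInt).add (loc hec h.locInt_deriv)) fun ψ hψ hc hs => ?_
  -- Test functions are real, so the complex factor `e` cannot be absorbed into them. The rule is
  -- proved for real factors `r`, with `ψ r` as test function, and applied to the real and imaginary
  -- parts of `e`.
  have key : ∀ r : ℝ → ℝ, ContDiff ℝ ∞ r → ∀ r' : ℝ → ℝ, (∀ y, HasDerivAt r (r' y) y) →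
      Integrable (fun y => ((deriv ψ y * r y : ℝ) : ℂ) * u y) ∧
      Integrable (fun y => ((ψ y * r' y : ℝ) : ℂ) * u y) ∧
      Integrable (fun y => ((ψ y * r y : ℝ) : ℂ) * g y) ∧
      ∫ y, ((deriv ψ y * r y : ℝ) : ℂ) * u y = - (∫ y, ((ψ y * r' y : ℝ) : ℂ) * u y)
        - (∫ y, ((ψ y * r y : ℝ) : ℂ) * g y) := by
    intro r hr r' hr'
    have e1 : deriv r = r' := funext fun y => (hr' y).deriv
    have hr'c : Continuous r' := e1 ▸ hr.continuous_deriv (by norm_num)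
    have hψr : ContDiff ℝ ∞ fun y => ψ y * r y := hψ.mul hr
    have hcr : HasCompactSupport fun y => ψ y * r y := hc.mul_right
    have sup : ∀ {q : ℝ → ℝ}, tsupport (fun y => ψ y * q y) ⊆ Ω := fun {q} =>
      (closure_mono (fun y hy => by
        simp only [Function.mem_support] at hy ⊢; exact left_ne_zero_of_mul hy)).trans hs
    have i2 : Integrable (fun y => ((ψ y * r' y : ℝ) : ℂ) * u y) :=
      integrable_test_mul (𝕜 := ℂ) h.locInt (hψ.continuous.mul hr'c) hc.mul_right sup
    have i3 : Integrable (fun y => ((ψ y * r y : ℝ) : ℂ) * g y) :=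
      integrable_test_mul (𝕜 := ℂ) h.locInt_deriv hψr.continuous hcr sup
    have i1 : Integrable (fun y => ((deriv ψ y * r y : ℝ) : ℂ) * u y) := by
      refine integrable_test_mul (𝕜 := ℂ) h.locInt
        ((hψ.continuous_deriv (by norm_num)).mul hr.continuous) hc.deriv.mul_right ?_
      refine (closure_mono fun y hy => ?_).trans ((tsupport_deriv_subset' ψ).trans hs)
      simp only [Function.mem_support] at hy ⊢; exact left_ne_zero_of_mul hy
    refine ⟨i1, i2, i3, ?_⟩
    have hl := h.integral_line hψr hcr sup
    have hder : ∀ y, deriv (fun y => ψ y * r y) y = deriv ψ y * r y + ψ y * r' y := fun y =>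
      ((hψ.differentiable (by norm_num) y).hasDerivAt.mul (hr' y)).deriv
    have e2 : ∫ y, ((deriv (fun y => ψ y * r y) y : ℝ) : ℂ) * u y
        = ∫ y, (((deriv ψ y * r y : ℝ) : ℂ) * u y + ((ψ y * r' y : ℝ) : ℂ) * u y) := by
      refine integral_congr_ae (.of_forall fun y => ?_)
      simp only [hder]; push_cast; ring
    change ∫ y, ((deriv (fun y => ψ y * r y) y : ℝ) : ℂ) * u y = _ at hl
    rw [e2, integral_add i1 i2] at hl
    rw [eq_sub_of_add_eq hl, sub_eq_add_neg, add_comm]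
    exact (sub_eq_add_neg _ _).symm
  obtain ⟨a1, a2, a3, a4⟩ := key _ hre _ hdre
  obtain ⟨b1, b2, b3, b4⟩ := key _ him _ hdim
  have e1 : ∫ y, ((deriv ψ y : ℝ) : ℂ) * (e y * u y)
      = ∫ y, (((deriv ψ y * (e y).re : ℝ) : ℂ) * u y
        + Complex.I * (((deriv ψ y * (e y).im : ℝ) : ℂ) * u y)) := by
    refine integral_congr_ae (.of_forall fun y => ?_)
    conv_lhs => simp only []; rw [← Complex.re_add_im (e y)]
    push_cast; ring
  have e2 : ∫ y, ((ψ y : ℝ) : ℂ) * (deriv e y * u y + e y * g y)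
      = ∫ y, ((((ψ y * (deriv e y).re : ℝ) : ℂ) * u y
        + Complex.I * (((ψ y * (deriv e y).im : ℝ) : ℂ) * u y))
        + (((ψ y * (e y).re : ℝ) : ℂ) * g y
        + Complex.I * (((ψ y * (e y).im : ℝ) : ℂ) * g y))) := by
    refine integral_congr_ae (.of_forall fun y => ?_)
    conv_lhs => simp only []; rw [← Complex.re_add_im (e y), ← Complex.re_add_im (deriv e y)]
    push_cast; ring
  change ∫ y, ((deriv ψ y : ℝ) : ℂ) * (e y * u y)
    = - ∫ y, ((ψ y : ℝ) : ℂ) * (deriv e y * u y + e y * g y)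
  rw [e1, e2, integral_add a1 (b1.const_mul _),
    integral_add (a2.fun_add (b2.const_mul _)) (a3.fun_add (b3.const_mul _)),
    integral_add a2 (b2.const_mul _), integral_add a3 (b3.const_mul _), a4]
  simp only [integral_const_mul, b4]
  ring

end HasWeakDerivOn

/-- A continuous function that is differentiable off `0` with a locally integrable derivative has
this derivative as its weak derivative. -/
lemma hasWeakDerivOn_of_hasDerivAt {𝕜 : Type} [RCLike 𝕜] {f f' : ℝ → 𝕜} (hf : Continuous f)
    (hd : ∀ y, y ≠ 0 → HasDerivAt f (f' y) y) (hi : LocallyIntegrable f') :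
    HasWeakDerivOn univ f f' := by
  refine HasWeakDerivOn.of_integral_line (hf.locallyIntegrable.locallyIntegrableOn _)
    (hi.locallyIntegrableOn _) fun ψ hψ hc hs => ?_
  have hl : LocallyIntegrableOn f univ := hf.locallyIntegrable.locallyIntegrableOn _
  have i1 : Integrable fun y => ((deriv ψ y : ℝ) : 𝕜) * f y :=
    integrable_test_mul hl (hψ.continuous_deriv (by norm_num)) hc.deriv (subset_univ _)
  have i2 : Integrable fun y => ((ψ y : ℝ) : 𝕜) * f' y :=
    integrable_test_mul (hi.locallyIntegrableOn _) hψ.continuous hc hs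
  obtain ⟨R, hR⟩ := hc.isCompact.isBounded.subset_closedBall (0 : ℝ)
  have hz : ∀ y, R < |y| → ψ y = 0 := fun y hy => image_eq_zero_of_notMem_tsupport fun h => by
    have := hR h
    simp at this; linarith
  have hψd : ∀ y, HasDerivAt (fun y => ((ψ y : ℝ) : 𝕜)) ((deriv ψ y : ℝ) : 𝕜) y := fun y =>
    (RCLike.ofRealCLM (K := 𝕜)).hasFDerivAt.comp_hasDerivAt y
      (hψ.differentiable (by norm_num) y).hasDerivAt
  -- `R` may be negative when `ψ` has empty support; `|R| + 1` is positive and exceeds `R` in every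
  -- case.
  set S := |R| + 1
  have hS : 0 < S := by positivity
  have hRS : R < S := by have := le_abs_self R; simp only [S]; linarith
  have hFTC := integral_eq_of_hasDerivAt_off_countable (a := -S) (b := S)
    (fun y => ((ψ y : ℝ) : 𝕜) * f y)
    (fun y => ((deriv ψ y : ℝ) : 𝕜) * f y + ((ψ y : ℝ) : 𝕜) * f' y) (countable_singleton (0 : ℝ))
    ((RCLike.continuous_ofReal.comp hψ.continuous).mul hf).continuousOn
    (fun y hy => (hψd y).mul (hd y (by simpa using hy.2))) (i1.add i2).intervalIntegrable
  have hsup : Function.support (fun y => ((deriv ψ y : ℝ) : 𝕜) * f y + ((ψ y : ℝ) : 𝕜) * f' y)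
      ⊆ Ioc (-S) S := by
    intro y hy
    have hy' : y ∈ tsupport ψ := by
      by_contra hcon
      apply hy
      have h1 : deriv ψ y = 0 := image_eq_zero_of_notMem_tsupport
        fun h => hcon (tsupport_deriv_subset' ψ h)
      have h2 : ψ y = 0 := image_eq_zero_of_notMem_tsupport hcon
      simp [h1, h2]
    have := hR hy'
    simp only [Metric.mem_closedBall, dist_zero_right, Real.norm_eq_abs] at this
    have := abs_lt.mp (this.trans_lt hRS)
    exact ⟨this.1, this.2.le⟩
  rw [intervalIntegral.integral_eq_integral_of_support_subset hsup, integral_add i1 i2,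
    hz S (by rwa [abs_of_pos hS]), hz (-S) (by rwa [abs_neg, abs_of_pos hS])] at hFTC
  exact eq_neg_of_add_eq_zero_left (by simpa using hFTC)

end DeltaWave

end

/-! ### Primitives, and first order weak differential equations on an interval. -/

open MeasureTheory Set Filter Topology
open scoped ContDiff

noncomputable section

namespace DeltaWave

/-- The primitive is absolutely continuous on bounded intervals and has derivative `g` almost
everywhere (Lebesgue differentiation). Integration by parts for absolutely continuous functions on
an interval containing the support of `ψ` gives the claim. -/
lemma hasWeakDerivOn_primitive_real {g : ℝ → ℝ} (hg : LocallyIntegrable g) :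
    HasWeakDerivOn univ (fun x => ∫ t in (0 : ℝ)..x, g t) g := by
  have hgi : ∀ a b : ℝ, IntervalIntegrable g volume a b := fun a b =>
    (hg.integrableOn_isCompact isCompact_uIcc).intervalIntegrable
  have hcont : Continuous fun x => ∫ t in (0 : ℝ)..x, g t :=
    intervalIntegral.continuous_primitive hgi 0
  have hl : LocallyIntegrableOn (fun x => ∫ t in (0 : ℝ)..x, g t) univ :=
    hcont.locallyIntegrable.locallyIntegrableOn _
  refine HasWeakDerivOn.of_integral_line hl (hg.locallyIntegrableOn _) fun ψ hψ hc hs => ?_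
  obtain ⟨R, hR⟩ := hc.isCompact.isBounded.subset_closedBall (0 : ℝ)
  set S := |R| + 1 with hSdef
  have hS : 0 < S := by positivity
  have hRS : R < S := by have := le_abs_self R; simp only [S]; linarith
  have hin : tsupport ψ ⊆ Ioo (-S) S := fun y hy => by
    have := hR hy
    simp only [Metric.mem_closedBall, dist_zero_right, Real.norm_eq_abs] at this
    exact abs_lt.mp (this.trans_lt hRS)
  have hz : ∀ y, y ∉ Ioo (-S) S → ψ y = 0 := fun y hy =>
    image_eq_zero_of_notMem_tsupport fun h => hy (hin h)
  have hz' : ∀ y, y ∉ Ioo (-S) S → deriv ψ y = 0 := fun y hy =>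
    image_eq_zero_of_notMem_tsupport fun h => hy (hin (tsupport_deriv_subset' ψ h))
  have a1 : AbsolutelyContinuousOnInterval (fun x => ∫ t in (0 : ℝ)..x, g t) (-S) S :=
    (hgi _ _).absolutelyContinuousOnInterval_intervalIntegral
      (by rw [uIcc_of_le (by linarith)]; constructor <;> linarith)
  have a2 : AbsolutelyContinuousOnInterval ψ (-S) S :=
    (hψ.of_le (by norm_num)).contDiffOn.absolutelyContinuousOnInterval
  have key := a1.integral_mul_deriv_eq_deriv_mul a2
  rw [hz S (by simp), hz (-S) (by simp)] at key
  have e1 : ∫ x in (-S)..S, (∫ t in (0 : ℝ)..x, g t) * deriv ψ x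
      = ∫ x, deriv ψ x * (∫ t in (0 : ℝ)..x, g t) := by
    rw [intervalIntegral.integral_eq_integral_of_support_subset]
    · simp only [mul_comm]
    · intro y hy
      by_contra hcon
      refine hy ?_
      simp only []
      rw [hz' y fun h => hcon (Ioo_subset_Ioc_self h), mul_zero]
  have e2 : ∫ x in (-S)..S, deriv (fun x => ∫ t in (0 : ℝ)..x, g t) x * ψ x
      = ∫ x, ψ x * g x := by
    rw [← intervalIntegral.integral_eq_integral_of_support_subset (a := -S) (b := S)]
    · refine intervalIntegral.integral_congr_ae ?_
      filter_upwards [_root_.LocallyIntegrable.ae_hasDerivAt_integral hg] with x hx _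
      rw [(hx 0).deriv, mul_comm]
    · intro y hy
      by_contra hcon
      refine hy ?_
      simp only []
      rw [hz y fun h => hcon (Ioo_subset_Ioc_self h), zero_mul]
  rw [e1, e2] at key
  simpa using key

/-- The primitive of a locally integrable function has this function as its weak derivative. -/
lemma hasWeakDerivOn_primitive {g : ℝ → ℂ} (hg : LocallyIntegrable g) :
    HasWeakDerivOn univ (fun x => ∫ t in (0 : ℝ)..x, g t) g := by
  have hgi : ∀ a b : ℝ, IntervalIntegrable g volume a b := fun a b =>
    (hg.integrableOn_isCompact isCompact_uIcc).intervalIntegrable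
  have hre : LocallyIntegrable fun y => (g y).re := fun x => by
    obtain ⟨t, ht, hi⟩ := hg x
    exact ⟨t, ht, hi.re⟩
  have him : LocallyIntegrable fun y => (g y).im := fun x => by
    obtain ⟨t, ht, hi⟩ := hg x
    exact ⟨t, ht, hi.im⟩
  have h := (hasWeakDerivOn_primitive_real hre).ofReal.add
    ((hasWeakDerivOn_primitive_real him).ofReal.const_mul Complex.I)
  have iof : ∀ {f : ℝ → ℝ}, LocallyIntegrable f → ∀ x,
      IntervalIntegrable (fun t => (f t : ℂ)) volume 0 x := fun hf x => by
    have h := (hf.integrableOn_isCompact (isCompact_uIcc (a := (0 : ℝ)) (b := x))).intervalIntegrable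
    exact ⟨h.1.ofReal, h.2.ofReal⟩
  have e1 : ∀ x, ((∫ t in (0 : ℝ)..x, (g t).re : ℝ) : ℂ)
      + Complex.I * ((∫ t in (0 : ℝ)..x, (g t).im : ℝ) : ℂ) = ∫ t in (0 : ℝ)..x, g t := by
    intro x
    rw [← intervalIntegral.integral_ofReal, ← intervalIntegral.integral_ofReal,
      ← intervalIntegral.integral_const_mul, ← intervalIntegral.integral_add]
    · refine intervalIntegral.integral_congr fun t _ => ?_
      rw [mul_comm]
      exact Complex.re_add_im (g t)
    · exact iof hre x
    · exact (iof him x).const_mul _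
  refine h.congr (.of_forall fun x => e1 x) (.of_forall fun x => ?_)
  simp only []
  rw [mul_comm]
  exact Complex.re_add_im (g x)

/-- A function with vanishing weak derivative on an open interval is constant there. -/
lemma HasWeakDerivOn.ae_eq_const {𝕜 : Type} [RCLike 𝕜] {Ω : Set ℝ} {u : ℝ → 𝕜}
    (h : HasWeakDerivOn Ω u fun _ => 0) (hΩ : IsOpen Ω) (hΩ' : Ω.OrdConnected) :
    ∃ C : 𝕜, ∀ᵐ y, y ∈ Ω → u y = C := by
  rcases Ω.eq_empty_or_nonempty with rfl | ⟨x₀, hx₀⟩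
  · exact ⟨0, by simp⟩
  obtain ⟨r, hr, hball⟩ := Metric.isOpen_iff.mp hΩ x₀ hx₀
  let f : ContDiffBump x₀ := ⟨r / 4, r / 2, by positivity, by linarith⟩
  set η : ℝ → ℝ := f.normed volume with hη
  have hηc : ContDiff ℝ ∞ η := f.contDiff_normed
  have hηs : HasCompactSupport η := f.hasCompactSupport_normed
  have hηΩ : tsupport η ⊆ Ω := by
    rw [hη, f.tsupport_normed_eq]
    exact (Metric.closedBall_subset_ball (by change r / 2 < r; linarith)).trans hball
  have hη1 : ∫ y, η y = 1 := f.integral_normed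
  refine ⟨∫ y, ((η y : ℝ) : 𝕜) * u y, ?_⟩
  set C := ∫ y, ((η y : ℝ) : 𝕜) * u y with hC
  have hloc : LocallyIntegrableOn (fun y => u y - C) Ω :=
    h.locInt.sub (continuous_const.locallyIntegrable.locallyIntegrableOn _)
  have hmain := hΩ.ae_eq_zero_of_integral_contDiff_smul_eq_zero hloc (μ := volume) ?_
  · filter_upwards [hmain] with y hy hyΩ
    exact sub_eq_zero.mp (hy hyΩ)
  intro φ hφ hφc hφs
  -- The du Bois-Reymond argument: `φ - c η` has mean zero and is therefore the derivative of an
  -- admissible test function, against which `u` integrates to zero. What is left of `∫ φ u` is `c`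
  -- times the mean of `u` against the bump `η`, which is the constant `C`.
  set c := ∫ y, φ y with hc
  set θ : ℝ → ℝ := fun y => φ y - c * η y with hθ
  have hθc : ContDiff ℝ ∞ θ := hφ.sub (contDiff_const.mul hηc)
  have hφi : Integrable φ := hφ.continuous.integrable_of_hasCompactSupport hφc
  have hηi : Integrable η := hηc.continuous.integrable_of_hasCompactSupport hηs
  have hθ0 : ∫ y, θ y = 0 := by
    rw [hθ, integral_sub hφi (hηi.const_mul c), integral_const_mul, hη1, ← hc]; ring
  set K := tsupport φ ∪ tsupport η with hK
  have hKc : IsCompact K := hφc.isCompact.union hηs.isCompact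
  have hKne : K.Nonempty := by
    by_contra hcon
    rw [not_nonempty_iff_eq_empty] at hcon
    have : ∀ y, η y = 0 := fun y => image_eq_zero_of_notMem_tsupport fun hy => by
      have : y ∈ K := Or.inr hy
      rw [hcon] at this; exact this
    simp [this] at hη1
  obtain ⟨m, hm, hm'⟩ := hKc.exists_isLeast hKne
  obtain ⟨M, hM, hM'⟩ := hKc.exists_isGreatest hKne
  have hKΩ : K ⊆ Ω := union_subset hφs hηΩ
  have hIcc : Icc m M ⊆ Ω := hΩ'.out (hKΩ hm) (hKΩ hM)
  have hθz : ∀ y, y ∉ Icc m M → θ y = 0 := fun y hy => by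
    have hyK : y ∉ K := fun h => hy ⟨hm' h, hM' h⟩
    have h1 : φ y = 0 := image_eq_zero_of_notMem_tsupport fun h => hyK (Or.inl h)
    have h2 : η y = 0 := image_eq_zero_of_notMem_tsupport fun h => hyK (Or.inr h)
    simp [hθ, h1, h2]
  -- The base point lies to the left of the support of `θ`, so `ψ` vanishes left of `m`; it vanishes
  -- right of `M` because `θ` has mean zero. Order connectedness of `Ω` keeps the support `[m, M]`
  -- inside `Ω`.
  set ψ : ℝ → ℝ := fun x => ∫ t in (m - 1)..x, θ t with hψ
  have hψd : ∀ x, HasDerivAt ψ (θ x) x := fun x =>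
    intervalIntegral.integral_hasDerivAt_right (hθc.continuous.intervalIntegrable _ _)
      (hθc.continuous.stronglyMeasurableAtFilter _ _) hθc.continuous.continuousAt
  have hψ' : deriv ψ = θ := funext fun x => (hψd x).deriv
  have hψc : ContDiff ℝ ∞ ψ :=
    contDiff_infty_iff_deriv.mpr ⟨fun x => (hψd x).differentiableAt, hψ' ▸ hθc⟩
  have hψz : ∀ y, y ∉ Icc m M → ψ y = 0 := fun y hy => by
    rcases lt_or_ge y m with hlt | hge
    · refine intervalIntegral.integral_zero_ae (.of_forall fun t ht => hθz t fun h => ?_)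
      rcases le_total (m - 1) y with h1 | h1
      · rw [uIoc_of_le h1] at ht; linarith [h.1, ht.2]
      · rw [uIoc_of_ge h1] at ht; linarith [h.1, ht.2]
    · have hyM : M < y := by
        by_contra hcon; exact hy ⟨hge, not_lt.mp hcon⟩
      change ∫ t in (m - 1)..y, θ t = 0
      rw [intervalIntegral.integral_eq_integral_of_support_subset, hθ0]
      intro t ht
      have : t ∈ Icc m M := by
        by_contra hcon; exact ht (hθz t hcon)
      exact ⟨by linarith [this.1], by linarith [this.2]⟩
  have hψs : tsupport ψ ⊆ Icc m M := closure_minimal (fun y hy => by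
    by_contra hcon; exact hy (hψz y hcon)) isClosed_Icc
  have hψcs : HasCompactSupport ψ := HasCompactSupport.of_support_subset_isCompact isCompact_Icc
    ((subset_tsupport ψ).trans hψs)
  have hI := h.integral_line hψc hψcs (hψs.trans hIcc)
  rw [hψ'] at hI
  have i1 : Integrable fun y => ((φ y : ℝ) : 𝕜) * u y :=
    integrable_test_mul h.locInt hφ.continuous hφc hφs
  have i2 : Integrable fun y => ((η y : ℝ) : 𝕜) * u y :=
    integrable_test_mul h.locInt hηc.continuous hηs hηΩ
  have e1 : ∫ y, ((θ y : ℝ) : 𝕜) * u y = (∫ y, ((φ y : ℝ) : 𝕜) * u y) - (c : 𝕜) * C := by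
    rw [hC, ← integral_const_mul, ← integral_sub i1 (i2.const_mul _)]
    refine integral_congr_ae (.of_forall fun y => ?_)
    simp only [hθ]; push_cast; ring
  rw [e1] at hI
  have e2 : ∫ y, φ y • (u y - C) = (∫ y, ((φ y : ℝ) : 𝕜) * u y) - (c : 𝕜) * C := by
    have hcc : (c : 𝕜) = ∫ y, ((φ y : ℝ) : 𝕜) := integral_ofReal.symm
    rw [hcc, ← integral_mul_const, ← integral_sub i1 (hφi.ofReal.mul_const _)]
    refine integral_congr_ae (.of_forall fun y => ?_)
    simp only [RCLike.real_smul_eq_coe_mul]; ring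
  rw [e2, hI]; simp

/-- Weak solutions of `u' = ν u` on an open interval are exponentials. -/
lemma HasWeakDerivOn.ae_eq_exp {Ω : Set ℝ} {u : ℝ → ℂ} {ν : ℂ}
    (h : HasWeakDerivOn Ω u fun y => ν * u y) (hΩ : IsOpen Ω) (hΩ' : Ω.OrdConnected) :
    ∃ C : ℂ, ∀ᵐ y : ℝ, y ∈ Ω → u y = C * Complex.exp (ν * y) := by
  have hd : ∀ y : ℝ, HasDerivAt (fun y : ℝ => Complex.exp (-ν * y))
      (Complex.exp (-ν * y) * (-ν * 1)) y := fun y =>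
    (((hasDerivAt_id (y : ℂ)).const_mul (-ν)).cexp).comp_ofReal
  have hc : ContDiff ℝ ∞ fun y : ℝ => Complex.exp (-ν * y) :=
    Complex.contDiff_exp.comp (contDiff_const.mul Complex.ofRealCLM.contDiff)
  have h1 := h.smooth_mul hΩ hc
  have h2 : HasWeakDerivOn Ω (fun y => Complex.exp (-ν * y) * u y) fun _ => 0 := by
    refine h1.congr (.of_forall fun _ => rfl) (.of_forall fun y => ?_)
    simp only [(hd y).deriv]; ring
  obtain ⟨C, hC⟩ := h2.ae_eq_const hΩ hΩ'
  refine ⟨C, ?_⟩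
  filter_upwards [hC] with y hy hyΩ
  rw [← hy hyΩ, mul_right_comm, ← Complex.exp_add]
  simp

end DeltaWave

end

open MeasureTheory Set Filter Topology
open scoped ContDiff

noncomputable section

namespace DeltaWave

/-! ## The homogeneous equation -/

/-- On `Ω` the exponential has modulus at least `1`, so `f` dominates the constant `C`; a nonzero
constant is not square integrable on a set of infinite measure. -/
lemma eq_zero_of_memLp_exp {Ω : Set ℝ} (hΩ : MeasurableSet Ω) (hv : volume Ω = ⊤) {ν C : ℂ}
    (hν : ∀ y ∈ Ω, 0 ≤ ν.re * y) {f : ℝ → ℂ} (hf : MemLp f 2 (volume.restrict Ω))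
    (h : ∀ᵐ y : ℝ, y ∈ Ω → f y = C * Complex.exp (ν * y)) : C = 0 := by
  have h1 : MemLp (fun _ : ℝ => C) 2 (volume.restrict Ω) := by
    refine hf.mono aestronglyMeasurable_const ?_
    rw [ae_restrict_iff' hΩ]
    filter_upwards [h] with y hy hyΩ
    rw [hy hyΩ, norm_mul, Complex.norm_exp]
    refine le_mul_of_one_le_right (norm_nonneg _) (Real.one_le_exp ?_)
    simpa using hν y hyΩ
  rw [memLp_const_iff (by norm_num) (by norm_num)] at h1
  simpa [hv] using h1

/-- Square integrable solutions of `v'' = ν² v` on a half line. -/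
lemma half_line_solution {Ω : Set ℝ} (hΩ : IsOpen Ω) (hΩ' : Ω.OrdConnected) (hv : volume Ω = ⊤)
    {ν : ℂ} (hν : ∀ y ∈ Ω, 0 ≤ -ν.re * y) {v v₁ v₂ : ℝ → ℂ} (h1 : HasWeakDerivOn Ω v v₁)
    (h2 : HasWeakDerivOn Ω v₁ v₂) (hm : MemLp v 2 (volume.restrict Ω))
    (hm₁ : MemLp v₁ 2 (volume.restrict Ω)) (he : ∀ᵐ y, y ∈ Ω → v₂ y = ν ^ 2 * v y) :
    (∀ᵐ y, y ∈ Ω → v₁ y = ν * v y) ∧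
      ∃ A : ℂ, ∀ᵐ y : ℝ, y ∈ Ω → v y = A * Complex.exp (ν * y) := by
  -- Factorization of `d²/dy² - ν²` as `(d/dy + ν)(d/dy - ν)`: the function `v₁ - ν v` is a multiple
  -- of `e^{-νy}`, whose modulus is at least `1` on `Ω`, and square integrability forces it to
  -- vanish.
  have hz : HasWeakDerivOn Ω (fun y => v₁ y - ν * v y) fun y => -ν * (v₁ y - ν * v y) := by
    refine (h2.sub (h1.const_mul ν)).congr (.of_forall fun _ => rfl) ?_
    rw [EventuallyEq, ae_restrict_iff' hΩ.measurableSet]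
    filter_upwards [he] with y hy hyΩ
    rw [hy hyΩ]; ring
  obtain ⟨C, hC⟩ := hz.ae_eq_exp hΩ hΩ'
  have hC0 : C = 0 := eq_zero_of_memLp_exp hΩ.measurableSet hv (ν := -ν) (by simpa using hν)
    (hm₁.sub (hm.const_mul ν)) hC
  have hfst : ∀ᵐ y, y ∈ Ω → v₁ y = ν * v y := by
    filter_upwards [hC] with y hy hyΩ
    have := hy hyΩ
    rw [hC0, zero_mul] at this
    exact sub_eq_zero.mp this
  refine ⟨hfst, ?_⟩
  have h3 : HasWeakDerivOn Ω v fun y => ν * v y := by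
    refine h1.congr (.of_forall fun _ => rfl) ?_
    rwa [EventuallyEq, ae_restrict_iff' hΩ.measurableSet]
  exact h3.ae_eq_exp hΩ hΩ'

lemma continuous_cexp_mul (ν : ℂ) : Continuous fun y : ℝ => Complex.exp (ν * y) := by fun_prop

lemma eqOn_of_ae_mem {Ω : Set ℝ} (hΩ : IsOpen Ω) {f g : ℝ → ℂ} (hf : ContinuousOn f Ω)
    (hg : ContinuousOn g Ω) (h : ∀ᵐ y, y ∈ Ω → f y = g y) : EqOn f g Ω :=
  Measure.eqOn_open_of_ae_eq ((ae_restrict_iff' hΩ.measurableSet).mpr h) hΩ hf hg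

/-- The one-sided traces of a square integrable solution on a half line ending at `0`. -/
lemma half_line_trace {Ω : Set ℝ} (hΩ : IsOpen Ω) (hΩ' : Ω.OrdConnected) (hv : volume Ω = ⊤)
    (h0 : (𝓝[Ω] (0 : ℝ)).NeBot) (hn0 : (0 : ℝ) ∉ Ω)
    {ν : ℂ} (hν : ∀ y ∈ Ω, 0 ≤ -ν.re * y) {v v₁ v₂ : ℝ → ℂ} {r : ℂ} (hvc : Continuous v)
    (h1 : HasWeakDerivOn Ω v v₁)
    (h2 : HasWeakDerivOn Ω v₁ v₂) (hm : MemLp v 2 (volume.restrict Ω))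
    (hm₁ : MemLp v₁ 2 (volume.restrict Ω)) (he : ∀ᵐ y, y ∈ Ω → v₂ y = ν ^ 2 * v y)
    (hv₁c : ContinuousOn v₁ {0}ᶜ) (hr : Tendsto v₁ (𝓝[Ω] 0) (𝓝 r)) :
    (∀ y ∈ Ω, v y = v 0 * Complex.exp (ν * y)) ∧ r = ν * v 0 := by
  obtain ⟨e1, A, e2⟩ := half_line_solution hΩ hΩ' hv hν h1 h2 hm hm₁ he
  have e2' := eqOn_of_ae_mem hΩ hvc.continuousOn
    (continuous_const.mul (continuous_cexp_mul ν)).continuousOn e2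
  have e1' := eqOn_of_ae_mem hΩ
    (hv₁c.mono fun y hy => by rintro rfl; exact hn0 hy)
    (continuous_const.mul hvc).continuousOn e1
  have hA : v 0 = A := by
    have t1 : Tendsto v (𝓝[Ω] 0) (𝓝 (v 0)) := (hvc.tendsto 0).mono_left nhdsWithin_le_nhds
    have t2 : Tendsto v (𝓝[Ω] 0) (𝓝 A) := by
      have : Tendsto (fun y : ℝ => A * Complex.exp (ν * y)) (𝓝[Ω] 0)
          (𝓝 (A * Complex.exp (ν * (0 : ℝ)))) :=
        ((continuous_const.mul (continuous_cexp_mul ν)).tendsto 0).mono_left nhdsWithin_le_nhds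
      simp only [Complex.ofReal_zero, mul_zero, Complex.exp_zero, mul_one] at this
      exact this.congr' (by filter_upwards [self_mem_nhdsWithin] with y hy using (e2' hy).symm)
    exact tendsto_nhds_unique t1 t2
  refine ⟨fun y hy => by rw [hA]; exact e2' hy, ?_⟩
  have t3 : Tendsto v₁ (𝓝[Ω] 0) (𝓝 (ν * v 0)) := by
    have : Tendsto (fun y : ℝ => ν * v y) (𝓝[Ω] 0) (𝓝 (ν * v 0)) :=
      ((continuous_const.mul hvc).tendsto 0).mono_left nhdsWithin_le_nhds
    exact this.congr' (by filter_upwards [self_mem_nhdsWithin] with y hy using (e1' hy).symm)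
  exact tendsto_nhds_unique hr t3

lemma OpMapsTo.sub {q : ℝ → ℝ} {c : ℝ} {u f u' f' : LineL2} (h : OpMapsTo q c u f)
    (h' : OpMapsTo q c u' f') : OpMapsTo q c (u - u') (f - f') := by
  obtain ⟨v, v₁, v₂, l, r, a1, a2, a3, a4, a5, a6, a7, a8, a9, a10, a11, a12⟩ := h
  obtain ⟨v', v₁', v₂', l', r', b1, b2, b3, b4, b5, b6, b7, b8, b9, b10, b11, b12⟩ := h'
  refine ⟨fun y => v y - v' y, fun y => v₁ y - v₁' y, fun y => v₂ y - v₂' y, l - l', r - r',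
    ?_, a2.sub b2, a3.sub b3, a4.sub b4, a5.sub b5, a6.sub b6, a7.sub b7, a8.sub b8, a9.sub b9,
    a10.sub b10, ?_, ?_⟩
  · filter_upwards [Lp.coeFn_sub u u', a1, b1] with y e1 e2 e3
    rw [e1, Pi.sub_apply, e2, e3]
  · linear_combination a11 - b11
  · filter_upwards [Lp.coeFn_sub f f', a12, b12] with y e1 e2 e3
    rw [e1, Pi.sub_apply, e2, e3]; ring

/-- Solutions of `-v'' + q v - c δ₀ v = z v`. -/
lemma OpMapsTo.eigenfunction {q c : ℝ} {z μ : ℂ} (hμ : 0 < μ.re) (hz : μ ^ 2 = q - z)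
    {u f : LineL2} (h : OpMapsTo (fun _ => q) c u f) (hf : f =ᵐ[volume] fun y => z * u y) :
    ∃ A : ℂ, (u =ᵐ[volume] fun y => A * Complex.exp (-μ * |y|)) ∧ (2 * μ - c) * A = 0 := by
  obtain ⟨v, v₁, v₂, l, r, a1, a2, a3, a4, a5, a6, a7, a8, a9, a10, a11, a12⟩ := h
  have hm : MemLp v 2 volume := (memLp_congr_ae a1).mp (Lp.memLp u)
  have he : ∀ᵐ y, v₂ y = μ ^ 2 * v y := by
    filter_upwards [a1, a12, hf] with y e1 e2 e3
    rw [e3, e1] at e2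
    rw [hz]; linear_combination e2
  -- Only the decaying exponential survives on each side, so the one-sided derivatives at `0` are
  -- `-μ v(0)` and `μ v(0)`, and the jump condition becomes `(2μ - c) v(0) = 0`.
  obtain ⟨p1, p2⟩ := half_line_trace isOpen_Ioi ordConnected_Ioi Real.volume_Ioi inferInstance
    (by simp) (ν := -μ) (fun y (hy : 0 < y) => by simp only [Complex.neg_re]; nlinarith) a2
    (a3.mono (subset_univ _)) a6 (hm.restrict _) (a4.restrict _)
    (he.mono fun y hy _ => by rw [hy, neg_sq]) a8 a10
  obtain ⟨q1, q2⟩ := half_line_trace isOpen_Iio ordConnected_Iio Real.volume_Iio inferInstance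
    (by simp) (ν := μ) (fun y (hy : y < 0) => by nlinarith) a2
    (a3.mono (subset_univ _)) a5 (hm.restrict _) (a4.restrict _) (he.mono fun y hy _ => hy) a8 a9
  refine ⟨v 0, ?_, ?_⟩
  · refine a1.trans (.of_forall fun y => ?_)
    rcases lt_trichotomy y 0 with hy | rfl | hy
    · simp only [q1 y hy, abs_of_neg hy]; push_cast; ring_nf
    · simp
    · simp only [p1 y hy, abs_of_pos hy]
  · linear_combination -a11 + p2 - q2

end DeltaWave

end

open MeasureTheory Set Filter Topology
open scoped ContDiff

noncomputable section

namespace DeltaWave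

/-! ## Convolution with an exponential -/

/-- Young's inequality `‖K * G‖₂ ≤ ‖K‖₁ ‖G‖₂` on the line. -/
lemma lintegral_convolution_sq_le {K G : ℝ → ENNReal} (hK : Measurable K) (hG : Measurable G) :
    ∫⁻ x, (∫⁻ t, K (x - t) * G t) ^ (2 : ℝ) ≤ (∫⁻ s, K s) ^ (2 : ℝ) * ∫⁻ t, G t ^ (2 : ℝ) := by
  have hKx : ∀ x, ∫⁻ t, K (x - t) = ∫⁻ s, K s := fun x => lintegral_sub_left_eq_self K x
  have hKt : ∀ t, ∫⁻ x, K (x - t) = ∫⁻ s, K s := fun t => lintegral_sub_right_eq_self K t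
  -- Cauchy-Schwarz after splitting `K = K^{1/2} K^{1/2}`. Integrating in `x` by Tonelli then
  -- produces the second factor `‖K‖₁`.
  have hcs : ∀ x, (∫⁻ t, K (x - t) * G t) ^ (2 : ℝ)
      ≤ (∫⁻ s, K s) * ∫⁻ t, K (x - t) * G t ^ (2 : ℝ) := by
    intro x
    have hKm : Measurable fun t => K (x - t) := hK.comp (measurable_const.sub measurable_id)
    have h := ENNReal.lintegral_mul_le_Lp_mul_Lq volume Real.HolderConjugate.two_two
      (f := fun t => K (x - t) ^ (1 / 2 : ℝ)) (g := fun t => K (x - t) ^ (1 / 2 : ℝ) * G t)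
      (hKm.pow_const _).aemeasurable ((hKm.pow_const _).mul hG).aemeasurable
    have e1 : ∀ t, ((fun t => K (x - t) ^ (1 / 2 : ℝ)) * fun t => K (x - t) ^ (1 / 2 : ℝ) * G t) t
        = K (x - t) * G t := fun t => by
      simp only [Pi.mul_apply]
      rw [← mul_assoc, ← ENNReal.rpow_add_of_nonneg _ _ (by norm_num) (by norm_num)]
      norm_num
    have e2 : ∀ t, (K (x - t) ^ (1 / 2 : ℝ)) ^ (2 : ℝ) = K (x - t) := fun t => by
      rw [← ENNReal.rpow_mul]; norm_num
    have e3 : ∀ t, (K (x - t) ^ (1 / 2 : ℝ) * G t) ^ (2 : ℝ) = K (x - t) * G t ^ (2 : ℝ) :=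
      fun t => by rw [ENNReal.mul_rpow_of_nonneg _ _ (by norm_num), e2]
    simp only [e1, e2, e3, hKx] at h
    calc _ ≤ ((∫⁻ s, K s) ^ (1 / 2 : ℝ) * (∫⁻ t, K (x - t) * G t ^ (2 : ℝ)) ^ (1 / 2 : ℝ)) ^ (2 : ℝ) :=
          ENNReal.rpow_le_rpow h (by norm_num)
      _ = _ := by
          rw [ENNReal.mul_rpow_of_nonneg _ _ (by norm_num), ← ENNReal.rpow_mul, ← ENNReal.rpow_mul]
          norm_num
  have hm : Measurable fun p : ℝ × ℝ => K (p.1 - p.2) * G p.2 ^ (2 : ℝ) :=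
    (hK.comp (measurable_fst.sub measurable_snd)).mul ((hG.comp measurable_snd).pow_const _)
  calc _ ≤ ∫⁻ x, (∫⁻ s, K s) * ∫⁻ t, K (x - t) * G t ^ (2 : ℝ) := lintegral_mono hcs
    _ = (∫⁻ s, K s) * ∫⁻ x, ∫⁻ t, K (x - t) * G t ^ (2 : ℝ) :=
        lintegral_const_mul _ hm.lintegral_prod_right'
    _ = (∫⁻ s, K s) * ∫⁻ t, ∫⁻ x, K (x - t) * G t ^ (2 : ℝ) := by
        rw [lintegral_lintegral_swap hm.aemeasurable]
    _ = (∫⁻ s, K s) * ∫⁻ t, (∫⁻ s, K s) * G t ^ (2 : ℝ) := by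
        congr 1
        refine lintegral_congr fun t => ?_
        have : Measurable fun x => K (x - t) := hK.comp (measurable_id.sub measurable_const)
        rw [lintegral_mul_const _ this, hKt]
    _ = _ := by
        rw [lintegral_const_mul _ (hG.pow_const _), ← mul_assoc]
        congr 1
        rw [show (2 : ℝ) = ((2 : ℕ) : ℝ) by norm_num, ENNReal.rpow_natCast, sq]

lemma integrable_exp_neg_mul_abs {a : ℝ} (ha : 0 < a) :
    Integrable fun s : ℝ => Real.exp (-a * |s|) := by
  have h1 : IntegrableOn (fun s : ℝ => Real.exp (-a * |s|)) (Iic 0) :=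
    (integrableOn_exp_mul_Iic ha 0).congr_fun (fun s (hs : s ≤ 0) => by
      simp only [abs_of_nonpos hs]; ring_nf) measurableSet_Iic
  have h2 : IntegrableOn (fun s : ℝ => Real.exp (-a * |s|)) (Ioi 0) :=
    (integrableOn_exp_mul_Ioi (a := -a) (by linarith) 0).congr_fun (fun s (hs : 0 < s) => by
      simp only [abs_of_pos hs]) measurableSet_Ioi
  have := h1.union h2
  rwa [Iic_union_Ioi, integrableOn_univ] at this

lemma memLp_exp_neg_mul_abs {a : ℝ} (ha : 0 < a) :
    MemLp (fun s : ℝ => Real.exp (-a * |s|)) 2 := by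
  rw [memLp_two_iff_integrable_sq (by fun_prop)]
  refine (integrable_exp_neg_mul_abs (a := 2 * a) (by linarith)).congr (.of_forall fun s => ?_)
  simp only [← Real.exp_nat_mul]; congr 1; push_cast; ring

lemma memLp_cexp_neg_mul_abs {μ : ℂ} (hμ : 0 < μ.re) :
    MemLp (fun s : ℝ => Complex.exp (-μ * |s|)) 2 := by
  refine (memLp_exp_neg_mul_abs hμ).mono (by fun_prop) (.of_forall fun s => ?_)
  simp [Complex.norm_exp]

/-- The kernel bound `e^{-a|s|}` in `ℝ≥0∞`. -/
def expKer (a s : ℝ) : ENNReal := ENNReal.ofReal (Real.exp (-a * |s|))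

lemma measurable_expKer (a : ℝ) : Measurable (expKer a) := by unfold expKer; fun_prop

lemma lintegral_expKer_lt_top {a : ℝ} (ha : 0 < a) : ∫⁻ s, expKer a s < ⊤ :=
  (integrable_exp_neg_mul_abs ha).lintegral_lt_top

lemma eLpNorm_le_of_expKer_bound {a : ℝ} {F g : ℝ → ℂ} (hg : Measurable g)
    (h : ∀ x, ‖F x‖ₑ ≤ ∫⁻ t, expKer a (x - t) * ‖g t‖ₑ) :
    eLpNorm F 2 volume ≤ (∫⁻ s, expKer a s) * eLpNorm g 2 volume := by
  rw [eLpNorm_eq_lintegral_rpow_enorm_toReal (by norm_num) (by norm_num),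
    eLpNorm_eq_lintegral_rpow_enorm_toReal (by norm_num) (by norm_num)]
  simp only [ENNReal.toReal_ofNat]
  calc (∫⁻ x, ‖F x‖ₑ ^ (2 : ℝ)) ^ (1 / (2 : ℝ))
      ≤ (∫⁻ x, (∫⁻ t, expKer a (x - t) * ‖g t‖ₑ) ^ (2 : ℝ)) ^ (1 / (2 : ℝ)) :=
        ENNReal.rpow_le_rpow (lintegral_mono fun x => ENNReal.rpow_le_rpow (h x) (by norm_num))
          (by norm_num)
    _ ≤ ((∫⁻ s, expKer a s) ^ (2 : ℝ) * ∫⁻ t, ‖g t‖ₑ ^ (2 : ℝ)) ^ (1 / (2 : ℝ)) :=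
        ENNReal.rpow_le_rpow (lintegral_convolution_sq_le (measurable_expKer a) hg.enorm)
          (by norm_num)
    _ = _ := by
        rw [ENNReal.mul_rpow_of_nonneg _ _ (by norm_num), ← ENNReal.rpow_mul]; norm_num

/-- `∫_{-∞}^x e^{-μ(x-t)} g(t) dt`. -/
def causal (μ : ℂ) (g : ℝ → ℂ) (x : ℝ) : ℂ :=
  Complex.exp (-μ * x) * ∫ t in Iic x, Complex.exp (μ * t) * g t

/-- `∫_x^∞ e^{-μ(t-x)} g(t) dt`. -/
def anticausal (μ : ℂ) (g : ℝ → ℂ) (x : ℝ) : ℂ := causal μ (fun t => g (-t)) (-x)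

section causal

variable {μ : ℂ} {g h : ℝ → ℂ}

lemma integrableOn_cexp_mul (hμ : 0 < μ.re) (hg : MemLp g 2) (x : ℝ) :
    IntegrableOn (fun t : ℝ => Complex.exp (μ * t) * g t) (Iic x) := by
  have h1 : MemLp (fun t : ℝ => Complex.exp (μ * t)) 2 (volume.restrict (Iic x)) := by
    rw [memLp_two_iff_integrable_sq_norm (by fun_prop)]
    refine (integrableOn_exp_mul_Iic (a := 2 * μ.re) (by linarith) x).congr
      (.of_forall fun s => ?_)
    simp only [Complex.norm_exp, ← Real.exp_nat_mul]; congr 1; simp; ring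
  exact h1.integrable_mul (hg.restrict _)

lemma memLp_comp_neg (hg : MemLp g 2) : MemLp (fun t => g (-t)) 2 :=
  hg.comp_measurePreserving (Measure.measurePreserving_neg volume)

lemma causal_add (hμ : 0 < μ.re) (hg : MemLp g 2) (hh : MemLp h 2) (x : ℝ) :
    causal μ (fun t => g t + h t) x = causal μ g x + causal μ h x := by
  unfold causal
  rw [← mul_add, ← integral_add (integrableOn_cexp_mul hμ hg x) (integrableOn_cexp_mul hμ hh x)]
  simp only [mul_add]

lemma causal_const_mul (c : ℂ) (g : ℝ → ℂ) (x : ℝ) :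
    causal μ (fun t => c * g t) x = c * causal μ g x := by
  unfold causal
  have e : ∀ t : ℝ, Complex.exp (μ * t) * (c * g t) = c * (Complex.exp (μ * t) * g t) :=
    fun t => by ring
  simp only [e, integral_const_mul]
  ring

lemma causal_congr (hgh : g =ᵐ[volume] h) (x : ℝ) : causal μ g x = causal μ h x := by
  unfold causal
  congr 1
  refine integral_congr_ae (ae_restrict_of_ae ?_)
  filter_upwards [hgh] with t ht
  rw [ht]

lemma locallyIntegrable_of_memLp (hg : MemLp g 2) : LocallyIntegrable g :=
  hg.locallyIntegrable (by norm_num)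

/-- With the base point moved to `0`, the dependence on `x` is a smooth factor times a primitive, so
continuity and the weak derivative can be read off. -/
lemma causal_eq (hμ : 0 < μ.re) (hg : MemLp g 2) (x : ℝ) :
    causal μ g x = Complex.exp (-μ * x) * ((∫ t in Iic (0 : ℝ), Complex.exp (μ * t) * g t)
      + ∫ t in (0 : ℝ)..x, Complex.exp (μ * t) * g t) := by
  unfold causal
  rw [← intervalIntegral.integral_Iic_sub_Iic (integrableOn_cexp_mul hμ hg 0)
    (integrableOn_cexp_mul hμ hg x)]
  ring

lemma locallyIntegrable_cexp_mul (hg : MemLp g 2) :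
    LocallyIntegrable fun t : ℝ => Complex.exp (μ * t) * g t := by
  have := ((locallyIntegrable_of_memLp hg).locallyIntegrableOn univ).continuousOn_mul
    (continuous_cexp_mul μ).continuousOn isOpen_univ.isLocallyClosed
  rwa [locallyIntegrableOn_univ] at this

lemma continuous_causal (hμ : 0 < μ.re) (hg : MemLp g 2) : Continuous (causal μ g) := by
  have : causal μ g = fun x : ℝ => _ := funext (causal_eq hμ hg)
  rw [this]
  refine (continuous_cexp_mul _).mul (continuous_const.add
    (intervalIntegral.continuous_primitive (fun a b => ?_) 0))
  exact ((locallyIntegrable_cexp_mul hg).integrableOn_isCompact isCompact_uIcc).intervalIntegrable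

lemma hasWeakDerivOn_const (c : ℂ) : HasWeakDerivOn univ (fun _ => c) fun _ => (0 : ℂ) :=
  hasWeakDerivOn_of_hasDerivAt continuous_const (fun y _ => hasDerivAt_const y c)
    continuous_const.locallyIntegrable

lemma hasWeakDerivOn_causal (hμ : 0 < μ.re) (hg : MemLp g 2) :
    HasWeakDerivOn univ (causal μ g) fun x => g x - μ * causal μ g x := by
  have hd : ∀ y : ℝ, HasDerivAt (fun y : ℝ => Complex.exp (-μ * y))
      (Complex.exp (-μ * y) * (-μ * 1)) y := fun y =>
    (((hasDerivAt_id (y : ℂ)).const_mul (-μ)).cexp).comp_ofReal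
  have hc : ContDiff ℝ ∞ fun y : ℝ => Complex.exp (-μ * y) :=
    Complex.contDiff_exp.comp (contDiff_const.mul Complex.ofRealCLM.contDiff)
  have h1 := ((hasWeakDerivOn_const (∫ t in Iic (0 : ℝ), Complex.exp (μ * t) * g t)).add
    (hasWeakDerivOn_primitive (locallyIntegrable_cexp_mul (μ := μ) hg))).smooth_mul isOpen_univ hc
  refine h1.congr (.of_forall fun x => (causal_eq hμ hg x).symm) (.of_forall fun x => ?_)
  simp only [causal_eq hμ hg x, (hd x).deriv, zero_add]
  rw [← mul_assoc (Complex.exp (-μ * x)) (Complex.exp (μ * x)), ← Complex.exp_add]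
  simp only [neg_mul, neg_add_cancel, Complex.exp_zero]
  ring

lemma enorm_causal_le (x : ℝ) :
    ‖causal μ g x‖ₑ ≤ ∫⁻ t, expKer μ.re (x - t) * ‖g t‖ₑ := by
  unfold causal
  rw [← integral_const_mul]
  refine (enorm_integral_le_lintegral_enorm _).trans ?_
  refine le_trans ?_ (setLIntegral_le_lintegral (Iic x) _)
  refine lintegral_mono_ae ?_
  rw [ae_restrict_iff' measurableSet_Iic]
  refine .of_forall fun t (ht : t ≤ x) => ?_
  rw [← mul_assoc, ← Complex.exp_add, enorm_mul]
  gcongr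
  rw [expKer, ← ofReal_norm, Complex.norm_exp, abs_of_nonneg (by linarith)]
  refine le_of_eq (congrArg _ (congrArg _ ?_))
  simp; ring

lemma enorm_anticausal_le (x : ℝ) :
    ‖anticausal μ g x‖ₑ ≤ ∫⁻ t, expKer μ.re (x - t) * ‖g t‖ₑ := by
  refine (enorm_causal_le (-x)).trans (le_of_eq ?_)
  rw [← lintegral_neg_eq_self (fun t => expKer μ.re (x - t) * ‖g t‖ₑ)]
  refine lintegral_congr fun t => ?_
  rw [expKer, expKer, ← abs_neg (-x - t)]
  congr 5; ring

lemma HasWeakDerivOn.comp_neg {u w : ℝ → ℂ} (h : HasWeakDerivOn univ u w) :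
    HasWeakDerivOn univ (fun x => u (-x)) fun x => - w (-x) := by
  have loc : ∀ {f : ℝ → ℂ}, LocallyIntegrableOn f univ →
      LocallyIntegrableOn (fun x => f (-x)) univ := fun {f} hf => by
    rw [locallyIntegrableOn_univ] at hf ⊢
    rw [locallyIntegrable_iff] at hf ⊢
    intro k hk
    have h2 := hf (k := -k) hk.neg
    have := (Measure.measurePreserving_neg (volume : Measure ℝ)).integrableOn_comp_preimage
      (MeasurableEquiv.neg ℝ).measurableEmbedding (f := f) (s := -k)
    simpa [Function.comp_def] using this.mpr h2
  have hl := loc h.locInt_deriv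
  have hl' : LocallyIntegrableOn (fun x => - w (-x)) univ := by
    rw [locallyIntegrableOn_univ] at hl ⊢
    exact hl.neg
  refine HasWeakDerivOn.of_integral_line (loc h.locInt) hl' fun ψ hψ hc hs => ?_
  have hψn : ContDiff ℝ ∞ fun y => ψ (-y) := hψ.comp contDiff_neg
  have h1 := h.integral_line hψn (hc.comp_homeomorph (Homeomorph.neg ℝ)) (subset_univ _)
  have hd : ∀ y, deriv (fun y => ψ (-y)) y = - deriv ψ (-y) := fun y => deriv_comp_neg ψ y
  have i1 := integral_neg_eq_self (fun y => ((deriv ψ y : ℝ) : ℂ) * u (-y)) volume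
  have i2 := integral_neg_eq_self (fun y => ((ψ y : ℝ) : ℂ) * - w (-y)) volume
  refine i1.symm.trans (Eq.trans ?_ (congrArg Neg.neg i2))
  simp only [hd] at h1
  simp only [neg_neg, mul_neg, integral_neg]
  simp only [RCLike.ofReal_neg, neg_mul, integral_neg, neg_inj] at h1
  exact h1

lemma hasWeakDerivOn_anticausal (hμ : 0 < μ.re) (hg : MemLp g 2) :
    HasWeakDerivOn univ (anticausal μ g) fun x => μ * anticausal μ g x - g x := by
  refine (hasWeakDerivOn_causal hμ (memLp_comp_neg hg)).comp_neg.congr (.of_forall fun _ => rfl)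
    (.of_forall fun x => ?_)
  simp only [anticausal, neg_neg]; ring

lemma continuous_anticausal (hμ : 0 < μ.re) (hg : MemLp g 2) : Continuous (anticausal μ g) :=
  (continuous_causal hμ (memLp_comp_neg hg)).comp continuous_neg

lemma anticausal_add (hμ : 0 < μ.re) (hg : MemLp g 2) (hh : MemLp h 2) (x : ℝ) :
    anticausal μ (fun t => g t + h t) x = anticausal μ g x + anticausal μ h x :=
  causal_add hμ (memLp_comp_neg hg) (memLp_comp_neg hh) _

lemma anticausal_const_mul (c : ℂ) (g : ℝ → ℂ) (x : ℝ) :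
    anticausal μ (fun t => c * g t) x = c * anticausal μ g x := causal_const_mul c _ _

lemma anticausal_congr (hgh : g =ᵐ[volume] h) (x : ℝ) : anticausal μ g x = anticausal μ h x :=
  causal_congr ((Measure.measurePreserving_neg volume).quasiMeasurePreserving.ae_eq_comp hgh) _

/-- Up to the factor `(2μ)⁻¹` this is the value at `0` of the free solution. Written as a pairing
with a square integrable function, it is a bounded functional of `g`, as the rank-one part of the
resolvent requires. -/
lemma causal_zero_add_anticausal_zero (hμ : 0 < μ.re) (hg : MemLp g 2) :
    causal μ g 0 + anticausal μ g 0 = ∫ t : ℝ, Complex.exp (-μ * |t|) * g t := by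
  have hi : Integrable fun t : ℝ => Complex.exp (-μ * |t|) * g t :=
    (memLp_cexp_neg_mul_abs hμ).integrable_mul hg
  rw [← integral_add_compl measurableSet_Iic hi, compl_Iic]
  simp only [causal, anticausal, Complex.ofReal_zero, mul_zero, neg_zero, Complex.exp_zero, one_mul]
  congr 1
  · refine setIntegral_congr_fun measurableSet_Iic fun t (ht : t ≤ 0) => ?_
    simp only [abs_of_nonpos ht]; push_cast; ring_nf
  · have := integral_comp_neg_Iic (0 : ℝ) fun t : ℝ => Complex.exp (-μ * |t|) * g t
    rw [neg_zero] at this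
    rw [← this]
    refine setIntegral_congr_fun measurableSet_Iic fun t (ht : t ≤ 0) => ?_
    simp only [abs_neg, abs_of_nonpos ht]; push_cast; ring_nf

end causal

lemma memLp_of_expKer_bound {a : ℝ} (ha : 0 < a) {F : ℝ → ℂ} {g : LineL2} (hF : Continuous F)
    (h : ∀ x, ‖F x‖ₑ ≤ ∫⁻ t, expKer a (x - t) * ‖g t‖ₑ) : MemLp F 2 volume :=
  ⟨hF.aestronglyMeasurable,
    (eLpNorm_le_of_expKer_bound (Lp.stronglyMeasurable g).measurable h).trans_lt
      (ENNReal.mul_lt_top (lintegral_expKer_lt_top ha) (Lp.memLp g).2)⟩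

/-- Operators on `L²(ℝ)` given by a pointwise formula with an exponential kernel bound. -/
def kernelCLM (a : ℝ) (T : (ℝ → ℂ) → ℝ → ℂ) (ha : 0 < a)
    (hc : ∀ g, MemLp g 2 → Continuous (T g))
    (hb : ∀ g x, ‖T g x‖ₑ ≤ ∫⁻ t, expKer a (x - t) * ‖g t‖ₑ)
    (hadd : ∀ g h, MemLp g 2 → MemLp h 2 → ∀ x, T (fun t => g t + h t) x = T g x + T h x)
    (hmul : ∀ (c : ℂ) g x, T (fun t => c * g t) x = c * T g x)
    (hcongr : ∀ g h : ℝ → ℂ, g =ᵐ[volume] h → ∀ x, T g x = T h x) : LineL2 →L[ℂ] LineL2 :=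
  have hmem : ∀ g : LineL2, MemLp (T g) 2 volume := fun g =>
    memLp_of_expKer_bound ha (hc g (Lp.memLp g)) (hb g)
  LinearMap.mkContinuous
    { toFun := fun g => (hmem g).toLp (T g)
      map_add' := fun g h => by
        rw [← MemLp.toLp_add]
        refine (MemLp.toLp_eq_toLp_iff _ _).mpr (.of_forall fun x => ?_)
        rw [Pi.add_apply, ← hadd g h (Lp.memLp g) (Lp.memLp h)]
        exact hcongr _ _ (Lp.coeFn_add g h) x
      map_smul' := fun c g => by
        rw [RingHom.id_apply, ← MemLp.toLp_const_smul]
        refine (MemLp.toLp_eq_toLp_iff _ _).mpr (.of_forall fun x => ?_)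
        rw [Pi.smul_apply, smul_eq_mul, ← hmul]
        exact hcongr _ _ (Lp.coeFn_smul c g) x }
    (∫⁻ s, expKer a s).toReal
    (fun g => by
      change ‖(hmem g).toLp (T g)‖ ≤ _
      rw [Lp.norm_toLp, Lp.norm_def, ← ENNReal.toReal_mul]
      exact ENNReal.toReal_mono
        (ENNReal.mul_lt_top (lintegral_expKer_lt_top ha) (Lp.memLp g).2).ne
        (eLpNorm_le_of_expKer_bound (Lp.stronglyMeasurable g).measurable (hb g)))

lemma kernelCLM_ae {a : ℝ} {T : (ℝ → ℂ) → ℝ → ℂ} {ha hc hb hadd hmul hcongr} (g : LineL2) :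
    kernelCLM a T ha hc hb hadd hmul hcongr g =ᵐ[volume] T g :=
  MemLp.coeFn_toLp (memLp_of_expKer_bound ha (hc g (Lp.memLp g)) (hb g))

end DeltaWave

end

open MeasureTheory Set Filter Topology
open scoped ContDiff

noncomputable section

namespace DeltaWave

/-! ## The resolvent -/

/-- The derivative of `e^{-μ|x|}` off `0`. -/
def kinkDeriv (μ : ℂ) (x : ℝ) : ℂ := -μ * (Real.sign x : ℂ) * Complex.exp (-μ * |x|)

lemma measurable_realSign : Measurable Real.sign :=
  Measurable.ite measurableSet_Iio measurable_const
    (Measurable.ite measurableSet_Ioi measurable_const measurable_const)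

lemma kinkDeriv_of_pos {μ : ℂ} {x : ℝ} (hx : 0 < x) :
    kinkDeriv μ x = -μ * Complex.exp (-μ * x) := by
  simp [kinkDeriv, Real.sign_of_pos hx, abs_of_pos hx]

lemma kinkDeriv_of_neg {μ : ℂ} {x : ℝ} (hx : x < 0) :
    kinkDeriv μ x = μ * Complex.exp (μ * x) := by
  simp [kinkDeriv, Real.sign_of_neg hx, abs_of_neg hx]

lemma abs_realSign_le_one (x : ℝ) : |Real.sign x| ≤ 1 := by
  rcases Real.sign_apply_eq x with h | h | h <;> rw [h] <;> norm_num

lemma memLp_kinkDeriv {μ : ℂ} (hμ : 0 < μ.re) : MemLp (kinkDeriv μ) 2 := by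
  have hm : Measurable (kinkDeriv μ) := by
    have := measurable_realSign
    unfold kinkDeriv; fun_prop
  refine ((memLp_cexp_neg_mul_abs hμ).const_mul μ).mono hm.aestronglyMeasurable
    (.of_forall fun x => ?_)
  have h1 := abs_realSign_le_one x
  rw [kinkDeriv, norm_mul, norm_mul, norm_mul, norm_neg, Complex.norm_real, Real.norm_eq_abs]
  have : ‖μ‖ * |Real.sign x| ≤ ‖μ‖ := mul_le_of_le_one_right (norm_nonneg _) h1
  gcongr

lemma hasDerivAt_cexp_mul (ν : ℂ) (y : ℝ) :
    HasDerivAt (fun y : ℝ => Complex.exp (ν * y)) (ν * Complex.exp (ν * y)) y := by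
  have := (((hasDerivAt_id (y : ℂ)).const_mul ν).cexp).comp_ofReal
  simpa [mul_comm] using this

lemma hasWeakDerivOn_cexp (ν : ℂ) :
    HasWeakDerivOn univ (fun y : ℝ => Complex.exp (ν * y)) fun y => ν * Complex.exp (ν * y) :=
  hasWeakDerivOn_of_hasDerivAt (continuous_cexp_mul ν) (fun y _ => hasDerivAt_cexp_mul ν y)
    (continuous_const.mul (continuous_cexp_mul ν)).locallyIntegrable

lemma hasWeakDerivOn_kink {μ : ℂ} (hμ : 0 < μ.re) :
    HasWeakDerivOn univ (fun x : ℝ => Complex.exp (-μ * |x|)) (kinkDeriv μ) := by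
  refine hasWeakDerivOn_of_hasDerivAt (by fun_prop) (fun y hy => ?_)
    (locallyIntegrable_of_memLp (memLp_kinkDeriv hμ))
  rcases lt_or_gt_of_ne hy with h | h
  · rw [kinkDeriv_of_neg h]
    refine (hasDerivAt_cexp_mul μ y).congr_of_eventuallyEq ?_
    filter_upwards [Iio_mem_nhds h] with x hx
    rw [abs_of_neg hx]; push_cast; ring_nf
  · rw [kinkDeriv_of_pos h]
    refine (hasDerivAt_cexp_mul (-μ) y).congr_of_eventuallyEq ?_
    filter_upwards [Ioi_mem_nhds h] with x hx
    rw [abs_of_pos hx]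

lemma hasWeakDerivOn_kinkDeriv_Ioi (μ : ℂ) :
    HasWeakDerivOn (Ioi 0) (kinkDeriv μ) fun x => μ ^ 2 * Complex.exp (-μ * |x|) := by
  refine (((hasWeakDerivOn_cexp (-μ)).const_mul (-μ)).mono (subset_univ (Ioi 0))).congr ?_ ?_ <;>
    rw [EventuallyEq, ae_restrict_iff' measurableSet_Ioi] <;> refine .of_forall fun x hx => ?_
  · rw [kinkDeriv_of_pos hx]
  · rw [abs_of_pos hx]; ring

lemma hasWeakDerivOn_kinkDeriv_Iio (μ : ℂ) :
    HasWeakDerivOn (Iio 0) (kinkDeriv μ) fun x => μ ^ 2 * Complex.exp (-μ * |x|) := by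
  refine (((hasWeakDerivOn_cexp μ).const_mul μ).mono (subset_univ (Iio 0))).congr ?_ ?_ <;>
    rw [EventuallyEq, ae_restrict_iff' measurableSet_Iio] <;> refine .of_forall fun x hx => ?_
  · rw [kinkDeriv_of_neg hx]
  · rw [abs_of_neg hx]; push_cast; ring_nf

lemma continuousOn_kinkDeriv (μ : ℂ) : ContinuousOn (kinkDeriv μ) {0}ᶜ := by
  intro x hx
  refine ContinuousAt.continuousWithinAt ?_
  rcases lt_or_gt_of_ne (show x ≠ 0 from hx) with h | h
  · refine ContinuousAt.congr (f := fun x : ℝ => μ * Complex.exp (μ * x))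
      (by fun_prop) ?_
    filter_upwards [Iio_mem_nhds h] with y hy using (kinkDeriv_of_neg hy).symm
  · refine ContinuousAt.congr (f := fun x : ℝ => -μ * Complex.exp (-μ * x))
      (by fun_prop) ?_
    filter_upwards [Ioi_mem_nhds h] with y hy using (kinkDeriv_of_pos hy).symm

lemma tendsto_kinkDeriv_left (μ : ℂ) : Tendsto (kinkDeriv μ) (𝓝[<] 0) (𝓝 μ) := by
  have h : Tendsto (fun x : ℝ => μ * Complex.exp (μ * x)) (𝓝[<] 0)
      (𝓝 (μ * Complex.exp (μ * (0 : ℝ)))) :=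
    ((continuous_const.mul (continuous_cexp_mul μ)).tendsto 0).mono_left nhdsWithin_le_nhds
  simp only [Complex.ofReal_zero, mul_zero, Complex.exp_zero, mul_one] at h
  exact h.congr' (by filter_upwards [self_mem_nhdsWithin] with y hy using (kinkDeriv_of_neg hy).symm)

lemma tendsto_kinkDeriv_right (μ : ℂ) : Tendsto (kinkDeriv μ) (𝓝[>] 0) (𝓝 (-μ)) := by
  have h : Tendsto (fun x : ℝ => -μ * Complex.exp (-μ * x)) (𝓝[>] 0)
      (𝓝 (-μ * Complex.exp (-μ * (0 : ℝ)))) :=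
    ((continuous_const.mul (continuous_cexp_mul (-μ))).tendsto 0).mono_left nhdsWithin_le_nhds
  simp only [Complex.ofReal_zero, mul_zero, Complex.exp_zero, mul_one] at h
  exact h.congr' (by filter_upwards [self_mem_nhdsWithin] with y hy using (kinkDeriv_of_pos hy).symm)

/-- The causal part `P` and the anticausal part `Q` satisfy `P' = g - μ P` and `Q' = μ Q - g`.
Adding and subtracting shows that `w = (2μ)⁻¹ (P + Q)` solves `-w'' + μ² w = g` on the whole line,
with a continuous first derivative. -/
lemma hasWeakDerivOn_green {μ : ℂ} (hμ : 0 < μ.re) {g : ℝ → ℂ} (hg : MemLp g 2) :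
    HasWeakDerivOn univ (fun x => (2 * μ)⁻¹ * (causal μ g x + anticausal μ g x))
      (fun x => 2⁻¹ * (anticausal μ g x - causal μ g x)) ∧
    HasWeakDerivOn univ (fun x => 2⁻¹ * (anticausal μ g x - causal μ g x))
      (fun x => μ ^ 2 * ((2 * μ)⁻¹ * (causal μ g x + anticausal μ g x)) - g x) := by
  have hμ0 : μ ≠ 0 := fun h => by simp [h] at hμ
  have hP := hasWeakDerivOn_causal hμ hg
  have hQ := hasWeakDerivOn_anticausal hμ hg
  refine ⟨((hP.add hQ).const_mul (2 * μ)⁻¹).congr (.of_forall fun _ => rfl)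
    (.of_forall fun x => ?_), ((hQ.sub hP).const_mul 2⁻¹).congr (.of_forall fun _ => rfl)
    (.of_forall fun x => ?_)⟩
  · simp only []; field_simp; ring
  · simp only []; field_simp; ring

/-- The resolvent of `-d²/dx² + q - c δ₀` exists at `z = q - μ²` unless `2 μ = c`. -/
theorem inResolventSet_opGraph {q c : ℝ} {z μ : ℂ} (hμ : 0 < μ.re) (hz : μ ^ 2 = q - z)
    (hc : 2 * μ ≠ c) : InResolventSet (opGraph (fun _ => q) c) z := by
  have hμ0 : μ ≠ 0 := fun h => by simp [h] at hμ
  have hc' : 2 * μ - c ≠ 0 := sub_ne_zero.mpr hc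
  have hconj : 0 < ((starRingEnd ℂ) μ).re := by simpa using hμ
  let PC : LineL2 →L[ℂ] LineL2 := kernelCLM μ.re (causal μ) hμ (fun _ => continuous_causal hμ)
    (fun _ => enorm_causal_le) (fun _ _ => causal_add hμ) causal_const_mul
    (fun _ _ h => causal_congr h)
  let QC : LineL2 →L[ℂ] LineL2 := kernelCLM μ.re (anticausal μ) hμ
    (fun _ => continuous_anticausal hμ)
    (fun _ => enorm_anticausal_le) (fun _ _ => anticausal_add hμ) anticausal_const_mul
    (fun _ _ h => anticausal_congr h)
  have hPC : ∀ g, PC g =ᵐ[volume] causal μ g := fun g => kernelCLM_ae g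
  have hQC : ∀ g, QC g =ᵐ[volume] anticausal μ g := fun g => kernelCLM_ae g
  let E : LineL2 := (memLp_cexp_neg_mul_abs hμ).toLp _
  -- The rate is conjugated because the inner product is conjugate linear in its first argument.
  let Ec : LineL2 := (memLp_cexp_neg_mul_abs hconj).toLp _
  have hE : E =ᵐ[volume] fun s : ℝ => Complex.exp (-μ * |s|) := MemLp.coeFn_toLp _
  -- The amplitude `A` of the correction `A e^{-μ|x|}` to the free solution `w`. Its derivative
  -- jumps by `-2μ A` at `0`, and the jump condition `-2μ A = -c (w(0) + A)` gives `A = c w(0) / (2μ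
  -- - c)`.
  let ell : LineL2 →L[ℂ] ℂ := (c / (2 * μ - c) * (2 * μ)⁻¹) • innerSL ℂ Ec
  have hell : ∀ g : LineL2, ell g
      = c / (2 * μ - c) * ((2 * μ)⁻¹ * (causal μ g 0 + anticausal μ g 0)) := by
    intro g
    rw [causal_zero_add_anticausal_zero hμ (Lp.memLp g)]
    simp only [ell, FunLike.coe_smul, Pi.smul_apply, innerSL_apply_apply, smul_eq_mul]
    rw [mul_assoc, L2.inner_def]
    congr 2
    refine integral_congr_ae ?_
    have : Ec =ᵐ[volume] fun s : ℝ => Complex.exp (-(starRingEnd ℂ) μ * |s|) :=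
      MemLp.coeFn_toLp _
    filter_upwards [this] with t ht
    rw [ht, RCLike.inner_apply', ← Complex.exp_conj]
    simp
  let G : LineL2 →L[ℂ] LineL2 := (2 * μ)⁻¹ • (PC + QC) + ell.smulRight E
  have hG : ∀ g : LineL2, G g =ᵐ[volume] fun x =>
      (2 * μ)⁻¹ * (causal μ g x + anticausal μ g x) + ell g * Complex.exp (-μ * |x|) := by
    intro g
    have e : G g = (2 * μ)⁻¹ • (PC g + QC g) + ell g • E := rfl
    rw [e]
    filter_upwards [Lp.coeFn_add ((2 * μ)⁻¹ • (PC g + QC g)) (ell g • E),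
      Lp.coeFn_smul (2 * μ)⁻¹ (PC g + QC g), Lp.coeFn_smul (ell g) E,
      Lp.coeFn_add (PC g) (QC g), hPC g, hQC g, hE] with x e1 e2 e3 e4 e5 e6 e7
    rw [e1, Pi.add_apply, e2, e3, Pi.smul_apply, Pi.smul_apply, e4, Pi.add_apply, e5, e6, e7,
      smul_eq_mul, smul_eq_mul]
  have hmap : ∀ g : LineL2, OpMapsTo (fun _ => q) c (G g) (z • G g + g) := by
    intro g
    have hg := Lp.memLp g
    set A := ell g with hA
    set w : ℝ → ℂ := fun x => (2 * μ)⁻¹ * (causal μ g x + anticausal μ g x) with hw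
    set w₁ : ℝ → ℂ := fun x => 2⁻¹ * (anticausal μ g x - causal μ g x) with hw₁
    obtain ⟨d1, d2⟩ := hasWeakDerivOn_green hμ hg
    have cP := continuous_causal hμ hg
    have cQ := continuous_anticausal hμ hg
    have mP : MemLp (causal μ g) 2 := (memLp_congr_ae (hPC g)).mp (Lp.memLp _)
    have mQ : MemLp (anticausal μ g) 2 := (memLp_congr_ae (hQC g)).mp (Lp.memLp _)
    have cw : Continuous w := continuous_const.mul (cP.add cQ)
    have cw₁ : Continuous w₁ := continuous_const.mul (cQ.sub cP)
    have mE := memLp_cexp_neg_mul_abs hμ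
    refine ⟨fun x => w x + A * Complex.exp (-μ * |x|), fun x => w₁ x + A * kinkDeriv μ x,
      fun x => (μ ^ 2 * w x - g x) + A * (μ ^ 2 * Complex.exp (-μ * |x|)),
      w₁ 0 + A * μ, w₁ 0 + A * (-μ), hG g, by fun_prop,
      d1.add ((hasWeakDerivOn_kink hμ).const_mul A),
      ((mQ.sub mP).const_mul _).add ((memLp_kinkDeriv hμ).const_mul A),
      (d2.mono (subset_univ _)).add ((hasWeakDerivOn_kinkDeriv_Iio μ).const_mul A),
      (d2.mono (subset_univ _)).add ((hasWeakDerivOn_kinkDeriv_Ioi μ).const_mul A),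
      (((((mP.add mQ).const_mul _).const_mul _).sub hg).add ((mE.const_mul _).const_mul A)),
      cw₁.continuousOn.add (continuousOn_const.mul (continuousOn_kinkDeriv μ)),
      ((cw₁.tendsto 0).mono_left nhdsWithin_le_nhds).add ((tendsto_kinkDeriv_left μ).const_mul A),
      ((cw₁.tendsto 0).mono_left nhdsWithin_le_nhds).add ((tendsto_kinkDeriv_right μ).const_mul A),
      ?_, ?_⟩
    · have hA0 : A * (2 * μ - c) = c * w 0 := by
        rw [hA, hell g, hw]; field_simp
      simp only [abs_zero, Complex.ofReal_zero, mul_zero, Complex.exp_zero, mul_one]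
      linear_combination -hA0
    · filter_upwards [Lp.coeFn_add (z • G g) g, Lp.coeFn_smul z (G g), hG g] with x e1 e2 e3
      rw [e1, Pi.add_apply, e2, Pi.smul_apply, e3, smul_eq_mul]
      have : (q : ℂ) = μ ^ 2 + z := by rw [hz]; ring
      rw [this]
      simp only [hw]
      ring
  -- `G` inverts `L - z`, whereas the resolvent is the inverse of `z - L`. Uniqueness holds since
  -- the difference of two solutions is an eigenfunction at `z`, which `2μ ≠ c` excludes.
  refine ⟨-G, fun u g => ?_⟩
  have hneg : (-G) g = G (-g) := by simp
  rw [hneg]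
  constructor
  · rintro ⟨f, hf, hfg⟩
    have h := (show OpMapsTo (fun _ => q) c u f from hf).sub (hmap (-g))
    have hz' : f - (z • G (-g) + -g) = z • (u - G (-g)) := by
      rw [← hfg, smul_sub]; abel
    rw [hz'] at h
    obtain ⟨A, hA, hA0⟩ := h.eigenfunction hμ hz (Lp.coeFn_smul z _)
    have : A = 0 := (mul_eq_zero.mp hA0).resolve_left hc'
    rw [← sub_eq_zero]
    refine Lp.ext (hA.trans ?_)
    filter_upwards [Lp.coeFn_zero ℂ 2 (volume : Measure ℝ)] with x hx
    rw [hx, this, zero_mul]; rfl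
  · rintro rfl
    exact ⟨_, hmap (-g), by abel⟩

/-- At `2 μ = c` the kernel is spanned by `e^{-μ|x|}`. -/
theorem spansKernel_opGraph {q c μ : ℝ} (hμ : 0 < μ) (hq : μ ^ 2 = q) (hc : 2 * μ = c) :
    ∃ e : LineL2, (e =ᵐ[volume] fun y => ((Real.exp (-(μ * |y|)) : ℝ) : ℂ)) ∧
      SpansKernel (opGraph (fun _ => q) c) e := by
  have hμ' : 0 < (μ : ℂ).re := by simpa using hμ
  have hz : (μ : ℂ) ^ 2 = q - 0 := by rw [← hq]; push_cast; ring
  let e : LineL2 := (memLp_cexp_neg_mul_abs hμ').toLp _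
  have he : e =ᵐ[volume] fun s : ℝ => Complex.exp (-μ * |s|) := MemLp.coeFn_toLp _
  have hmap : ∀ a : ℂ, OpMapsTo (fun _ => q) c (a • e) 0 := by
    intro a
    have mE := memLp_cexp_neg_mul_abs hμ'
    refine ⟨fun x => a * Complex.exp (-μ * |x|), fun x => a * kinkDeriv μ x,
      fun x => a * (μ ^ 2 * Complex.exp (-μ * |x|)), a * μ, a * (-μ), ?_, by fun_prop,
      (hasWeakDerivOn_kink hμ').const_mul a, (memLp_kinkDeriv hμ').const_mul a,
      (hasWeakDerivOn_kinkDeriv_Iio μ).const_mul a, (hasWeakDerivOn_kinkDeriv_Ioi μ).const_mul a,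
      (mE.const_mul _).const_mul a, continuousOn_const.mul (continuousOn_kinkDeriv μ),
      (tendsto_kinkDeriv_left μ).const_mul a, (tendsto_kinkDeriv_right μ).const_mul a, ?_, ?_⟩
    · filter_upwards [Lp.coeFn_smul a e, he] with x e1 e2
      rw [e1, Pi.smul_apply, e2, smul_eq_mul]
    · rw [← hc]; simp; ring
    · filter_upwards [Lp.coeFn_zero ℂ 2 (volume : Measure ℝ)] with x hx
      rw [hx, ← hq]; simp; ring
  refine ⟨e, ?_, ?_, fun u => ⟨fun h => ?_, ?_⟩⟩
  · filter_upwards [he] with x hx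
    rw [hx]; push_cast; ring_nf
  · intro h0
    have h1 : (fun s : ℝ => Complex.exp (-μ * |s|)) =ᵐ[volume] fun _ => 0 := by
      refine he.symm.trans ?_
      rw [h0]
      exact Lp.coeFn_zero ℂ 2 volume
    have h2 : (fun s : ℝ => Complex.exp (-μ * |s|)) = fun _ => 0 :=
      Continuous.ae_eq_iff_eq volume (by fun_prop) continuous_const |>.mp h1
    exact Complex.exp_ne_zero _ (congrFun h2 0)
  · obtain ⟨A, hA, -⟩ := (show OpMapsTo (fun _ => q) c u 0 from h).eigenfunction hμ' hz (by
      filter_upwards [Lp.coeFn_zero ℂ 2 (volume : Measure ℝ)] with x hx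
      rw [hx]; simp)
    refine ⟨A, Lp.ext (hA.trans ?_)⟩
    filter_upwards [Lp.coeFn_smul A e, he] with x e1 e2
    rw [e1, Pi.smul_apply, e2, smul_eq_mul]
  · rintro ⟨a, rfl⟩
    exact hmap a

end DeltaWave

end

open MeasureTheory Set Filter Topology
open scoped ContDiff

noncomputable section

namespace DeltaWave

/-! ## Decaying modes and the hypotheses of the bifurcation theorem -/

lemma hasWeakDerivOn_exp (ν : ℝ) :
    HasWeakDerivOn univ (fun y : ℝ => Real.exp (ν * y)) fun y => ν * Real.exp (ν * y) := by
  refine hasWeakDerivOn_of_hasDerivAt (by fun_prop) (fun y _ => ?_)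
    (by fun_prop : Continuous fun y : ℝ => ν * Real.exp (ν * y)).locallyIntegrable
  simpa [mul_comm] using ((hasDerivAt_id y).const_mul ν).exp

lemma memLp_exp_neg_Ioi {κ : ℝ} (hκ : 0 < κ) :
    MemLp (fun y : ℝ => Real.exp (-κ * y)) 2 (volume.restrict (Ioi 0)) := by
  refine (memLp_congr_ae ?_).mp ((memLp_exp_neg_mul_abs hκ).restrict (Ioi 0))
  rw [EventuallyEq, ae_restrict_iff' measurableSet_Ioi]
  exact .of_forall fun y (hy : 0 < y) => by rw [abs_of_pos hy]

lemma isDecayingMode_exp {κ : ℝ} (hκ : 0 < κ) :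
    IsDecayingMode (fun _ => κ ^ 2) fun y => Real.exp (-κ * y) := by
  have h := hasWeakDerivOn_exp (-κ)
  have hm := memLp_exp_neg_Ioi hκ
  refine ⟨by fun_prop, by simp, hm, _, _, h.mono (subset_univ _), hm.const_mul _,
    (h.const_mul (-κ)).mono (subset_univ _), (hm.const_mul _).const_mul _, .of_forall fun y => ?_⟩
  ring

/-- The uniform `L²` bound is demanded of every decaying mode, so uniqueness is needed besides
existence. The complexified mode is a multiple of the decaying exponential, and the value at `0`
fixes the multiple. -/
lemma IsDecayingMode.ae_eq {κ : ℝ} (hκ : 0 < κ) {φ : ℝ → ℝ}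
    (h : IsDecayingMode (fun _ => κ ^ 2) φ) :
    φ =ᵐ[volume.restrict (Ioi 0)] fun y => Real.exp (-κ * y) := by
  obtain ⟨hc, h0, hm, φ₁, φ₂, d1, m1, d2, m2, he⟩ := h
  obtain ⟨-, A, hA⟩ := half_line_solution isOpen_Ioi ordConnected_Ioi Real.volume_Ioi
    (ν := ((-κ : ℝ) : ℂ)) (fun y (hy : 0 < y) => by simp only [Complex.ofReal_re]; nlinarith)
    d1.ofReal d2.ofReal hm.ofReal m1.ofReal (by
      rw [ae_restrict_iff' measurableSet_Ioi] at he
      filter_upwards [he] with y hy hyΩ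
      rw [← sub_eq_zero.mp ((add_comm _ _).trans (hy hyΩ))]
      push_cast; ring)
  have hcI : ContinuousOn (fun y => (φ y : ℂ)) (Ioi 0) :=
    Complex.continuous_ofReal.comp_continuousOn (hc.mono Ioi_subset_Ici_self)
  have hA' := eqOn_of_ae_mem isOpen_Ioi hcI
    (continuous_const.mul (continuous_cexp_mul _)).continuousOn hA
  have hA1 : A = 1 := by
    have t1 : Tendsto (fun y => (φ y : ℂ)) (𝓝[>] 0) (𝓝 ((1 : ℝ) : ℂ)) := by
      rw [← h0]
      exact (Complex.continuous_ofReal.tendsto _).comp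
        ((hc 0 self_mem_Ici).mono_left (nhdsWithin_mono _ Ioi_subset_Ici_self))
    have t2 : Tendsto (fun y : ℝ => A * Complex.exp (((-κ : ℝ) : ℂ) * y)) (𝓝[>] 0)
        (𝓝 (A * Complex.exp (((-κ : ℝ) : ℂ) * (0 : ℝ)))) :=
      ((continuous_const.mul (continuous_cexp_mul _)).tendsto 0).mono_left nhdsWithin_le_nhds
    have := tendsto_nhds_unique t1
      (t2.congr' (by filter_upwards [self_mem_nhdsWithin] with y hy using (hA' hy).symm))
    simpa using this.symm
  rw [EventuallyEq, ae_restrict_iff' measurableSet_Ioi]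
  refine .of_forall fun y hy => ?_
  have := hA' hy
  simp only [hA1] at this
  rw [Pi.mul_apply, one_mul] at this
  exact_mod_cast this

lemma exists_sqrt_re_pos {w : ℂ} (hw : 0 < w.re) : ∃ μ : ℂ, 0 < μ.re ∧ μ ^ 2 = w := by
  obtain ⟨μ, hμ⟩ := IsAlgClosed.exists_pow_nat_eq w (n := 2) (by norm_num)
  rcases lt_trichotomy μ.re 0 with h | h | h
  · exact ⟨-μ, by simpa using h, by rw [neg_sq, hμ]⟩
  · rw [← hμ, sq, Complex.mul_re, h] at hw
    nlinarith
  · exact ⟨μ, h, hμ⟩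

lemma pot_one_zero (k : ℕ) (lam : ℝ) :
    pot (fun _ => 1) (fun _ => 0) k lam = fun _ => (k : ℝ) ^ 2 * (1 - lam) := by
  funext y; simp [pot]

lemma pot_one_zero' (k : ℕ) {lam : ℝ} (h : lam ≤ 1) :
    pot (fun _ => 1) (fun _ => 0) k lam = fun _ => (k * Real.sqrt (1 - lam)) ^ 2 := by
  rw [pot_one_zero]
  funext y
  rw [mul_pow, Real.sq_sqrt (by linarith)]

/-- The interval of parameters `lam` with `|√(1 - lam) - s| < s / (2 k)`. -/
def paramInterval (s : ℝ) (k : ℕ) : Set ℝ :=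
  Ioo (1 - (s + s / (2 * k)) ^ 2) (1 - (s - s / (2 * k)) ^ 2)

/-- The lower bound `s / 2` gives the modes a common decay rate; the bound `s / k` keeps every other
wavenumber away from resonance. -/
lemma sqrt_mem_of_mem_paramInterval {s : ℝ} (hs : 0 < s) {k : ℕ} (hk : 1 ≤ k) {lam : ℝ}
    (h : lam ∈ paramInterval s k) :
    lam < 1 ∧ s / 2 < Real.sqrt (1 - lam) ∧ |Real.sqrt (1 - lam) - s| < s / k := by
  have hk' : (1 : ℝ) ≤ k := by exact_mod_cast hk
  set d := s / (2 * k) with hd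
  have hd0 : 0 < d := by positivity
  have hd1 : d ≤ s / 2 := by
    rw [hd]; gcongr; linarith
  have hd2 : s / k = 2 * d := by rw [hd]; field_simp
  obtain ⟨h1, h2⟩ := h
  have hpos : 0 < s - d := by linarith
  have hlt : lam < 1 := by nlinarith
  have b1 : s - d < Real.sqrt (1 - lam) := Real.lt_sqrt_of_sq_lt (by linarith)
  have b2 : Real.sqrt (1 - lam) < s + d := by
    rw [Real.sqrt_lt' (by linarith)]; linarith
  refine ⟨hlt, by linarith, ?_⟩
  rw [hd2, abs_lt]; constructor <;> linarith

lemma sq_mem_paramInterval {s : ℝ} (hs : 0 < s) {k : ℕ} (hk : 1 ≤ k) :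
    1 - s ^ 2 ∈ paramInterval s k := by
  have hk' : (1 : ℝ) ≤ k := by exact_mod_cast hk
  set d := s / (2 * k) with hd
  have hd0 : 0 < d := by positivity
  have hd1 : d ≤ s / 2 := by
    rw [hd]; gcongr; linarith
  constructor <;> nlinarith

/-- At `z = 0` the relevant root is `μ = k √(1 - lam)`. Without the delta there is no obstruction,
since `μ ≠ 0`. With `c = k² α` the resonance `2μ = c` reads `kstar √(1 - lam) = k s`, which inside
the interval happens only at the bifurcation point. -/
theorem bifurcationHypotheses {lamstar α : ℝ} {kstar : ℕ} (hk : 1 ≤ kstar) (hlam : lamstar < 1)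
    (hα : α = 2 * Real.sqrt (1 - lamstar) / kstar) :
    BifurcationHypotheses (fun _ => 1) (fun _ => 0) α kstar lamstar
      (paramInterval (Real.sqrt (1 - lamstar)) kstar)
      (paramInterval (Real.sqrt (1 - lamstar)) kstar)
      (fun y => Real.exp (-(kstar * Real.sqrt (1 - lamstar) * |y|))) := by
  set s := Real.sqrt (1 - lamstar) with hsdef
  have hs : 0 < s := Real.sqrt_pos.mpr (by linarith)
  have hk' : (1 : ℝ) ≤ kstar := by exact_mod_cast hk
  have hk0 : (0 : ℝ) < kstar := by linarith
  set κs := (kstar : ℝ) * s with hκs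
  have hκs0 : 0 < κs := by positivity
  have hcs : 2 * κs = (kstar : ℝ) ^ 2 * α := by rw [hα, hκs]; field_simp
  have hker := spansKernel_opGraph (q := κs ^ 2) hκs0 rfl hcs
  have hdelta : deltaOp (fun _ => 1) (fun _ => 0) α kstar lamstar
      = opGraph (fun _ => κs ^ 2) ((kstar : ℝ) ^ 2 * α) := by
    rw [deltaOp, pot_one_zero' _ hlam.le]
  have hmode0 : ∀ {lam : ℝ}, lam ∈ paramInterval s kstar → ∀ {k : ℕ}, 1 ≤ k →
      s / 2 ≤ k * Real.sqrt (1 - lam) := fun {lam} hl {k} hk1 => by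
    obtain ⟨-, h2, -⟩ := sqrt_mem_of_mem_paramInterval hs hk hl
    have : (1 : ℝ) ≤ k := by exact_mod_cast hk1
    nlinarith [Real.sqrt_nonneg (1 - lam)]
  refine
    { memLp_V₀ := memLp_top_const 1
      memLp_W := memLp_top_const 0
      even_V₀ := .of_forall fun _ => rfl
      even_W := .of_forall fun _ => rfl
      interval := ordConnected_Ioo
      regular_resolvent := ?_
      one_le_kstar := hk
      isOpen_Istar := isOpen_Ioo
      interval_star := ordConnected_Ioo
      mem_star := ?_
      star_subset := Subset.rfl
      isolated_simple := ?_
      resolvent := ?_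
      modes := ?_
      kernel := ?_
      integrable := ?_
      transversality := ?_ }
  · intro k hk1 lam hl
    have h0 : 0 < k * Real.sqrt (1 - lam) := lt_of_lt_of_le (by positivity) (hmode0 hl hk1)
    rw [regularOp, pot_one_zero' _ (sqrt_mem_of_mem_paramInterval hs hk hl).1.le]
    refine inResolventSet_opGraph (μ := ((k * Real.sqrt (1 - lam) : ℝ) : ℂ))
      (by simpa only [Complex.ofReal_re] using h0) (by push_cast; ring) ?_
    norm_cast
    positivity
  · have := sq_mem_paramInterval hs hk
    rwa [hsdef, Real.sq_sqrt (by linarith), sub_sub_cancel, ← hsdef] at this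
  · rw [hdelta]
    refine ⟨hker.imp fun e he => he.2, κs ^ 2, by positivity, fun z hz hzn => ?_⟩
    have hre : 0 < (((κs ^ 2 : ℝ) : ℂ) - z).re := by
      have := (Complex.re_le_norm z).trans_lt hzn
      simp only [Complex.sub_re, Complex.ofReal_re]; linarith
    obtain ⟨μ, hμ, hμ2⟩ := exists_sqrt_re_pos hre
    -- Here `c = 2 κs`, so the resonance `2μ = c` would mean `μ = κs` and hence `z = κs² - μ² = 0`.
    refine inResolventSet_opGraph hμ hμ2 fun hcon => hz ?_
    rw [← hcs] at hcon
    have : μ = κs := by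
      push_cast at hcon; linear_combination hcon / 2
    rw [this] at hμ2
    push_cast at hμ2
    linear_combination hμ2
  · intro k hk1 lam hl hne
    have h0 : 0 < k * Real.sqrt (1 - lam) := lt_of_lt_of_le (by positivity) (hmode0 hl hk1)
    obtain ⟨hl1, -, hl3⟩ := sqrt_mem_of_mem_paramInterval hs hk hl
    rw [deltaOp, pot_one_zero' _ hl1.le]
    refine inResolventSet_opGraph (μ := ((k * Real.sqrt (1 - lam) : ℝ) : ℂ))
      (by simpa only [Complex.ofReal_re] using h0) (by push_cast; ring) ?_
    norm_cast
    intro hcon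
    have hk1' : (0 : ℝ) < k := by exact_mod_cast hk1
    rw [hα] at hcon
    have e1 : kstar * Real.sqrt (1 - lam) = k * s := by
      push_cast at hcon
      field_simp at hcon
      rw [mul_comm, hcon]
    rw [lt_div_iff₀ hk0, ← abs_of_pos (a := (kstar : ℝ)) hk0, ← abs_mul] at hl3
    -- Resonance gives `(k - kstar) s = kstar (√(1 - lam) - s)`, which is smaller than `s` in
    -- modulus by the width of the interval; the integer `k - kstar` must then vanish.
    have e2 : |(k : ℝ) - kstar| * s < 1 * s := by
      have e0 : ((k : ℝ) - kstar) * s = (Real.sqrt (1 - lam) - s) * kstar := by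
        linear_combination -e1
      have e0' : |(k : ℝ) - kstar| * s = |((k : ℝ) - kstar) * s| := by
        rw [abs_mul, abs_of_pos (a := s) hs]
      rw [one_mul, e0', e0]
      exact hl3
    have e3 : |(k : ℤ) - kstar| < 1 := by exact_mod_cast lt_of_mul_lt_mul_right e2 hs.le
    have e4 : k = kstar := by rw [Int.abs_lt_one_iff] at e3; omega
    subst e4
    have e5 : Real.sqrt (1 - lam) = s := mul_left_cancel₀ hk0.ne' e1
    rw [hsdef, Real.sqrt_inj (by linarith) (by linarith)] at e5
    exact hne (by rw [show lam = lamstar by linarith])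
  · refine ⟨(eLpNorm (fun y : ℝ => Real.exp (-(s / 2) * |y|)) 2 volume).toReal + 1, by positivity,
      fun lam hl k hk1 => ?_⟩
    have h1 := hmode0 hl hk1
    have h0 : 0 < k * Real.sqrt (1 - lam) := lt_of_lt_of_le (by positivity) h1
    rw [pot_one_zero' _ (sqrt_mem_of_mem_paramInterval hs hk hl).1.le]
    refine ⟨⟨_, isDecayingMode_exp h0⟩, fun φ hφ => ?_⟩
    rw [eLpNorm_congr_ae (hφ.ae_eq h0)]
    calc _ ≤ eLpNorm (fun y : ℝ => Real.exp (-(s / 2) * |y|)) 2 (volume.restrict (Ioi 0)) := by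
          refine eLpNorm_mono_ae ?_
          rw [ae_restrict_iff' measurableSet_Ioi]
          refine .of_forall fun y (hy : 0 < y) => ?_
          rw [Real.norm_eq_abs, Real.norm_eq_abs, Real.abs_exp, Real.abs_exp, abs_of_pos hy,
            Real.exp_le_exp]
          nlinarith
      _ ≤ eLpNorm (fun y : ℝ => Real.exp (-(s / 2) * |y|)) 2 volume :=
          eLpNorm_mono_measure _ Measure.restrict_le_self
      _ ≤ _ := by
          rw [← ENNReal.ofReal_toReal (memLp_exp_neg_mul_abs (a := s / 2) (by positivity)).2.ne]
          exact ENNReal.ofReal_le_ofReal (by simp)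
  · rw [hdelta]; exact hker
  · have := (memLp_exp_neg_mul_abs hκs0).integrable_sq
    simpa [neg_mul] using this
  · have hint : Integrable fun y => (1 : ℝ) * Real.exp (-(κs * |y|)) ^ 2 := by
      have := (memLp_exp_neg_mul_abs hκs0).integrable_sq
      simpa [neg_mul] using this
    exact (integral_pos_of_integrable_nonneg_nonzero (x := 0) (by fun_prop) hint
      (fun y => by positivity) (by simp)).ne'

end DeltaWave

end

open MeasureTheory Set Filter Topology
open scoped ContDiff

noncomputable section

namespace DeltaWave

/-! ## Sine series with weighted absolutely summable coefficients -/

/-- `ℓ¹(ℕ)`. The element `x` stands for the sine series with coefficients `x k / k²`; the index `0`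
plays no role. -/
abbrev Coeff : Type := lp (fun _ : ℕ => ℝ) 1

namespace Coeff

lemma summable_abs (x : Coeff) : Summable fun k => |x k| := by
  have h := (memℓp_gen_iff (p := 1) (by simp)).mp (lp.memℓp x)
  simpa using h

lemma norm_eq (x : Coeff) : ‖x‖ = ∑' k, |x k| := by
  have h := lp.norm_eq_tsum_rpow (p := 1) (by simp) x
  simpa using h

/-- The basis vectors. -/
def basis (k : ℕ) : Coeff := lp.single 1 k (1 : ℝ)

lemma basis_apply (k j : ℕ) : basis k j = if j = k then 1 else 0 := by
  rw [basis, lp.single_apply, Pi.single_apply]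

@[simp] lemma norm_basis (k : ℕ) : ‖basis k‖ = 1 := by
  rw [basis, lp.norm_single (by norm_num)]; simp

lemma hasSum_basis (x : Coeff) : HasSum (fun k => x k • basis k) x := by
  convert lp.hasSum_single (p := 1) (by norm_num) x using 2 with k
  rw [basis, ← lp.single_smul, smul_eq_mul, mul_one]

lemma norm_smul_le {E : Type*} [NormedAddCommGroup E] [NormedSpace ℝ E] {v : ℕ → E} {C : ℝ}
    (hv : ∀ k, ‖v k‖ ≤ C) (x : Coeff) (k : ℕ) : ‖x k • v k‖ ≤ |x k| * C := by
  rw [norm_smul, Real.norm_eq_abs]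
  gcongr
  exact hv k

lemma summable_norm_smul {E : Type*} [NormedAddCommGroup E] [NormedSpace ℝ E] {v : ℕ → E} {C : ℝ}
    (hv : ∀ k, ‖v k‖ ≤ C) (x : Coeff) : Summable fun k => ‖x k • v k‖ :=
  .of_nonneg_of_le (fun _ => norm_nonneg _) (norm_smul_le hv x) (x.summable_abs.mul_right C)

section lift

variable {E : Type*} [NormedAddCommGroup E] [NormedSpace ℝ E] [CompleteSpace E]

/-- The bounded operator on `ℓ¹` with prescribed bounded values on the basis. -/
def lift (v : ℕ → E) (C : ℝ) (hv : ∀ k, ‖v k‖ ≤ C) : Coeff →L[ℝ] E :=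
  LinearMap.mkContinuous
    { toFun := fun x => ∑' k, x k • v k
      map_add' := fun x y => by
        rw [← (summable_norm_smul hv x).of_norm.tsum_add (summable_norm_smul hv y).of_norm]
        simp only [lp.coeFn_add, Pi.add_apply, add_smul]
      map_smul' := fun c x => by
        rw [RingHom.id_apply, ← (summable_norm_smul hv x).of_norm.tsum_const_smul]
        simp only [lp.coeFn_smul, Pi.smul_apply, smul_assoc] }
    C
    (fun x => by
      refine (norm_tsum_le_tsum_norm (summable_norm_smul hv x)).trans ?_
      rw [norm_eq, mul_comm, ← tsum_mul_right]
      exact (summable_norm_smul hv x).tsum_le_tsum (norm_smul_le hv x)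
        (x.summable_abs.mul_right C))

variable {v : ℕ → E} {C : ℝ} {hv : ∀ k, ‖v k‖ ≤ C}

lemma hasSum_lift (x : Coeff) : HasSum (fun k => x k • v k) (lift v C hv x) :=
  (summable_norm_smul hv x).of_norm.hasSum

lemma norm_lift_le (hC : 0 ≤ C) : ‖lift v C hv‖ ≤ C := LinearMap.mkContinuous_norm_le _ hC _

@[simp] lemma lift_basis (k : ℕ) : lift v C hv (basis k) = v k := by
  have h := hasSum_lift (hv := hv) (basis k)
  refine h.unique ?_
  convert hasSum_ite_eq k (v k) using 2 with j
  rw [basis_apply]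
  split_ifs with hj
  · rw [hj, one_smul]
  · rw [zero_smul]

end lift

/-- Bounded operators on `ℓ¹` are determined by their values on the basis. -/
lemma clm_ext {F : Type*} [NormedAddCommGroup F] [NormedSpace ℝ F] {A B : Coeff →L[ℝ] F}
    (h : ∀ k, A (basis k) = B (basis k)) : A = B := by
  ext x
  have hA := (hasSum_basis x).mapL A
  have hB := (hasSum_basis x).mapL B
  simp only [map_smul, h] at hA hB
  exact hA.unique hB

/-- The coordinate functionals. -/
def coord (k : ℕ) : Coeff →L[ℝ] ℝ := lp.evalCLM ℝ (fun _ : ℕ => ℝ) 1 k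

lemma coord_apply (k : ℕ) (x : Coeff) : coord k x = x k := rfl

/-- Diagonal operators. -/
def diag (d : ℕ → ℝ) (C : ℝ) (hd : ∀ k, |d k| ≤ C) : Coeff →L[ℝ] Coeff :=
  lift (fun k => d k • basis k) C fun k => by
    rw [norm_smul, norm_basis, mul_one]; exact hd k

lemma diag_basis {d : ℕ → ℝ} {C : ℝ} {hd : ∀ k, |d k| ≤ C} (k : ℕ) :
    diag d C hd (basis k) = d k • basis k := lift_basis k

lemma diag_apply {d : ℕ → ℝ} {C : ℝ} {hd : ∀ k, |d k| ≤ C} (x : Coeff) (k : ℕ) :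
    diag d C hd x k = d k * x k := by
  have h : (coord k).comp (diag d C hd) = d k • coord k := clm_ext fun j => by
    simp only [ContinuousLinearMap.comp_apply, diag_basis, map_smul, FunLike.coe_smul,
      Pi.smul_apply, coord_apply, basis_apply, smul_eq_mul]
    split_ifs with hj
    · rw [hj]
    · simp
  exact congrArg (fun A : Coeff →L[ℝ] ℝ => A x) h

/-- The signed basis vector representing `sin (m ·)`, for `m ∈ ℤ`. -/
def sinVec (m : ℤ) : Coeff := ((m.sign : ℝ) * (m : ℝ) ^ 2) • basis m.natAbs

lemma norm_sinVec_le (m : ℤ) : ‖sinVec m‖ ≤ (m : ℝ) ^ 2 := by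
  rw [sinVec, norm_smul, norm_basis, mul_one, norm_mul, norm_pow, Real.norm_eq_abs,
    Real.norm_eq_abs, sq_abs]
  refine mul_le_of_le_one_left (by positivity) ?_
  rcases lt_trichotomy m 0 with h | rfl | h
  · simp [Int.sign_eq_neg_one_of_neg h]
  · simp
  · simp [Int.sign_eq_one_of_pos h]

/-- The cubing operator on sine series, on basis vectors:
`4 sin j sin k sin l = sin (j+k-l) + sin (j-k+l) + sin (-j+k+l) - sin (j+k+l)`. -/
def triVec (j k l : ℕ) : Coeff :=
  (4 * ((j : ℝ) ^ 2 * (k : ℝ) ^ 2 * (l : ℝ) ^ 2))⁻¹ •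
    (sinVec (j + k - l) + sinVec (j - k + l) + sinVec (-j + k + l) - sinVec (j + k + l))

/-- For positive indices the frequencies `±j ± k ± l` are at most `j + k + l ≤ 3jkl`, so each of the
four terms has norm at most `9 (jkl)²`; division by `4 (jkl)²` leaves `9`. If an index is zero, the
inverse of zero makes the vector vanish. -/
lemma norm_triVec_le (j k l : ℕ) : ‖triVec j k l‖ ≤ 9 := by
  by_cases h0 : (j : ℝ) ^ 2 * (k : ℝ) ^ 2 * (l : ℝ) ^ 2 = 0
  · rw [triVec, h0]; simp
  have hpos : 0 < (j : ℝ) ^ 2 * (k : ℝ) ^ 2 * (l : ℝ) ^ 2 := lt_of_le_of_ne (by positivity) (Ne.symm h0)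
  have hj : (1 : ℝ) ≤ j := by
    have : j ≠ 0 := by rintro rfl; simp at h0
    exact_mod_cast Nat.one_le_iff_ne_zero.mpr this
  have hk : (1 : ℝ) ≤ k := by
    have : k ≠ 0 := by rintro rfl; simp at h0
    exact_mod_cast Nat.one_le_iff_ne_zero.mpr this
  have hl : (1 : ℝ) ≤ l := by
    have : l ≠ 0 := by rintro rfl; simp at h0
    exact_mod_cast Nat.one_le_iff_ne_zero.mpr this
  have hsum : (j : ℝ) + k + l ≤ 3 * (j * k * l) := by
    have h1 : (1 : ℝ) ≤ j * k := by nlinarith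
    have h2 : (1 : ℝ) ≤ k * l := by nlinarith
    have h3 : (1 : ℝ) ≤ j * l := by nlinarith
    nlinarith
  have hb : ∀ m : ℤ, |(m : ℝ)| ≤ j + k + l →
      ‖sinVec m‖ ≤ 9 * ((j : ℝ) ^ 2 * (k : ℝ) ^ 2 * (l : ℝ) ^ 2) := fun m hm => by
    refine (norm_sinVec_le m).trans ?_
    rw [← sq_abs]
    calc |(m : ℝ)| ^ 2 ≤ (3 * (j * k * l)) ^ 2 := by gcongr; exact hm.trans hsum
      _ = _ := by ring
  have b1 := hb (j + k - l) (by push_cast; rw [abs_le]; constructor <;> linarith)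
  have b2 := hb (j - k + l) (by push_cast; rw [abs_le]; constructor <;> linarith)
  have b3 := hb (-j + k + l) (by push_cast; rw [abs_le]; constructor <;> linarith)
  have b4 := hb (j + k + l) (by push_cast; rw [abs_le]; constructor <;> linarith)
  rw [triVec, norm_smul, norm_inv, Real.norm_of_nonneg (by positivity), inv_mul_le_iff₀ (by positivity)]
  refine (norm_sub_le _ _).trans ?_
  have := norm_add₃_le (a := sinVec (j + k - l)) (b := sinVec (j - k + l)) (c := sinVec (-j + k + l))
  linarith

/-- The trilinear product of sine series. -/
def tri : Coeff →L[ℝ] Coeff →L[ℝ] Coeff →L[ℝ] Coeff :=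
  lift (fun j => lift (fun k => lift (fun l => triVec j k l) 9 (norm_triVec_le j k)) 9
    fun _ => norm_lift_le (by norm_num)) 9 fun _ => norm_lift_le (by norm_num)

lemma tri_basis (j k l : ℕ) : tri (basis j) (basis k) (basis l) = triVec j k l := by
  simp [tri]

lemma abs_sin_div_sq_le (θ : ℝ) (k : ℕ) : ‖Real.sin (k * θ) / (k : ℝ) ^ 2‖ ≤ 1 := by
  rcases Nat.eq_zero_or_pos k with rfl | hk
  · simp
  have : (1 : ℝ) ≤ k := by exact_mod_cast hk
  rw [Real.norm_eq_abs, abs_div, abs_of_nonneg (by positivity : 0 ≤ (k : ℝ) ^ 2),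
    div_le_one (by positivity)]
  exact (Real.abs_sin_le_one _).trans (by nlinarith)

/-- The value of the sine series at `θ`. -/
def eval (θ : ℝ) : Coeff →L[ℝ] ℝ :=
  lift (fun k => Real.sin (k * θ) / (k : ℝ) ^ 2) 1 (abs_sin_div_sq_le θ)

lemma eval_sinVec (θ : ℝ) (m : ℤ) : eval θ (sinVec m) = Real.sin (m * θ) := by
  rw [sinVec, map_smul, eval, lift_basis, smul_eq_mul]
  rcases lt_trichotomy m 0 with h | rfl | h
  · have hm : (m : ℝ) ≠ 0 := by exact_mod_cast h.ne
    have e : ((m.natAbs : ℕ) : ℝ) = -m := by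
      rw [Nat.cast_natAbs, abs_of_neg h]; push_cast; rfl
    rw [e, Int.sign_eq_neg_one_of_neg h, neg_mul, Real.sin_neg, neg_sq]
    push_cast; field_simp
  · simp
  · have hm : (m : ℝ) ≠ 0 := by exact_mod_cast h.ne'
    have e : ((m.natAbs : ℕ) : ℝ) = m := by
      rw [Nat.cast_natAbs, abs_of_pos h]
    rw [e, Int.sign_eq_one_of_pos h]
    push_cast; field_simp

lemma eval_triVec (θ : ℝ) (j k l : ℕ) : eval θ (triVec j k l)
    = (Real.sin (j * θ) / (j : ℝ) ^ 2) * (Real.sin (k * θ) / (k : ℝ) ^ 2)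
      * (Real.sin (l * θ) / (l : ℝ) ^ 2) := by
  rw [triVec, map_smul, map_sub, map_add, map_add]
  simp only [eval_sinVec]
  push_cast
  have e : Real.sin ((j + k - l) * θ) + Real.sin ((j - k + l) * θ) + Real.sin ((-j + k + l) * θ)
      - Real.sin ((j + k + l) * θ)
      = 4 * (Real.sin (j * θ) * Real.sin (k * θ) * Real.sin (l * θ)) := by
    simp only [add_mul, sub_mul, neg_mul, Real.sin_add, Real.sin_sub, Real.cos_add, Real.cos_sub,
      Real.sin_neg, Real.cos_neg]
    ring
  rw [e, smul_eq_mul, mul_inv, mul_inv, mul_inv]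
  ring

/-- Both sides are bounded and linear in each slot, so the product formula for three sines extends
from basis vectors one slot at a time. This identifies `tri x x x` with the cube of the trace. -/
lemma eval_tri (θ : ℝ) (x y z : Coeff) :
    eval θ (tri x y z) = eval θ x * eval θ y * eval θ z := by
  have h3 : ∀ j k, (eval θ).comp (tri (basis j) (basis k))
      = (eval θ (basis j) * eval θ (basis k)) • eval θ := fun j k => clm_ext fun l => by
    rw [ContinuousLinearMap.comp_apply, tri_basis, eval_triVec]
    simp [eval]
  have h2 : ∀ j z, (eval θ).comp ((tri (basis j)).flip z)
      = (eval θ (basis j) * eval θ z) • eval θ := fun j z => clm_ext fun k => by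
    have := congrArg (fun A : Coeff →L[ℝ] ℝ => A z) (h3 j k)
    refine this.trans ?_
    simp only [FunLike.coe_smul, Pi.smul_apply, smul_eq_mul]
    ring
  have h1 : (eval θ).comp ((tri.flip y).flip z) = (eval θ y * eval θ z) • eval θ :=
    clm_ext fun j => by
      have := congrArg (fun A : Coeff →L[ℝ] ℝ => A y) (h2 j z)
      refine this.trans ?_
      simp only [FunLike.coe_smul, Pi.smul_apply, smul_eq_mul]
      ring
  have := congrArg (fun A : Coeff →L[ℝ] ℝ => A x) h1
  refine this.trans ?_
  simp only [FunLike.coe_smul, Pi.smul_apply, smul_eq_mul]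
  ring

/-- Three of the four frequencies produced by `sin³` equal `k` and the fourth is `3k`. The resulting
`3/4` is the source of the constant in the second derivative of the parameter. -/
lemma tri_basis_apply_self {k : ℕ} (hk : 1 ≤ k) :
    (tri (basis k) (basis k) (basis k)) k = 3 / (4 * (k : ℝ) ^ 4) := by
  have hk0 : (k : ℝ) ≠ 0 := by positivity
  rw [tri_basis, triVec]
  have e1 : ((k : ℤ) + k - k) = k := by ring
  have e2 : ((k : ℤ) - k + k) = k := by ring
  have e3 : (-(k : ℤ) + k + k) = k := by ring
  rw [e1, e2, e3]
  have s1 : sinVec (k : ℤ) k = (k : ℝ) ^ 2 := by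
    rw [sinVec, lp.coeFn_smul, Pi.smul_apply, basis_apply, Int.sign_eq_one_of_pos (by omega)]
    simp
  have s2 : sinVec ((k : ℤ) + k + k) k = 0 := by
    rw [sinVec, lp.coeFn_smul, Pi.smul_apply, basis_apply, if_neg (by omega), smul_zero]
  simp only [lp.coeFn_smul, lp.coeFn_sub, lp.coeFn_add, Pi.smul_apply, Pi.sub_apply, Pi.add_apply,
    s1, s2, smul_eq_mul]
  field_simp; ring

/-- The diagonal operator with entries `1 / k`. -/
def invDiag : Coeff →L[ℝ] Coeff := diag (fun k => (k : ℝ)⁻¹) 1 fun k => by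
  rw [abs_of_nonneg (by positivity)]; exact Nat.cast_inv_le_one k

end Coeff

end DeltaWave

end

open MeasureTheory Set Filter Topology
open scoped ContDiff

noncomputable section

namespace DeltaWave

namespace Coeff

/-! ## The bifurcating branch of sine series -/

/-- The affine space of series with coefficient `1` at `sin (κ ·)`, parametrized by `ℓ¹`. -/
def branchBase (κ : ℕ) (z : Coeff) : Coeff :=
  ((κ : ℝ) ^ 2) • basis κ + (z - coord κ z • basis κ)

/-- The reduced equation; the coordinate `z κ` is the variation of the decay rate. -/
def branchMap (κ : ℕ) (s γ : ℝ) (p : ℝ × Coeff) : Coeff :=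
  (2 * (s + coord κ p.2)) • invDiag (branchBase κ p.2) - (2 * s / κ) • branchBase κ p.2
    - (γ * p.1) • tri (branchBase κ p.2) (branchBase κ p.2) (branchBase κ p.2)

lemma invDiag_apply (x : Coeff) (k : ℕ) : invDiag x k = (k : ℝ)⁻¹ * x k := diag_apply x k

lemma branchBase_zero (κ : ℕ) : branchBase κ 0 = ((κ : ℝ) ^ 2) • basis κ := by
  simp [branchBase]

lemma branchBase_apply_self (κ : ℕ) (z : Coeff) : branchBase κ z κ = (κ : ℝ) ^ 2 := by
  simp only [branchBase, lp.coeFn_add, lp.coeFn_sub, lp.coeFn_smul, Pi.add_apply, Pi.sub_apply,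
    Pi.smul_apply, basis_apply, coord_apply, smul_eq_mul, if_true]
  ring

lemma contDiff_branchBase (κ : ℕ) : ContDiff ℝ ω (branchBase κ) := by
  unfold branchBase
  exact contDiff_const.add (contDiff_id.sub ((coord κ).contDiff.smul contDiff_const))

lemma contDiff_tri : ContDiff ℝ ω fun x : Coeff => tri x := by
  exact ContinuousLinearMap.contDiff (𝕜 := ℝ) (E := Coeff)
    (F := Coeff →L[ℝ] Coeff →L[ℝ] Coeff) tri

lemma contDiff_branchMap (κ : ℕ) (s γ : ℝ) : ContDiff ℝ ω (branchMap κ s γ) := by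
  have hb : ContDiff ℝ ω fun p : ℝ × Coeff => branchBase κ p.2 :=
    (contDiff_branchBase κ).comp contDiff_snd
  have hc : ContDiff ℝ ω fun p : ℝ × Coeff => coord κ p.2 := (coord κ).contDiff.comp contDiff_snd
  have hd : ContDiff ℝ ω fun p : ℝ × Coeff => invDiag (branchBase κ p.2) :=
    invDiag.contDiff.comp hb
  have ht₁ : ContDiff ℝ ω fun p : ℝ × Coeff => tri (branchBase κ p.2) :=
    contDiff_tri.comp hb
  have ht : ContDiff ℝ ω fun p : ℝ × Coeff =>
      tri (branchBase κ p.2) (branchBase κ p.2) (branchBase κ p.2) :=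
    (ht₁.clm_apply hb).clm_apply hb
  unfold branchMap
  have h1 : ContDiff ℝ ω fun p : ℝ × Coeff => 2 * (s + coord κ p.2) :=
    contDiff_const.mul (contDiff_const.add hc)
  have h2 : ContDiff ℝ ω fun p : ℝ × Coeff => γ * p.1 := contDiff_const.mul contDiff_fst
  exact ((h1.smul hd).sub (hb.const_smul _)).sub (h2.smul ht)

/-- The entries of the linearization. -/
def linEntry (κ : ℕ) (s : ℝ) (k : ℕ) : ℝ := if k = κ then 2 * κ else 2 * s * ((k : ℝ)⁻¹ - (κ : ℝ)⁻¹)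

lemma abs_linEntry_le {κ : ℕ} (hκ : 1 ≤ κ) {s : ℝ} (hs : 0 < s) (k : ℕ) :
    |linEntry κ s k| ≤ 2 * κ + 4 * s := by
  have h1 : (0 : ℝ) ≤ (k : ℝ)⁻¹ := by positivity
  have h2 : (k : ℝ)⁻¹ ≤ 1 := Nat.cast_inv_le_one k
  have h3 : (0 : ℝ) ≤ (κ : ℝ)⁻¹ := by positivity
  have h4 : (κ : ℝ)⁻¹ ≤ 1 := Nat.cast_inv_le_one κ
  have h5 : (0 : ℝ) ≤ κ := by positivity
  unfold linEntry
  split_ifs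
  · rw [abs_of_nonneg (by positivity)]; linarith
  · rw [abs_le]; constructor <;> nlinarith

/-- Off the slot `κ` the entry is proportional to `1/k - 1/κ`, which over `k ≥ 1` is closest to zero
at the neighbour `k = κ + 1`, where it equals `-1/(κ(κ + 1))`. For `k = 0` the inverse is zero and
the modulus `1/κ` is larger. This uniform gap makes the linearization invertible. -/
lemma abs_linEntry_ge {κ : ℕ} (hκ : 1 ≤ κ) {s : ℝ} (hs : 0 < s) (k : ℕ) :
    min (2 * (κ : ℝ)) (2 * s * ((κ : ℝ) * (κ + 1))⁻¹) ≤ |linEntry κ s k| := by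
  have hκ' : (1 : ℝ) ≤ κ := by exact_mod_cast hκ
  unfold linEntry
  split_ifs with h
  · exact (min_le_left _ _).trans (le_abs_self _)
  refine (min_le_right _ _).trans ?_
  rw [abs_mul, abs_of_pos (by positivity : (0 : ℝ) < 2 * s)]
  refine mul_le_mul_of_nonneg_left ?_ (by positivity)
  rcases Nat.eq_zero_or_pos k with rfl | hk
  · rw [Nat.cast_zero, inv_zero, zero_sub, abs_neg, abs_of_nonneg (by positivity)]
    exact inv_anti₀ (by positivity) (by nlinarith)
  have hk' : (1 : ℝ) ≤ k := by exact_mod_cast hk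
  have e : (k : ℝ)⁻¹ - (κ : ℝ)⁻¹ = (κ - k) * ((κ : ℝ) * k)⁻¹ := by field_simp
  rcases lt_or_gt_of_ne h with hlt | hlt
  · have h1 : (k : ℝ) + 1 ≤ κ := by exact_mod_cast hlt
    refine le_trans ?_ (le_abs_self _)
    rw [e]
    calc ((κ : ℝ) * (κ + 1))⁻¹ ≤ ((κ : ℝ) * k)⁻¹ := inv_anti₀ (by positivity) (by nlinarith)
      _ ≤ _ := le_mul_of_one_le_left (by positivity) (by linarith)
  · have h1 : (κ : ℝ) + 1 ≤ k := by exact_mod_cast hlt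
    refine le_trans ?_ (neg_le_abs _)
    rw [e, mul_inv, mul_inv, ← neg_mul, neg_sub, mul_left_comm]
    refine mul_le_mul_of_nonneg_left ?_ (by positivity)
    rw [← div_eq_mul_inv, le_div_iff₀ (by positivity), inv_mul_le_iff₀ (by positivity)]
    nlinarith

lemma isInvertible_diag {d : ℕ → ℝ} {C c : ℝ} (hd : ∀ k, |d k| ≤ C) (hc : 0 < c)
    (hd' : ∀ k, c ≤ |d k|) : (diag d C hd).IsInvertible := by
  have hne : ∀ k, d k ≠ 0 := fun k h => by
    have := hd' k
    rw [h, abs_zero] at this; linarith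
  have hi : ∀ k, |(d k)⁻¹| ≤ c⁻¹ := fun k => by
    rw [abs_inv]; exact inv_anti₀ hc (hd' k)
  refine ⟨ContinuousLinearEquiv.equivOfInverse (diag d C hd) (diag (fun k => (d k)⁻¹) c⁻¹ hi)
    (fun x => ?_) (fun x => ?_), rfl⟩
  · refine lp.ext (funext fun k => ?_)
    rw [diag_apply, diag_apply, inv_mul_cancel_left₀ (hne k)]
  · refine lp.ext (funext fun k => ?_)
    rw [diag_apply, diag_apply, mul_inv_cancel_left₀ (hne k)]

lemma branchMap_zero (κ : ℕ) (s γ : ℝ) : branchMap κ s γ (0, 0) = 0 := by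
  refine lp.ext (funext fun k => ?_)
  simp only [branchMap, branchBase_zero, lp.coeFn_sub, lp.coeFn_smul, Pi.sub_apply, Pi.smul_apply,
    invDiag_apply, basis_apply, smul_eq_mul, map_zero, mul_zero, zero_mul, lp.coeFn_zero,
    Pi.zero_apply, add_zero, sub_zero]
  split_ifs with h
  · rw [h]; ring
  · ring

/-- The linearization in `z` is diagonal. -/
lemma hasFDerivAt_branchMap {κ : ℕ} (hκ : 1 ≤ κ) {s : ℝ} (hs : 0 < s) (γ : ℝ) :
    HasFDerivAt (fun z => branchMap κ s γ (0, z))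
      (diag (linEntry κ s) (2 * κ + 4 * s) (abs_linEntry_le hκ hs)) 0 := by
  have hκ0 : (κ : ℝ) ≠ 0 := by positivity
  -- The linear part of the affine map `branchBase κ`: it removes the coordinate `κ`, which
  -- therefore acts only through the rate `s + coord κ z`. Its derivative there is `2 · κ⁻¹ · κ² =
  -- 2κ`, and the cubic term is absent at `τ = 0`.
  set P : Coeff →L[ℝ] Coeff := ContinuousLinearMap.id ℝ Coeff - (coord κ).smulRight (basis κ)
    with hP
  have hb : HasFDerivAt (branchBase κ) P 0 := by
    have h := (P.hasFDerivAt (x := (0 : Coeff))).const_add (((κ : ℝ) ^ 2) • basis κ)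
    exact h
  have hc : HasFDerivAt (fun z : Coeff => 2 * (s + coord κ z)) ((2 : ℝ) • coord κ) 0 :=
    (((coord κ).hasFDerivAt (x := (0 : Coeff))).const_add s).const_mul 2
  have h := (hc.smul (invDiag.hasFDerivAt.comp 0 hb)).sub (hb.const_smul (2 * s / κ))
  have he : (fun z => branchMap κ s γ (0, z)) = fun z => (2 * (s + coord κ z)) •
      (invDiag ∘ branchBase κ) z - (2 * s / κ) • branchBase κ z := by
    funext z
    simp [branchMap]
  rw [he]
  refine h.congr_fderiv (clm_ext fun j => lp.ext (funext fun k => ?_))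
  have e1 : coord κ (basis j) = if κ = j then 1 else 0 := basis_apply j κ
  simp only [hP, diag_basis, Function.comp_apply, branchBase_zero, map_zero, add_zero,
    add_apply, sub_apply, smul_apply,
    ContinuousLinearMap.smulRight_apply, ContinuousLinearMap.comp_apply,
    ContinuousLinearMap.id_apply, lp.coeFn_add, lp.coeFn_sub, lp.coeFn_smul, Pi.add_apply,
    Pi.sub_apply, Pi.smul_apply, invDiag_apply, basis_apply, smul_eq_mul, e1, linEntry]
  by_cases hj : j = κ
  · subst hj
    by_cases hkj : k = j
    · subst hkj; simp; field_simp
    · simp [hkj]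
  · by_cases hkj : k = j
    · subst hkj; simp [hj, Ne.symm hj]; ring
    · simp [hkj, hj, Ne.symm hj]

/-- The implicit function theorem applied to `branchMap` at the origin. The second identity is the
coordinate `κ` of the first, where `w τ κ` is frozen at `κ²`; it expresses `σ τ - s` as `τ` times a
continuous function and so determines `σ'(0)` without differentiating `w`. -/
theorem exists_branch {κ : ℕ} (hκ : 1 ≤ κ) {s : ℝ} (hs : 0 < s) (γ : ℝ) :
    ∃ (w : ℝ → Coeff) (σ : ℝ → ℝ), ContDiffAt ℝ ω w 0 ∧ ContDiffAt ℝ ω σ 0 ∧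
      w 0 = ((κ : ℝ) ^ 2) • basis κ ∧ σ 0 = s ∧
      ∀ᶠ τ in 𝓝 (0 : ℝ),
        (2 * σ τ) • invDiag (w τ) - (2 * s / κ) • w τ - (γ * τ) • tri (w τ) (w τ) (w τ) = 0 ∧
        2 * κ * (σ τ - s) = γ * τ * tri (w τ) (w τ) (w τ) κ := by
  have hκ0 : (κ : ℝ) ≠ 0 := by positivity
  have hcd : ContDiffAt ℝ ω (branchMap κ s γ) (0, 0) := (contDiff_branchMap κ s γ).contDiffAt
  have hω : (ω : WithTop ℕ∞) ≠ 0 := by simp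
  have hinv : (fderiv ℝ (branchMap κ s γ) (0, 0) ∘L .inr ℝ ℝ Coeff).IsInvertible := by
    have h1 : HasFDerivAt (fun z : Coeff => branchMap κ s γ (0, z))
        (fderiv ℝ (branchMap κ s γ) (0, 0) ∘L .inr ℝ ℝ Coeff) 0 :=
      (hcd.differentiableAt hω).hasFDerivAt.comp (0 : Coeff) (hasFDerivAt_prodMk_right (0 : ℝ) 0)
    rw [h1.unique (hasFDerivAt_branchMap hκ hs γ)]
    refine isInvertible_diag _ (c := min (2 * (κ : ℝ)) (2 * s * ((κ : ℝ) * (κ + 1))⁻¹)) ?_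
      (abs_linEntry_ge hκ hs)
    exact lt_min (by positivity) (by positivity)
  set ψ := hcd.implicitFunction hω hinv with hψ
  have hψ0 : ψ 0 = 0 := hcd.implicitFunction_apply_self hω hinv
  have hψc : ContDiffAt ℝ ω ψ 0 := hcd.contDiffAt_implicitFunction hω hinv
  have hψe : ∀ᶠ τ in 𝓝 (0 : ℝ), branchMap κ s γ (τ, ψ τ) = 0 := by
    have := hcd.eventually_apply_implicitFunction hω hinv
    rwa [branchMap_zero] at this
  refine ⟨fun τ => branchBase κ (ψ τ), fun τ => s + coord κ (ψ τ),
    (contDiff_branchBase κ).contDiffAt.comp 0 hψc,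
    contDiffAt_const.add ((coord κ).contDiff.contDiffAt.comp 0 hψc), ?_, ?_, ?_⟩
  · simp only [hψ0, branchBase_zero]
  · simp only [hψ0, map_zero, add_zero]
  · filter_upwards [hψe] with τ hτ
    refine ⟨hτ, ?_⟩
    have h1 := congrArg (fun x : Coeff => x κ) hτ
    simp only [branchMap, lp.coeFn_sub, lp.coeFn_smul, Pi.sub_apply, Pi.smul_apply, invDiag_apply,
      smul_eq_mul, lp.coeFn_zero, Pi.zero_apply, branchBase_apply_self] at h1
    have e : 2 * (s + coord κ (ψ τ)) * ((κ : ℝ)⁻¹ * (κ : ℝ) ^ 2) - 2 * s / κ * (κ : ℝ) ^ 2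
        = 2 * κ * (s + coord κ (ψ τ) - s) := by field_simp
    rw [e] at h1
    linarith

end Coeff

end DeltaWave

end

open MeasureTheory Set Filter Topology
open scoped ContDiff

noncomputable section

namespace DeltaWave

/-! ## Weak derivatives on the torus and on the strip -/

lemma ae_mem_torus : ∀ᵐ x ∂torusMeasure, x ∈ Icc 0 (2 * Real.pi) := by
  unfold torusMeasure
  filter_upwards [ae_restrict_mem measurableSet_Ioc] with x hx
  exact Ioc_subset_Icc_self hx

lemma ae_mem_strip : ∀ᵐ p ∂stripMeasure, p.1 ∈ Icc 0 (2 * Real.pi) :=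
  (Measure.quasiMeasurePreserving_fst (μ := torusMeasure) (ν := volume)).ae ae_mem_torus

lemma memLp_torus_of_continuous {f : ℝ → ℝ} (hf : Continuous f) : MemLp f 2 torusMeasure := by
  obtain ⟨C, hC⟩ := (isCompact_Icc (a := (0 : ℝ)) (b := 2 * Real.pi)).exists_bound_of_continuousOn
    hf.continuousOn
  exact MemLp.of_bound hf.aestronglyMeasurable C (ae_mem_torus.mono fun x hx => hC x hx)

lemma memLp_strip_of_test {g : ℝ × ℝ → ℝ} (hg : Continuous g)
    (hs : ∃ R : ℝ, ∀ x y, R < |y| → g (x, y) = 0) : MemLp g 2 stripMeasure := by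
  obtain ⟨R, hR⟩ := hs
  set K : Set (ℝ × ℝ) := Icc 0 (2 * Real.pi) ×ˢ Icc (-R) R with hK
  have hKc : IsCompact K := isCompact_Icc.prod isCompact_Icc
  have hfin : stripMeasure K < ⊤ := by
    rw [hK, stripMeasure, Measure.prod_prod]
    exact ENNReal.mul_lt_top (measure_lt_top _ _) (by simp)
  obtain ⟨C, hC⟩ := hKc.exists_bound_of_continuousOn hg.continuousOn
  have h1 : MemLp (K.indicator fun _ => max C 0) 2 stripMeasure :=
    memLp_indicator_const 2 hKc.measurableSet _ (Or.inr hfin.ne)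
  refine h1.mono hg.aestronglyMeasurable ?_
  filter_upwards [ae_mem_strip] with p hp
  by_cases hpK : p ∈ K
  · rw [indicator_of_mem hpK, Real.norm_of_nonneg (le_max_right C 0)]
    exact (hC p hpK).trans (le_max_left _ _)
  · have : R < |p.2| := by
      by_contra hcon
      exact hpK ⟨hp, abs_le.mp (not_lt.mp hcon)⟩
    rw [show g p = 0 from hR p.1 p.2 this, norm_zero]
    exact norm_nonneg _

lemma memLp_exp_strip {σ : ℝ} (hσ : 0 < σ) :
    MemLp (fun p : ℝ × ℝ => Real.exp (-σ * |p.2|)) 2 stripMeasure := by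
  rw [memLp_two_iff_integrable_sq (by fun_prop)]
  have h := (integrable_const (1 : ℝ) (μ := torusMeasure)).mul_prod
    (memLp_exp_neg_mul_abs hσ).integrable_sq
  simpa [stripMeasure] using h

/-- Integration against a square integrable function. -/
def pairing {α : Type*} [MeasurableSpace α] {μ : Measure α} {h : α → ℝ} (hh : MemLp h 2 μ) :
    Lp ℝ 2 μ →L[ℝ] ℝ := innerSL ℝ (hh.toLp h)

lemma pairing_apply {α : Type*} [MeasurableSpace α] {μ : Measure α} {h : α → ℝ} (hh : MemLp h 2 μ)
    (F : Lp ℝ 2 μ) : pairing hh F = ∫ p, F p * h p ∂μ := by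
  rw [pairing, innerSL_apply_apply, L2.inner_def]
  refine integral_congr_ae ?_
  filter_upwards [hh.coeFn_toLp] with p hp
  rw [hp]; rfl

/-- For a fixed test function both sides of the defining identity are bounded functionals of `x`, so
the identity passes from single modes to `ℓ¹` superpositions. -/
lemma HasWeakDerivStrip.of_basis {d : ℝ × ℝ} {A B : Coeff →L[ℝ] StripL2}
    (h : ∀ k, HasWeakDerivStrip d (A (Coeff.basis k)) (B (Coeff.basis k))) (x : Coeff) :
    HasWeakDerivStrip d (A x) (B x) := by
  intro ψ hψ
  have h1 : MemLp (fun p => fderiv ℝ ψ p d) 2 stripMeasure :=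
    memLp_strip_of_test ((hψ.smooth.continuous_fderiv (by norm_num)).clm_apply continuous_const)
      (hψ.fderiv_supp d)
  have h2 : MemLp ψ 2 stripMeasure := memLp_strip_of_test hψ.smooth.continuous hψ.supp
  have key : (pairing h1).comp A = -(pairing h2).comp B := Coeff.clm_ext fun k => by
    simp only [neg_apply, ContinuousLinearMap.comp_apply, pairing_apply]
    exact h k ψ hψ
  have := congrArg (fun L : Coeff →L[ℝ] ℝ => L x) key
  simpa only [neg_apply, ContinuousLinearMap.comp_apply, pairing_apply] using this

lemma HasWeakDerivTorus.of_basis {A B : Coeff →L[ℝ] TorusL2}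
    (h : ∀ k, HasWeakDerivTorus (A (Coeff.basis k)) (B (Coeff.basis k))) (x : Coeff) :
    HasWeakDerivTorus (A x) (B x) := by
  intro ψ hψ hp
  have h1 : MemLp (deriv ψ) 2 torusMeasure :=
    memLp_torus_of_continuous (hψ.continuous_deriv (by norm_num))
  have h2 : MemLp ψ 2 torusMeasure := memLp_torus_of_continuous hψ.continuous
  have key : (pairing h1).comp A = -(pairing h2).comp B := Coeff.clm_ext fun k => by
    simp only [neg_apply, ContinuousLinearMap.comp_apply, pairing_apply]
    exact h k ψ hψ hp
  have := congrArg (fun L : Coeff →L[ℝ] ℝ => L x) key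
  simpa only [neg_apply, ContinuousLinearMap.comp_apply, pairing_apply] using this

lemma HasWeakDerivStrip.congr {d : ℝ × ℝ} {F G F' G' : ℝ × ℝ → ℝ} (h : HasWeakDerivStrip d F G)
    (hF : F' =ᵐ[stripMeasure] F) (hG : G' =ᵐ[stripMeasure] G) : HasWeakDerivStrip d F' G' := by
  intro ψ hψ
  have e1 : ∫ p, F' p * fderiv ℝ ψ p d ∂stripMeasure = ∫ p, F p * fderiv ℝ ψ p d ∂stripMeasure :=
    integral_congr_ae (hF.mono fun p hp => by simp only [hp])
  have e2 : ∫ p, G' p * ψ p ∂stripMeasure = ∫ p, G p * ψ p ∂stripMeasure :=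
    integral_congr_ae (hG.mono fun p hp => by simp only [hp])
  rw [e1, e2, h ψ hψ]

lemma HasWeakDerivTorus.congr {F G F' G' : ℝ → ℝ} (h : HasWeakDerivTorus F G)
    (hF : F' =ᵐ[torusMeasure] F) (hG : G' =ᵐ[torusMeasure] G) : HasWeakDerivTorus F' G' := by
  intro ψ hψ hp
  have e1 : ∫ x, F' x * deriv ψ x ∂torusMeasure = ∫ x, F x * deriv ψ x ∂torusMeasure :=
    integral_congr_ae (hF.mono fun p hp => by simp only [hp])
  have e2 : ∫ x, G' x * ψ x ∂torusMeasure = ∫ x, G x * ψ x ∂torusMeasure :=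
    integral_congr_ae (hG.mono fun p hp => by simp only [hp])
  rw [e1, e2, h ψ hψ hp]

lemma integral_torus (f : ℝ → ℝ) : ∫ x, f x ∂torusMeasure = ∫ x in (0 : ℝ)..(2 * Real.pi), f x := by
  rw [torusMeasure, intervalIntegral.integral_of_le (by positivity)]

/-- Integration by parts on the torus. -/
lemma integral_torus_by_parts {a a' ψ ψ' : ℝ → ℝ} (ha : ∀ x, HasDerivAt a (a' x) x)
    (ha' : Continuous a') (hψ : ∀ x, HasDerivAt ψ (ψ' x) x) (hψ' : Continuous ψ')
    (hp : a (2 * Real.pi) = a 0) (hp' : ψ (2 * Real.pi) = ψ 0) :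
    ∫ x, a x * ψ' x ∂torusMeasure = - ∫ x, a' x * ψ x ∂torusMeasure := by
  rw [integral_torus, integral_torus, intervalIntegral.integral_mul_deriv_eq_deriv_mul
    (fun x _ => ha x) (fun x _ => hψ x) (ha'.intervalIntegrable _ _) (hψ'.intervalIntegrable _ _),
    hp, hp']
  ring

lemma HasWeakDerivTorus.of_hasDerivAt {a a' : ℝ → ℝ} (ha : ∀ x, HasDerivAt a (a' x) x)
    (ha' : Continuous a') (hp : a (2 * Real.pi) = a 0) : HasWeakDerivTorus a a' := by
  intro ψ hψ hψp
  refine integral_torus_by_parts ha ha'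
    (fun x => (hψ.differentiable (by norm_num) x).hasDerivAt)
    (hψ.continuous_deriv (by norm_num)) hp ?_
  have := hψp 0
  rwa [zero_add] at this

lemma integrable_memLp_mul {F : ℝ × ℝ → ℝ} (hF : MemLp F 2 stripMeasure) {g : ℝ × ℝ → ℝ}
    (hg : Continuous g) (hs : ∃ R : ℝ, ∀ x y, R < |y| → g (x, y) = 0) :
    Integrable (fun p => F p * g p) stripMeasure :=
  hF.integrable_mul (memLp_strip_of_test hg hs)

lemma hasDerivAt_fst {ψ : ℝ × ℝ → ℝ} (hψ : ContDiff ℝ ∞ ψ) (x y : ℝ) :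
    HasDerivAt (fun x => ψ (x, y)) (fderiv ℝ ψ (x, y) (1, 0)) x :=
  (hψ.differentiable (by norm_num) (x, y)).hasFDerivAt.comp_hasDerivAt x
    ((hasDerivAt_id x).prodMk (hasDerivAt_const x y))

lemma hasDerivAt_snd {ψ : ℝ × ℝ → ℝ} (hψ : ContDiff ℝ ∞ ψ) (x y : ℝ) :
    HasDerivAt (fun y => ψ (x, y)) (fderiv ℝ ψ (x, y) (0, 1)) y :=
  (hψ.differentiable (by norm_num) (x, y)).hasFDerivAt.comp_hasDerivAt y
    ((hasDerivAt_const y x).prodMk (hasDerivAt_id y))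

lemma hasWeakDx_mul {a a' b : ℝ → ℝ} (ha : ∀ x, HasDerivAt a (a' x) x) (ha' : Continuous a')
    (hp : a (2 * Real.pi) = a 0) (h1 : MemLp (fun p : ℝ × ℝ => a p.1 * b p.2) 2 stripMeasure)
    (h2 : MemLp (fun p : ℝ × ℝ => a' p.1 * b p.2) 2 stripMeasure) :
    HasWeakDx (fun p => a p.1 * b p.2) fun p => a' p.1 * b p.2 := by
  intro ψ hψ
  have hc : Continuous fun p => fderiv ℝ ψ p (1, 0) :=
    (hψ.smooth.continuous_fderiv (by norm_num)).clm_apply continuous_const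
  have i1 := integrable_memLp_mul h1 hc (hψ.fderiv_supp _)
  have i2 := integrable_memLp_mul h2 hψ.smooth.continuous hψ.supp
  unfold stripMeasure at *
  rw [integral_prod_symm _ i1, integral_prod_symm _ i2, ← integral_neg]
  refine integral_congr_ae (.of_forall fun y => ?_)
  have := integral_torus_by_parts ha ha' (fun x => hasDerivAt_fst hψ.smooth x y)
    (hc.comp (continuous_id.prodMk continuous_const)) hp
    (by have := hψ.periodic 0 y; rwa [zero_add] at this)
  have e : ∀ c d : ℝ, c * b y * d = b y * (c * d) := fun c d => by ring
  simp only [e, integral_const_mul, this, mul_neg]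

lemma hasWeakDy_mul {a b b' : ℝ → ℝ} (hb : HasWeakDerivOn univ b b')
    (h1 : MemLp (fun p : ℝ × ℝ => a p.1 * b p.2) 2 stripMeasure)
    (h2 : MemLp (fun p : ℝ × ℝ => a p.1 * b' p.2) 2 stripMeasure) :
    HasWeakDy (fun p => a p.1 * b p.2) fun p => a p.1 * b' p.2 := by
  intro ψ hψ
  have hc : Continuous fun p => fderiv ℝ ψ p (0, 1) :=
    (hψ.smooth.continuous_fderiv (by norm_num)).clm_apply continuous_const
  have i1 := integrable_memLp_mul h1 hc (hψ.fderiv_supp _)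
  have i2 := integrable_memLp_mul h2 hψ.smooth.continuous hψ.supp
  unfold stripMeasure at *
  rw [integral_prod _ i1, integral_prod _ i2, ← integral_neg]
  refine integral_congr_ae (.of_forall fun x => ?_)
  obtain ⟨R, hR⟩ := hψ.supp
  have hcs : HasCompactSupport fun y => ψ (x, y) :=
    HasCompactSupport.intro (isCompact_Icc (a := -R) (b := R)) fun y hy =>
      hR x y (by by_contra hcon; exact hy (abs_le.mp (not_lt.mp hcon)))
  have h := hb.integral_line (hψ.smooth.comp (contDiff_const.prodMk contDiff_id)) hcs
    (subset_univ _)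
  have hd : deriv (fun y => ψ (x, y)) = fun y => fderiv ℝ ψ (x, y) (0, 1) :=
    funext fun y => (hasDerivAt_snd hψ.smooth x y).deriv
  have h' : ∫ y, fderiv ℝ ψ (x, y) (0, 1) * b y = - ∫ y, ψ (x, y) * b' y := by
    have e : ∀ y, deriv (ψ ∘ fun y => (x, y)) y = fderiv ℝ ψ (x, y) (0, 1) := fun y =>
      congrFun hd y
    simpa [e] using h
  have e : ∀ c d e : ℝ, c * d * e = c * (e * d) := fun c d e => by ring
  simp only [e, integral_const_mul, h', mul_neg]

end DeltaWave

end

open MeasureTheory Set Filter Topology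
open scoped ContDiff

noncomputable section

namespace DeltaWave

/-! ## Waves with a given transversal profile -/

/-- A differentiable function `p` with derivative `q`, both bounded by `C e^{-σ r}` on `[0,∞)`. -/
structure IsProfile (σ C : ℝ) (p q : ℝ → ℝ) : Prop where
  pos : 0 < σ
  hasDerivAt : ∀ r, HasDerivAt p (q r) r
  cont : Continuous q
  bound : ∀ r, 0 ≤ r → |p r| ≤ C * Real.exp (-σ * r)
  bound_deriv : ∀ r, 0 ≤ r → |q r| ≤ C * Real.exp (-σ * r)

namespace IsProfile

variable {σ C : ℝ} {p q : ℝ → ℝ}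

lemma continuous (h : IsProfile σ C p q) : Continuous p :=
  continuous_iff_continuousAt.mpr fun r => (h.hasDerivAt r).continuousAt

lemma nonneg (h : IsProfile σ C p q) : 0 ≤ C := by
  have := (abs_nonneg _).trans (h.bound 0 le_rfl)
  simpa using this

/-- Since `k|y| ≥ |y|` for `k ≥ 1`, evaluating one profile at `k|y|` gives a bound independent of
`k`. -/
lemma scaled_bound {f : ℝ → ℝ} (hσ : 0 < σ) (hC : 0 ≤ C)
    (hf : ∀ r, 0 ≤ r → |f r| ≤ C * Real.exp (-σ * r))
    {k : ℕ} (hk : 1 ≤ k) (y : ℝ) : |f (k * |y|)| ≤ C * Real.exp (-σ * |y|) := by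
  have hk' : (1 : ℝ) ≤ k := by exact_mod_cast hk
  refine (hf _ (by positivity)).trans ?_
  have : |y| ≤ k * |y| := le_mul_of_one_le_left (abs_nonneg _) hk'
  gcongr C * Real.exp ?_
  nlinarith

/-- The functions `c k * t (k x) * b k y` that make up the components of a wave. -/
def modeFn (c : ℕ → ℝ) (t : ℝ → ℝ) (b : ℕ → ℝ → ℝ) (k : ℕ) (z : ℝ × ℝ) : ℝ :=
  c k * t (k * z.1) * b k z.2

end IsProfile

open IsProfile

/-- Conditions under which the functions `modeFn c t b k` are uniformly dominated. -/
structure IsModeFamily (σ C : ℝ) (c : ℕ → ℝ) (t : ℝ → ℝ) (b : ℕ → ℝ → ℝ) : Prop where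
  pos : 0 < σ
  nonneg : 0 ≤ C
  cont : Continuous t
  meas : ∀ k, Measurable (b k)
  bound : ∀ k x y, |c k * t (k * x) * b k y| ≤ C * Real.exp (-σ * |y|)

/-- The norm of the dominating function. -/
def domNorm (σ : ℝ) (hσ : 0 < σ) : ℝ := ‖(memLp_exp_strip hσ).toLp _‖

namespace IsModeFamily

variable {σ C : ℝ} {c : ℕ → ℝ} {t : ℝ → ℝ} {b : ℕ → ℝ → ℝ}

lemma memLp (h : IsModeFamily σ C c t b) (k : ℕ) : MemLp (modeFn c t b k) 2 stripMeasure := by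
  have hm : Measurable (modeFn c t b k) := by
    unfold modeFn
    exact (measurable_const.mul (h.cont.measurable.comp (measurable_const.mul measurable_fst))).mul
      ((h.meas k).comp measurable_snd)
  refine ((memLp_exp_strip h.pos).const_mul C).mono hm.aestronglyMeasurable (.of_forall fun z => ?_)
  rw [Real.norm_eq_abs, Real.norm_of_nonneg (mul_nonneg h.nonneg (Real.exp_pos _).le)]
  exact h.bound k z.1 z.2

lemma norm_toLp_le (h : IsModeFamily σ C c t b) (k : ℕ) :
    ‖(h.memLp k).toLp _‖ ≤ C * domNorm σ h.pos := by
  have e : C * domNorm σ h.pos = ‖((memLp_exp_strip h.pos).const_smul C).toLp _‖ := by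
    rw [MemLp.toLp_const_smul, norm_smul, Real.norm_of_nonneg h.nonneg, domNorm]
  rw [e]
  refine Lp.norm_le_norm_of_ae_le ?_
  filter_upwards [(h.memLp k).coeFn_toLp, ((memLp_exp_strip h.pos).const_smul C).coeFn_toLp]
    with z h1 h2
  rw [h1, h2, Real.norm_eq_abs, Pi.smul_apply, smul_eq_mul,
    Real.norm_of_nonneg (mul_nonneg h.nonneg (Real.exp_pos _).le)]
  exact h.bound k z.1 z.2

/-- The superposition operator `x ↦ ∑ x k • modeFn c t b k`. -/
def op (h : IsModeFamily σ C c t b) : Coeff →L[ℝ] StripL2 :=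
  Coeff.lift (fun k => (h.memLp k).toLp _) (C * domNorm σ h.pos) h.norm_toLp_le

lemma op_basis (h : IsModeFamily σ C c t b) (k : ℕ) :
    h.op (Coeff.basis k) = (h.memLp k).toLp _ := Coeff.lift_basis k

lemma op_basis_ae (h : IsModeFamily σ C c t b) (k : ℕ) :
    h.op (Coeff.basis k) =ᵐ[stripMeasure] modeFn c t b k := by
  rw [op_basis]; exact MemLp.coeFn_toLp _

lemma norm_op_le (h : IsModeFamily σ C c t b) : ‖h.op‖ ≤ C * domNorm σ h.pos :=
  Coeff.norm_lift_le (mul_nonneg h.nonneg (norm_nonneg _))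

end IsModeFamily

/-- Limits of series in `L²` agree with pointwise sums. -/
lemma Coeff.lift_ae_eq {α : Type*} [MeasurableSpace α] {μ : Measure α} {v : ℕ → Lp ℝ 2 μ} {C : ℝ}
    {hv : ∀ k, ‖v k‖ ≤ C} {f : ℕ → α → ℝ} (hf : ∀ k, v k =ᵐ[μ] f k) (x : Coeff) {U : α → ℝ}
    (hU : ∀ a, HasSum (fun k => x k * f k a) (U a)) : Coeff.lift v C hv x =ᵐ[μ] U := by
  have h1 : Tendsto (fun n => ∑ k ∈ Finset.range n, x k • v k) atTop (𝓝 (Coeff.lift v C hv x)) :=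
    (Coeff.hasSum_lift x).tendsto_sum_nat
  -- Convergence in `L²` yields convergence almost everywhere only along a subsequence; since the
  -- whole pointwise series converges, this suffices to identify the limit.
  have h2 := (tendstoInMeasure_of_tendsto_Lp h1)
  obtain ⟨ns, hns, h3⟩ := h2.exists_seq_tendsto_ae
  have h4 : ∀ n, (∑ k ∈ Finset.range n, x k • v k : Lp ℝ 2 μ)
      =ᵐ[μ] fun a => ∑ k ∈ Finset.range n, x k * f k a := by
    intro n
    induction n with
    | zero =>
      simp only [Finset.range_zero, Finset.sum_empty]
      exact Lp.coeFn_zero ℝ 2 μ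
    | succ n ih =>
      rw [Finset.sum_range_succ]
      filter_upwards [Lp.coeFn_add (∑ k ∈ Finset.range n, x k • v k) (x n • v n),
        Lp.coeFn_smul (x n) (v n), hf n, ih] with a e1 e2 e3 e4
      rw [e1, Pi.add_apply, e2, Pi.smul_apply, e3, e4, Finset.sum_range_succ, smul_eq_mul]
  filter_upwards [h3, ae_all_iff.mpr h4] with a ha hb
  refine tendsto_nhds_unique ha ?_
  simp only [hb]
  exact (hU a).tendsto_sum_nat.comp hns.tendsto_atTop

/-- The functions `c k * t (k x)` on the torus. -/
def torusMode (c : ℕ → ℝ) (t : ℝ → ℝ) (k : ℕ) (x : ℝ) : ℝ := c k * t (k * x)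

lemma continuous_torusMode (c : ℕ → ℝ) {t : ℝ → ℝ} (ht : Continuous t) (k : ℕ) :
    Continuous (torusMode c t k) := by unfold torusMode; fun_prop

/-- The norm of the constant function `1` on the torus. -/
def torusOneNorm : ℝ := ‖(memLp_torus_of_continuous (continuous_const (y := (1 : ℝ)))).toLp _‖

lemma norm_torusMode_le {c : ℕ → ℝ} {t : ℝ → ℝ} (ht : Continuous t)
    (hb : ∀ k x, |c k * t (k * x)| ≤ 1) (k : ℕ) :
    ‖(memLp_torus_of_continuous (continuous_torusMode c ht k)).toLp _‖ ≤ torusOneNorm := by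
  refine Lp.norm_le_norm_of_ae_le ?_
  filter_upwards [(memLp_torus_of_continuous (continuous_torusMode c ht k)).coeFn_toLp,
    (memLp_torus_of_continuous (continuous_const (y := (1 : ℝ)))).coeFn_toLp] with x h1 h2
  rw [h1, h2, norm_one]
  exact hb k x

/-- The superposition operator on the torus. -/
def torusOp {c : ℕ → ℝ} {t : ℝ → ℝ} (ht : Continuous t)
    (hb : ∀ k x, |c k * t (k * x)| ≤ 1) : Coeff →L[ℝ] TorusL2 :=
  Coeff.lift (fun k => (memLp_torus_of_continuous (continuous_torusMode c ht k)).toLp _)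
    torusOneNorm (norm_torusMode_le ht hb)

lemma torusOp_basis_ae {c : ℕ → ℝ} {t : ℝ → ℝ} (ht : Continuous t)
    (hb : ∀ k x, |c k * t (k * x)| ≤ 1) (k : ℕ) :
    torusOp ht hb (Coeff.basis k) =ᵐ[torusMeasure] torusMode c t k := by
  rw [torusOp, Coeff.lift_basis]; exact MemLp.coeFn_toLp _

lemma nat_inv_sq_le_one (k : ℕ) : ((k : ℝ) ^ 2)⁻¹ ≤ 1 := by
  rw [← inv_pow]
  exact pow_le_one₀ (by positivity) (Nat.cast_inv_le_one k)

lemma abs_mul_le_one_of {a b : ℝ} (h0 : 0 ≤ a) (ha : a ≤ 1) (hb : |b| ≤ 1) : |a * b| ≤ 1 := by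
  rw [abs_mul, abs_of_nonneg h0]
  exact mul_le_one₀ ha (abs_nonneg _) hb

lemma sin_coeff_bound (k : ℕ) (x : ℝ) : |((k : ℝ) ^ 2)⁻¹ * Real.sin (k * x)| ≤ 1 :=
  abs_mul_le_one_of (by positivity) (nat_inv_sq_le_one k) (Real.abs_sin_le_one _)

lemma cos_coeff_bound (k : ℕ) (x : ℝ) : |(k : ℝ)⁻¹ * Real.cos (k * x)| ≤ 1 :=
  abs_mul_le_one_of (by positivity) (Nat.cast_inv_le_one k) (Real.abs_cos_le_one _)

lemma neg_sin_coeff_bound (k : ℕ) (x : ℝ) : |(-1 : ℝ) * Real.sin (k * x)| ≤ 1 := by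
  rw [neg_one_mul, abs_neg]; exact Real.abs_sin_le_one _

/-- A sine series together with its first two derivatives. -/
def torusTriple : Coeff →L[ℝ] TorusL2 × TorusL2 × TorusL2 :=
  (torusOp (c := fun k => ((k : ℝ) ^ 2)⁻¹) Real.continuous_sin sin_coeff_bound).prod
    ((torusOp (c := fun k => (k : ℝ)⁻¹) Real.continuous_cos cos_coeff_bound).prod
      (torusOp (c := fun _ => -1) Real.continuous_sin neg_sin_coeff_bound))

lemma hasDerivAt_sin_mul (k : ℕ) (x : ℝ) :
    HasDerivAt (fun x => Real.sin (k * x)) (k * Real.cos (k * x)) x := by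
  simpa [mul_comm] using ((hasDerivAt_id x).const_mul (k : ℝ)).sin

lemma hasDerivAt_cos_mul (k : ℕ) (x : ℝ) :
    HasDerivAt (fun x => Real.cos (k * x)) (-(k * Real.sin (k * x))) x := by
  simpa [mul_comm] using ((hasDerivAt_id x).const_mul (k : ℝ)).cos

lemma hasDerivAt_sin_coeff (k : ℕ) (x : ℝ) :
    HasDerivAt (fun x => ((k : ℝ) ^ 2)⁻¹ * Real.sin (k * x)) ((k : ℝ)⁻¹ * Real.cos (k * x)) x := by
  have e : (k : ℝ)⁻¹ * Real.cos (k * x) = ((k : ℝ) ^ 2)⁻¹ * (k * Real.cos (k * x)) := by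
    rcases Nat.eq_zero_or_pos k with rfl | hk
    · simp
    · field_simp
  rw [e]
  exact (hasDerivAt_sin_mul k x).const_mul ((k : ℝ) ^ 2)⁻¹

lemma hasDerivAt_cos_coeff (k : ℕ) (x : ℝ) :
    HasDerivAt (fun x => (k : ℝ)⁻¹ * Real.cos (k * x)) (-1 * Real.sin (k * x)) x := by
  have e : -1 * Real.sin (k * x) = (k : ℝ)⁻¹ * -(k * Real.sin (k * x)) := by
    rcases Nat.eq_zero_or_pos k with rfl | hk
    · simp
    · field_simp
  rw [e]
  exact (hasDerivAt_cos_mul k x).const_mul (k : ℝ)⁻¹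

lemma sin_nat_mul_two_pi (k : ℕ) : Real.sin (k * (2 * Real.pi)) = 0 := by
  have := Real.sin_nat_mul_pi (k * 2)
  rwa [Nat.cast_mul, Nat.cast_ofNat, mul_assoc] at this

lemma cos_nat_mul_two_pi (k : ℕ) : Real.cos (k * (2 * Real.pi)) = 1 := Real.cos_nat_mul_two_pi k

lemma torusTriple_mem (x : Coeff) : torusTriple x ∈ H2Torus := by
  constructor
  · refine HasWeakDerivTorus.of_basis (fun k => ?_) x
    refine HasWeakDerivTorus.congr ?_ (torusOp_basis_ae _ _ k) (torusOp_basis_ae _ _ k)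
    refine HasWeakDerivTorus.of_hasDerivAt (hasDerivAt_sin_coeff k)
      (continuous_torusMode _ Real.continuous_cos k) ?_
    simp only [torusMode, sin_nat_mul_two_pi, mul_zero, Real.sin_zero]
  · refine HasWeakDerivTorus.of_basis (fun k => ?_) x
    refine HasWeakDerivTorus.congr ?_ (torusOp_basis_ae _ _ k) (torusOp_basis_ae _ _ k)
    refine HasWeakDerivTorus.of_hasDerivAt (hasDerivAt_cos_coeff k)
      (continuous_torusMode _ Real.continuous_sin k) ?_
    simp only [torusMode, cos_nat_mul_two_pi, mul_zero, Real.cos_zero]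

/-- The sine series as an element of `H²(𝕋)`. -/
def torusMap : Coeff →L[ℝ] H2Torus := torusTriple.codRestrict H2Torus torusTriple_mem

lemma Coeff.hasSum_eval (θ : ℝ) (x : Coeff) :
    HasSum (fun k => x k * (((k : ℝ) ^ 2)⁻¹ * Real.sin (k * θ))) (Coeff.eval θ x) := by
  have h := Coeff.hasSum_lift (hv := Coeff.abs_sin_div_sq_le θ) x
  have e : ∀ k : ℕ, x k * (((k : ℝ) ^ 2)⁻¹ * Real.sin (k * θ))
      = x k • (Real.sin (k * θ) / (k : ℝ) ^ 2) := fun k => by rw [smul_eq_mul, div_eq_inv_mul]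
  simp only [e]
  exact h

lemma torusMap_fn_ae (x : Coeff) :
    H2Torus.fn (torusMap x) =ᵐ[torusMeasure] fun θ => Coeff.eval θ x :=
  Coeff.lift_ae_eq (f := torusMode (fun k => ((k : ℝ) ^ 2)⁻¹) Real.sin)
    (fun _ => MemLp.coeFn_toLp _) x fun θ => Coeff.hasSum_eval θ x

end DeltaWave

end

/-! ### Assembly of the components of a wave from its profile. -/

open MeasureTheory Set Filter Topology
open scoped ContDiff

noncomputable section

namespace DeltaWave

set_option maxSynthPendingDepth 3

open IsProfile

/-- The function `p (k |y|)`. -/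
def evenPart (p : ℝ → ℝ) (k : ℕ) (y : ℝ) : ℝ := p (k * |y|)

/-- The function `sign y * q (k |y|)`. -/
def oddPart (q : ℝ → ℝ) (k : ℕ) (y : ℝ) : ℝ := Real.sign y * q (k * |y|)

/-- The mode `k = 0` does not decay in `y`, so its coefficient has to annihilate it: this is the
condition `c 0 * t 0 = 0`, met by the sine itself or, for cosines, by the convention that zero has
inverse zero. -/
lemma isModeFamily_of_bound {σ C : ℝ} (hσ : 0 < σ) (hC : 0 ≤ C) {c : ℕ → ℝ} {t : ℝ → ℝ}
    {b : ℕ → ℝ → ℝ} (ht : Continuous t) (hb : ∀ k, Measurable (b k))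
    (h0 : c 0 * t 0 = 0) (hct : ∀ k x, |c k * t (k * x)| ≤ 1)
    (hbd : ∀ k, 1 ≤ k → ∀ y, |b k y| ≤ C * Real.exp (-σ * |y|)) : IsModeFamily σ C c t b where
  pos := hσ
  nonneg := hC
  cont := ht
  meas := hb
  bound k x y := by
    rcases Nat.eq_zero_or_pos k with rfl | hk
    · rw [Nat.cast_zero, zero_mul, h0, zero_mul, abs_zero]
      positivity
    · rw [abs_mul]
      calc _ ≤ 1 * (C * Real.exp (-σ * |y|)) := by
            gcongr
            · exact hct k x
            · exact hbd k hk y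
        _ = _ := one_mul _

lemma inv_mul_self_le_one (k : ℕ) : (k : ℝ)⁻¹ * k ≤ 1 := by
  rcases Nat.eq_zero_or_pos k with rfl | hk
  · simp
  · rw [inv_mul_cancel₀ (by positivity)]

namespace IsProfile

variable {σ C : ℝ} {p q : ℝ → ℝ}

lemma measurable_evenPart (h : IsProfile σ C p q) (k : ℕ) : Measurable (evenPart p k) := by
  have := h.continuous
  unfold evenPart; fun_prop

lemma measurable_oddPart (h : IsProfile σ C p q) (k : ℕ) : Measurable (oddPart q k) := by
  have := h.cont.measurable
  have := measurable_realSign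
  unfold oddPart; fun_prop

lemma bound_evenPart (h : IsProfile σ C p q) (k : ℕ) (hk : 1 ≤ k) (y : ℝ) :
    |evenPart p k y| ≤ C * Real.exp (-σ * |y|) := scaled_bound h.pos h.nonneg h.bound hk y

lemma bound_oddPart (h : IsProfile σ C p q) (k : ℕ) (hk : 1 ≤ k) (y : ℝ) :
    |oddPart q k y| ≤ C * Real.exp (-σ * |y|) := by
  rw [oddPart, abs_mul]
  exact (mul_le_of_le_one_left (abs_nonneg _) (abs_realSign_le_one y)).trans
    (scaled_bound h.pos h.nonneg h.bound_deriv hk y)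

lemma family (h : IsProfile σ C p q) :
    IsModeFamily σ C (fun k => ((k : ℝ) ^ 2)⁻¹) Real.sin (evenPart p) :=
  isModeFamily_of_bound h.pos h.nonneg Real.continuous_sin h.measurable_evenPart (by simp)
    sin_coeff_bound h.bound_evenPart

lemma family_dx (h : IsProfile σ C p q) :
    IsModeFamily σ C (fun k => (k : ℝ)⁻¹) Real.cos (evenPart p) :=
  isModeFamily_of_bound h.pos h.nonneg Real.continuous_cos h.measurable_evenPart (by simp)
    cos_coeff_bound h.bound_evenPart

lemma family_dxx (h : IsProfile σ C p q) :
    IsModeFamily σ C (fun _ => -1) Real.sin (evenPart p) :=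
  isModeFamily_of_bound h.pos h.nonneg Real.continuous_sin h.measurable_evenPart (by simp)
    neg_sin_coeff_bound h.bound_evenPart

lemma family_dy (h : IsProfile σ C p q) :
    IsModeFamily σ C (fun k => (k : ℝ)⁻¹) Real.sin (oddPart q) :=
  isModeFamily_of_bound h.pos h.nonneg Real.continuous_sin h.measurable_oddPart (by simp)
    (fun k x => abs_mul_le_one_of (by positivity) (Nat.cast_inv_le_one k) (Real.abs_sin_le_one _))
    h.bound_oddPart

/-- The factor `k⁻¹ * k` is `1` for `k ≥ 1` and `0` for `k = 0`; it discards the frequency zero,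
where the cosine does not vanish. -/
lemma family_dxy (h : IsProfile σ C p q) :
    IsModeFamily σ C (fun k => (k : ℝ)⁻¹ * k) Real.cos (oddPart q) :=
  isModeFamily_of_bound h.pos h.nonneg Real.continuous_cos h.measurable_oddPart (by simp)
    (fun k x => abs_mul_le_one_of (by positivity) (inv_mul_self_le_one k) (Real.abs_cos_le_one _))
    h.bound_oddPart

lemma hasWeakDerivOn_evenPart (h : IsProfile σ C p q) (k : ℕ) :
    HasWeakDerivOn univ (evenPart p k) fun y => k * oddPart q k y := by
  have hc : Continuous (evenPart p k) := by
    have := h.continuous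
    unfold evenPart; fun_prop
  refine hasWeakDerivOn_of_hasDerivAt hc (fun y hy => ?_) ?_
  · have habs : HasDerivAt (fun y : ℝ => (k : ℝ) * |y|) (k * Real.sign y) y := by
      rcases lt_or_gt_of_ne hy with hlt | hgt
      · rw [Real.sign_of_neg hlt]; exact (hasDerivAt_abs_neg hlt).const_mul _
      · rw [Real.sign_of_pos hgt]; exact (hasDerivAt_abs_pos hgt).const_mul _
    have := (h.hasDerivAt (k * |y|)).comp y habs
    have e : (k : ℝ) * oddPart q k y = q (k * |y|) * (k * Real.sign y) := by
      rw [oddPart]; ring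
    rw [e]; exact this
  · have h1 : LocallyIntegrable (Real.sign) := by
      refine (locallyIntegrable_const (1 : ℝ)).mono measurable_realSign.aestronglyMeasurable
        (.of_forall fun y => ?_)
      rw [norm_one]; exact abs_realSign_le_one y
    have h2 : Continuous fun y : ℝ => (k : ℝ) * q (k * |y|) := by
      have := h.cont
      fun_prop
    have h3 := (h1.locallyIntegrableOn univ).continuousOn_mul h2.continuousOn
      isOpen_univ.isLocallyClosed
    rw [locallyIntegrableOn_univ] at h3
    refine h3.congr (.of_forall fun y => ?_)
    simp only [oddPart]; ring

/-- All components of the wave. -/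
def ambient (h : IsProfile σ C p q) :
    Coeff →L[ℝ] StripL2 × StripL2 × StripL2 × StripL2 × StripL2 × H2Torus :=
  h.family.op.prod (h.family_dx.op.prod (h.family_dxx.op.prod (h.family_dy.op.prod
    (h.family_dxy.op.prod (p 0 • torusMap)))))

lemma summable_waveFn (h : IsProfile σ C p q) (x : Coeff) (θ y : ℝ) (k : ℕ) :
    ‖x k * ((((k : ℝ) ^ 2)⁻¹ * Real.sin (k * θ)) * evenPart p k y)‖ ≤ |x k| * C := by
  rw [norm_mul, Real.norm_eq_abs]
  gcongr
  rw [Real.norm_eq_abs]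
  refine (h.family.bound k θ y).trans (mul_le_of_le_one_right h.nonneg ?_)
  rw [Real.exp_le_one_iff]
  nlinarith [h.pos, abs_nonneg y]

end IsProfile

/-- The pointwise values of the wave. -/
def waveFn (p : ℝ → ℝ) (x : Coeff) (θ y : ℝ) : ℝ :=
  ∑' k : ℕ, x k * ((((k : ℝ) ^ 2)⁻¹ * Real.sin (k * θ)) * evenPart p k y)

namespace IsProfile

variable {σ C : ℝ} {p q : ℝ → ℝ}

lemma hasSum_waveFn (h : IsProfile σ C p q) (x : Coeff) (θ y : ℝ) :
    HasSum (fun k : ℕ => x k * ((((k : ℝ) ^ 2)⁻¹ * Real.sin (k * θ)) * evenPart p k y))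
      (waveFn p x θ y) :=
  (Summable.of_norm_bounded (x.summable_abs.mul_right C) (h.summable_waveFn x θ y)).hasSum

lemma isContRep (h : IsProfile σ C p q) (x : Coeff) :
    IsContRep (h.family.op x) (waveFn p x) where
  cont := by
    refine continuous_tsum (fun k => ?_) (x.summable_abs.mul_right C)
      (fun k z => h.summable_waveFn x z.1 z.2 k)
    have := h.continuous
    unfold evenPart; fun_prop
  periodic θ y := by
    unfold waveFn
    congr 1 with k
    have := Real.sin_add_nat_mul_two_pi (k * θ) k
    rw [← mul_add] at this
    rw [this]
  ae_eq := Coeff.lift_ae_eq (f := modeFn (fun k => ((k : ℝ) ^ 2)⁻¹) Real.sin (evenPart p))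
    (fun _ => MemLp.coeFn_toLp _) x fun z => h.hasSum_waveFn x z.1 z.2

lemma waveFn_zero (h : IsProfile σ C p q) (x : Coeff) (θ : ℝ) :
    waveFn p x θ 0 = p 0 * Coeff.eval θ x := by
  refine (h.hasSum_waveFn x θ 0).unique ?_
  have e : ∀ k : ℕ, x k * ((((k : ℝ) ^ 2)⁻¹ * Real.sin (k * θ)) * evenPart p k 0)
      = p 0 * (x k * (((k : ℝ) ^ 2)⁻¹ * Real.sin (k * θ))) := fun k => by
    rw [evenPart, abs_zero, mul_zero]; ring
  simp only [e]
  exact (Coeff.hasSum_eval θ x).mul_left (p 0)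

lemma isH1H1 (h : IsProfile σ C p q) (x : Coeff) :
    IsH1H1 (h.family.op x) (h.family_dx.op x) (h.family_dy.op x) (h.family_dxy.op x) where
  dx := by
    refine HasWeakDerivStrip.of_basis (fun k => ?_) x
    refine HasWeakDerivStrip.congr ?_ (h.family.op_basis_ae k) (h.family_dx.op_basis_ae k)
    exact hasWeakDx_mul (hasDerivAt_sin_coeff k) (by fun_prop)
      (by simp only [sin_nat_mul_two_pi, mul_zero, Real.sin_zero])
      (h.family.memLp k) (h.family_dx.memLp k)
  dy := by
    refine HasWeakDerivStrip.of_basis (fun k => ?_) x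
    refine HasWeakDerivStrip.congr ?_ (h.family.op_basis_ae k) (h.family_dy.op_basis_ae k)
    have e : modeFn (fun k => (k : ℝ)⁻¹) Real.sin (oddPart q) k
        = fun z => (((k : ℝ) ^ 2)⁻¹ * Real.sin (k * z.1)) * (k * oddPart q k z.2) := by
      funext z
      rcases Nat.eq_zero_or_pos k with rfl | hk
      · simp [modeFn]
      · simp only [modeFn]; field_simp
    rw [e]
    exact hasWeakDy_mul (a := fun x => ((k : ℝ) ^ 2)⁻¹ * Real.sin (k * x))
      (h.hasWeakDerivOn_evenPart k) (h.family.memLp k) (e ▸ h.family_dy.memLp k)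
  dxy := by
    refine HasWeakDerivStrip.of_basis (fun k => ?_) x
    refine HasWeakDerivStrip.congr ?_ (h.family_dx.op_basis_ae k) (h.family_dxy.op_basis_ae k)
    have e : modeFn (fun k => (k : ℝ)⁻¹ * k) Real.cos (oddPart q) k
        = fun z => ((k : ℝ)⁻¹ * Real.cos (k * z.1)) * (k * oddPart q k z.2) := by
      funext z
      simp only [modeFn]; ring
    rw [e]
    exact hasWeakDy_mul (a := fun x => (k : ℝ)⁻¹ * Real.cos (k * x))
      (h.hasWeakDerivOn_evenPart k) (h.family_dx.memLp k) (e ▸ h.family_dxy.memLp k)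

lemma hasWeakDxx (h : IsProfile σ C p q) (x : Coeff) :
    HasWeakDx (h.family_dx.op x) (h.family_dxx.op x) := by
  refine HasWeakDerivStrip.of_basis (fun k => ?_) x
  refine HasWeakDerivStrip.congr ?_ (h.family_dx.op_basis_ae k) (h.family_dxx.op_basis_ae k)
  exact hasWeakDx_mul (hasDerivAt_cos_coeff k) (by fun_prop)
    (by simp only [cos_nat_mul_two_pi, mul_zero, Real.cos_zero])
    (h.family_dx.memLp k) (h.family_dxx.memLp k)

lemma ambient_mem (h : IsProfile σ C p q) (x : Coeff) : h.ambient x ∈ WaveSpace := by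
  refine ⟨h.isH1H1 x, h.hasWeakDxx x, waveFn p x, h.isContRep x, ?_⟩
  have e : H2Torus.fn (p 0 • torusMap x) = p 0 • H2Torus.fn (torusMap x) := rfl
  change H2Torus.fn (p 0 • torusMap x) =ᵐ[torusMeasure] _
  rw [e]
  filter_upwards [Lp.coeFn_smul (p 0) (H2Torus.fn (torusMap x)), torusMap_fn_ae x] with θ h1 h2
  rw [h1, Pi.smul_apply, h2, h.waveFn_zero, smul_eq_mul]

/-- The wave with transversal profile `p` and given coefficients. -/
def wave (h : IsProfile σ C p q) : Coeff →L[ℝ] WaveSpace :=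
  h.ambient.codRestrict WaveSpace h.ambient_mem

/-- The bound is linear in the profile constant `C`. A Taylor remainder of profiles with a
quadratically small constant thus becomes a quadratic remainder in operator norm. -/
lemma norm_wave_le (h : IsProfile σ C p q) :
    ‖h.wave‖ ≤ C * (domNorm σ h.pos + ‖torusMap‖) := by
  have hd : 0 ≤ domNorm σ h.pos := norm_nonneg _
  have ht : 0 ≤ ‖torusMap‖ := norm_nonneg _
  have hC := h.nonneg
  refine ContinuousLinearMap.opNorm_le_bound _ (by positivity) fun x => ?_
  have hop : ∀ {c t b} (hf : IsModeFamily σ C c t b),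
      ‖hf.op x‖ ≤ C * (domNorm σ h.pos + ‖torusMap‖) * ‖x‖ := fun hf => by
    refine (hf.op.le_of_opNorm_le hf.norm_op_le x).trans ?_
    gcongr
    exact le_add_of_nonneg_right ht
  have h0 : |p 0| ≤ C := by simpa using h.bound 0 le_rfl
  change ‖h.ambient x‖ ≤ _
  refine norm_prod_le_iff.mpr ⟨hop h.family, norm_prod_le_iff.mpr ⟨hop h.family_dx,
    norm_prod_le_iff.mpr ⟨hop h.family_dxx, norm_prod_le_iff.mpr ⟨hop h.family_dy,
    norm_prod_le_iff.mpr ⟨hop h.family_dxy, ?_⟩⟩⟩⟩⟩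
  change ‖p 0 • torusMap x‖ ≤ _
  rw [norm_smul, Real.norm_eq_abs]
  calc |p 0| * ‖torusMap x‖ ≤ C * (‖torusMap‖ * ‖x‖) := by
        gcongr
        exact torusMap.le_opNorm x
    _ ≤ C * (domNorm σ h.pos + ‖torusMap‖) * ‖x‖ := by
        rw [mul_assoc]
        gcongr
        exact le_add_of_nonneg_left hd

end IsProfile

lemma IsModeFamily.op_sub {σ C σ₁ C₁ σ₂ C₂ σ₃ C₃ a : ℝ} {c : ℕ → ℝ} {t : ℝ → ℝ}
    {b b₁ b₂ b₃ : ℕ → ℝ → ℝ} (h : IsModeFamily σ C c t b) (h₁ : IsModeFamily σ₁ C₁ c t b₁)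
    (h₂ : IsModeFamily σ₂ C₂ c t b₂) (h₃ : IsModeFamily σ₃ C₃ c t b₃)
    (hb : ∀ k y, b k y = b₁ k y - b₂ k y - a * b₃ k y) (x : Coeff) :
    h.op x = h₁.op x - h₂.op x - a • h₃.op x := by
  have : h.op = h₁.op - h₂.op - a • h₃.op := Coeff.clm_ext fun k => by
    change h.op (Coeff.basis k) = h₁.op (Coeff.basis k) - h₂.op (Coeff.basis k)
      - a • h₃.op (Coeff.basis k)
    simp only [op_basis]
    rw [← MemLp.toLp_const_smul, ← MemLp.toLp_sub, ← MemLp.toLp_sub]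
    refine (MemLp.toLp_eq_toLp_iff _ _).mpr (.of_forall fun z => ?_)
    simp only [modeFn, hb, Pi.sub_apply, Pi.smul_apply, smul_eq_mul]
    ring
  rw [this]; rfl

/-- Every component is linear in the profile and its derivative. The combination is the one
occurring in a first order Taylor expansion, and the constants attached to the four profiles are
unrelated. -/
lemma IsProfile.wave_sub {σ C σ₁ C₁ σ₂ C₂ σ₃ C₃ a : ℝ} {p q p₁ q₁ p₂ q₂ p₃ q₃ : ℝ → ℝ}
    (h : IsProfile σ C p q) (h₁ : IsProfile σ₁ C₁ p₁ q₁) (h₂ : IsProfile σ₂ C₂ p₂ q₂)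
    (h₃ : IsProfile σ₃ C₃ p₃ q₃) (hp : ∀ r, p r = p₁ r - p₂ r - a * p₃ r)
    (hq : ∀ r, q r = q₁ r - q₂ r - a * q₃ r) :
    h₁.wave - h₂.wave - a • h₃.wave = h.wave := by
  have he : ∀ k y, evenPart p k y = evenPart p₁ k y - evenPart p₂ k y - a * evenPart p₃ k y :=
    fun k y => hp _
  have ho : ∀ k y, oddPart q k y = oddPart q₁ k y - oddPart q₂ k y - a * oddPart q₃ k y :=
    fun k y => by simp only [oddPart, hq]; ring
  refine ContinuousLinearMap.ext fun x => Subtype.ext ?_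
  change h₁.ambient x - h₂.ambient x - a • h₃.ambient x = h.ambient x
  refine Prod.ext (h.family.op_sub h₁.family h₂.family h₃.family he x).symm
    (Prod.ext (h.family_dx.op_sub h₁.family_dx h₂.family_dx h₃.family_dx he x).symm
    (Prod.ext (h.family_dxx.op_sub h₁.family_dxx h₂.family_dxx h₃.family_dxx he x).symm
    (Prod.ext (h.family_dy.op_sub h₁.family_dy h₂.family_dy h₃.family_dy ho x).symm
    (Prod.ext (h.family_dxy.op_sub h₁.family_dxy h₂.family_dxy h₃.family_dxy ho x).symm ?_))))
  change p₁ 0 • torusMap x - p₂ 0 • torusMap x - a • p₃ 0 • torusMap x = p 0 • torusMap x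
  rw [hp, sub_smul, sub_smul, mul_smul]

end DeltaWave

end

open MeasureTheory Set Filter Topology
open scoped ContDiff

noncomputable section

namespace DeltaWave

set_option maxSynthPendingDepth 3

/-! ## Smooth dependence of exponential profiles on the decay rate -/

/-- The `j`-th derivative of `e^{-s r}` with respect to `s`. -/
def powExp (j : ℕ) (s r : ℝ) : ℝ := (-r) ^ j * Real.exp (-(s * r))

/-- The derivative of `powExp j s r` with respect to `r`. -/
def powExpDeriv (j : ℕ) (s r : ℝ) : ℝ := -(j * powExp (j - 1) s r) - s * powExp j s r

lemma hasDerivAt_powExp (j : ℕ) (s r : ℝ) : HasDerivAt (powExp j s) (powExpDeriv j s r) r := by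
  have h1 : HasDerivAt (fun r : ℝ => (-r) ^ j) (j * (-r) ^ (j - 1) * (-1)) r :=
    (hasDerivAt_neg r).pow j
  have h2 : HasDerivAt (fun r : ℝ => Real.exp (-(s * r))) (Real.exp (-(s * r)) * (-(s * 1))) r :=
    (((hasDerivAt_id r).const_mul s).neg).exp
  have e : powExpDeriv j s r = j * (-r) ^ (j - 1) * (-1) * Real.exp (-(s * r))
      + (-r) ^ j * (Real.exp (-(s * r)) * (-(s * 1))) := by
    simp only [powExpDeriv, powExp]; ring
  rw [e]
  exact h1.mul h2

lemma continuous_powExp (j : ℕ) (s : ℝ) : Continuous (powExp j s) := by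
  unfold powExp; fun_prop

lemma continuous_powExpDeriv (j : ℕ) (s : ℝ) : Continuous (powExpDeriv j s) := by
  have h1 := continuous_powExp j s
  have h2 := continuous_powExp (j - 1) s
  unfold powExpDeriv; fun_prop

/-- An upper bound of `r ^ j * e^{-a r}`. -/
def powBound (j : ℕ) (a : ℝ) : ℝ := j.factorial / a ^ j

lemma powBound_nonneg (j : ℕ) {a : ℝ} (ha : 0 < a) : 0 ≤ powBound j a := by
  unfold powBound; positivity

lemma pow_mul_exp_le (j : ℕ) {a r : ℝ} (ha : 0 < a) (hr : 0 ≤ r) :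
    r ^ j * Real.exp (-(a * r)) ≤ powBound j a := by
  have h := Real.pow_div_factorial_le_exp (a * r) (by positivity) j
  rw [Real.exp_neg, powBound, ← div_eq_mul_inv, div_le_div_iff₀ (Real.exp_pos _) (by positivity)]
  rw [div_le_iff₀ (by positivity), mul_pow] at h
  linarith

lemma pow_mul_exp_le_mul_exp (j : ℕ) {a b c r : ℝ} (ha : 0 < a) (hr : 0 ≤ r) (habc : a + b ≤ c) :
    r ^ j * Real.exp (-(c * r)) ≤ powBound j a * Real.exp (-b * r) := by
  have h : Real.exp (-(c * r)) ≤ Real.exp (-(a * r)) * Real.exp (-b * r) := by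
    rw [← Real.exp_add, Real.exp_le_exp]
    nlinarith
  calc r ^ j * Real.exp (-(c * r)) ≤ r ^ j * (Real.exp (-(a * r)) * Real.exp (-b * r)) := by gcongr
    _ = (r ^ j * Real.exp (-(a * r))) * Real.exp (-b * r) := by ring
    _ ≤ _ := by
      gcongr
      exact pow_mul_exp_le j ha hr

lemma abs_powExp (j : ℕ) (s : ℝ) {r : ℝ} (hr : 0 ≤ r) :
    |powExp j s r| = r ^ j * Real.exp (-(s * r)) := by
  rw [powExp, abs_mul, abs_pow, abs_neg, abs_of_nonneg hr, abs_of_pos (Real.exp_pos _)]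

lemma abs_powExp_le (j : ℕ) {s r : ℝ} (hs : 0 < s) (hr : 0 ≤ r) :
    |powExp j s r| ≤ powBound j (s / 4) * Real.exp (-(s / 2) * r) := by
  rw [abs_powExp j s hr]
  exact pow_mul_exp_le_mul_exp j (by linarith) hr (by linarith)

lemma isProfile_powExp (j : ℕ) {s : ℝ} (hs : 0 < s) :
    IsProfile (s / 2) (powBound j (s / 4) + (j * powBound (j - 1) (s / 4) + s * powBound j (s / 4)))
      (powExp j s) (powExpDeriv j s) where
  pos := by linarith
  hasDerivAt := hasDerivAt_powExp j s
  cont := continuous_powExpDeriv j s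
  bound r hr := by
    refine (abs_powExp_le j hs hr).trans ?_
    have h1 := powBound_nonneg j (show 0 < s / 4 by linarith)
    have h2 := powBound_nonneg (j - 1) (show 0 < s / 4 by linarith)
    gcongr
    exact le_add_of_nonneg_right (by positivity)
  bound_deriv r hr := by
    have h1 := powBound_nonneg j (show 0 < s / 4 by linarith)
    have e1 := abs_powExp_le j hs hr
    have e2 := abs_powExp_le (j - 1) hs hr
    calc |powExpDeriv j s r| ≤ |(j : ℝ) * powExp (j - 1) s r| + |s * powExp j s r| := by
          rw [powExpDeriv]
          refine (abs_sub _ _).trans ?_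
          rw [abs_neg]
      _ = j * |powExp (j - 1) s r| + s * |powExp j s r| := by
          rw [abs_mul, abs_mul, Nat.abs_cast, abs_of_pos hs]
      _ ≤ j * (powBound (j - 1) (s / 4) * Real.exp (-(s / 2) * r))
          + s * (powBound j (s / 4) * Real.exp (-(s / 2) * r)) := by gcongr
      _ = (j * powBound (j - 1) (s / 4) + s * powBound j (s / 4)) * Real.exp (-(s / 2) * r) := by
          ring
      _ ≤ _ := mul_le_mul_of_nonneg_right (le_add_of_nonneg_left h1) (Real.exp_pos _).le

lemma abs_exp_sub_one_sub_le (x : ℝ) : |Real.exp x - 1 - x| ≤ x ^ 2 * Real.exp |x| := by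
  have h := Complex.norm_exp_sub_sum_le_norm_mul_exp (x : ℂ) 2
  rw [Complex.norm_real, Real.norm_eq_abs, sq_abs] at h
  have e : Complex.exp x - ∑ m ∈ Finset.range 2, (x : ℂ) ^ m / m.factorial
      = ((Real.exp x - 1 - x : ℝ) : ℂ) := by
    simp [Finset.sum_range_succ, Complex.ofReal_exp]
    ring
  rwa [e, Complex.norm_real, Real.norm_eq_abs] at h

/-- The second order Taylor remainder of `powExp j` in the decay rate. -/
def powExpRem (j : ℕ) (t s r : ℝ) : ℝ := powExp j t r - powExp j s r - (t - s) * powExp (j + 1) s r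

/-- With `h = (t - s) r` the remainder is `powExp j s r` times `e^{-h} - 1 + h`, bounded by `h²
e^{sr/4}`. Of the decay rate `s`, one quarter pays for this growth, one quarter for the power
`r^{j+2}`, and one half is kept. -/
lemma abs_powExpRem_le (j : ℕ) {t s r : ℝ} (hs : 0 < s) (ht : |t - s| ≤ s / 4) (hr : 0 ≤ r) :
    |powExpRem j t s r|
      ≤ (t - s) ^ 2 * (powBound (j + 2) (s / 4) * Real.exp (-(s / 2) * r)) := by
  have e : powExpRem j t s r
      = powExp j s r * (Real.exp (-((t - s) * r)) - 1 - (-((t - s) * r))) := by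
    have : Real.exp (-(t * r)) = Real.exp (-(s * r)) * Real.exp (-((t - s) * r)) := by
      rw [← Real.exp_add]; ring_nf
    simp only [powExpRem, powExp, this]; ring
  have habs : |-((t - s) * r)| ≤ s / 4 * r := by
    rw [abs_neg, abs_mul, abs_of_nonneg hr]; gcongr
  rw [e, abs_mul, abs_powExp j s hr]
  calc r ^ j * Real.exp (-(s * r)) * |Real.exp (-((t - s) * r)) - 1 - (-((t - s) * r))|
      ≤ r ^ j * Real.exp (-(s * r)) * ((-((t - s) * r)) ^ 2 * Real.exp (s / 4 * r)) := by
        gcongr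
        refine (abs_exp_sub_one_sub_le _).trans ?_
        gcongr
    _ = (t - s) ^ 2 * (r ^ (j + 2) * Real.exp (-(3 * s / 4 * r))) := by
        have : Real.exp (-(3 * s / 4 * r)) = Real.exp (-(s * r)) * Real.exp (s / 4 * r) := by
          rw [← Real.exp_add]; ring_nf
        rw [this]; ring
    _ ≤ _ := by
        have := pow_mul_exp_le_mul_exp (a := s / 4) (b := s / 2) (c := 3 * s / 4) (j + 2)
          (by linarith) hr (by linarith)
        exact mul_le_mul_of_nonneg_left this (sq_nonneg _)

/-- The `r`-derivative of the remainder is again made of remainders, except for a term in `(t - s)²`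
that arises because the coefficient `s` in `powExpDeriv` varies too. For `j = 0` the truncated index
`j - 1` is harmless, its coefficient being zero. -/
lemma powExpDeriv_rem (j : ℕ) (t s r : ℝ) :
    powExpDeriv j t r - powExpDeriv j s r - (t - s) * powExpDeriv (j + 1) s r
      = -(j * powExpRem (j - 1) t s r) - t * powExpRem j t s r
        - (t - s) ^ 2 * powExp (j + 1) s r := by
  rcases j with _ | j
  · simp only [powExpDeriv, powExpRem, Nat.cast_zero, Nat.add_sub_cancel, Nat.cast_add,
      Nat.cast_one]
    ring
  · simp only [powExpDeriv, powExpRem, Nat.add_sub_cancel, Nat.cast_add, Nat.cast_one]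
    ring

/-- A constant for the remainder estimates. -/
def remConst (j : ℕ) (s : ℝ) : ℝ :=
  powBound (j + 2) (s / 4) + (j * powBound (j - 1 + 2) (s / 4)
    + 2 * s * powBound (j + 2) (s / 4) + powBound (j + 1) (s / 4))

lemma isProfile_rem (j : ℕ) {t s : ℝ} (hs : 0 < s) (ht : |t - s| ≤ s / 4) :
    IsProfile (s / 2) ((t - s) ^ 2 * remConst j s) (powExpRem j t s) (fun r =>
      powExpDeriv j t r - powExpDeriv j s r - (t - s) * powExpDeriv (j + 1) s r) where
  pos := by linarith
  hasDerivAt r := ((hasDerivAt_powExp j t r).sub (hasDerivAt_powExp j s r)).sub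
    ((hasDerivAt_powExp (j + 1) s r).const_mul (t - s))
  cont := ((continuous_powExpDeriv j t).sub (continuous_powExpDeriv j s)).sub
    (continuous_const.mul (continuous_powExpDeriv (j + 1) s))
  bound r hr := by
    refine (abs_powExpRem_le j hs ht hr).trans ?_
    have h1 := powBound_nonneg (j + 2) (show 0 < s / 4 by linarith)
    have h2 := powBound_nonneg (j - 1 + 2) (show 0 < s / 4 by linarith)
    have h3 := powBound_nonneg (j + 1) (show 0 < s / 4 by linarith)
    rw [← mul_assoc]
    gcongr
    exact le_add_of_nonneg_right (by positivity)
  bound_deriv r hr := by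
    have h1 := powBound_nonneg (j + 2) (show 0 < s / 4 by linarith)
    have e1 := abs_powExpRem_le j hs ht hr
    have e2 := abs_powExpRem_le (j - 1) hs ht hr
    have e3 := abs_powExp_le (j + 1) hs hr
    have ht' : |t| ≤ 2 * s := by
      have := abs_le.mp ht
      exact abs_le.mpr ⟨by linarith, by linarith⟩
    rw [powExpDeriv_rem]
    set E := Real.exp (-(s / 2) * r)
    calc _ ≤ |(j : ℝ) * powExpRem (j - 1) t s r| + |t * powExpRem j t s r|
          + |(t - s) ^ 2 * powExp (j + 1) s r| := by
          refine (abs_sub _ _).trans ?_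
          gcongr
          refine (abs_sub _ _).trans ?_
          rw [abs_neg]
      _ = j * |powExpRem (j - 1) t s r| + |t| * |powExpRem j t s r|
          + (t - s) ^ 2 * |powExp (j + 1) s r| := by
          rw [abs_mul, abs_mul, abs_mul, Nat.abs_cast, abs_of_nonneg (sq_nonneg (t - s))]
      _ ≤ j * ((t - s) ^ 2 * (powBound (j - 1 + 2) (s / 4) * E))
          + 2 * s * ((t - s) ^ 2 * (powBound (j + 2) (s / 4) * E))
          + (t - s) ^ 2 * (powBound (j + 1) (s / 4) * E) := by gcongr
      _ = (t - s) ^ 2 * (j * powBound (j - 1 + 2) (s / 4) + 2 * s * powBound (j + 2) (s / 4)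
          + powBound (j + 1) (s / 4)) * E := by ring
      _ ≤ _ := by
          rw [remConst]
          exact mul_le_mul_of_nonneg_right (mul_le_mul_of_nonneg_left (le_add_of_nonneg_left h1)
            (sq_nonneg _)) (Real.exp_pos _).le

/-- The wave operator with transversal profile `powExp j s`. -/
def expWave (j : ℕ) (s : ℝ) : Coeff →L[ℝ] WaveSpace :=
  if hs : 0 < s then (isProfile_powExp j hs).wave else 0

lemma expWave_of_pos (j : ℕ) {s : ℝ} (hs : 0 < s) : expWave j s = (isProfile_powExp j hs).wave :=
  dif_pos hs

lemma norm_expWave_sub_le (j : ℕ) {t s : ℝ} (hs : 0 < s) (ht : |t - s| ≤ s / 4) :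
    ‖expWave j t - expWave j s - (t - s) • expWave (j + 1) s‖
      ≤ remConst j s * (domNorm (s / 2) (half_pos hs) + ‖torusMap‖) * ‖‖t - s‖ ^ 2‖ := by
  have ht0 : 0 < t := by linarith [(abs_le.mp ht).1]
  rw [expWave_of_pos j ht0, expWave_of_pos j hs, expWave_of_pos (j + 1) hs,
    IsProfile.wave_sub (isProfile_rem j hs ht) (isProfile_powExp j ht0) (isProfile_powExp j hs)
      (isProfile_powExp (j + 1) hs) (fun _ => rfl) (fun _ => rfl)]
  refine (isProfile_rem j hs ht).norm_wave_le.trans (le_of_eq ?_)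
  rw [Real.norm_of_nonneg (sq_nonneg _), Real.norm_eq_abs, sq_abs]; ring

/-- The Taylor remainder in operator norm is `O((t - s)²)`, hence `o(t - s)`. -/
lemma hasDerivAt_expWave (j : ℕ) {s : ℝ} (hs : 0 < s) :
    HasDerivAt (expWave j) (expWave (j + 1) s) s := by
  rw [hasDerivAt_iff_isLittleO]
  refine Asymptotics.IsBigO.trans_isLittleO (g := fun t => ‖t - s‖ ^ 2) ?_
    (Asymptotics.isLittleO_pow_sub_sub s one_lt_two)
  refine Asymptotics.IsBigO.of_bound
    (remConst j s * (domNorm (s / 2) (half_pos hs) + ‖torusMap‖)) ?_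
  filter_upwards [Metric.closedBall_mem_nhds s (show 0 < s / 4 by linarith)] with t ht
  exact norm_expWave_sub_le j hs (by simpa [Real.dist_eq] using ht)

/-- Differentiation in the rate raises `j` by one, so the family is closed under it, and the
induction on the order runs over all `j` at once. -/
lemma contDiffOn_expWave_nat (n j : ℕ) : ContDiffOn ℝ n (expWave j) (Ioi 0) := by
  induction n generalizing j with
  | zero =>
    exact contDiffOn_zero.mpr fun s hs =>
      (hasDerivAt_expWave j hs).continuousAt.continuousWithinAt
  | succ n ih =>
    rw [Nat.cast_add, Nat.cast_one, contDiffOn_succ_iff_deriv_of_isOpen isOpen_Ioi]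
    refine ⟨fun s hs => (hasDerivAt_expWave j hs).differentiableAt.differentiableWithinAt,
      by simp, (ih (j + 1)).congr fun s hs => (hasDerivAt_expWave j hs).deriv⟩

lemma contDiffOn_expWave (j : ℕ) : ContDiffOn ℝ ∞ (expWave j) (Ioi 0) :=
  contDiffOn_infty.mpr fun n => contDiffOn_expWave_nat n j

end DeltaWave

end

open MeasureTheory Set Filter Topology
open scoped ContDiff

noncomputable section

namespace DeltaWave

set_option maxSynthPendingDepth 3

/-! ## Weakly differentiable functions on half-lines -/

lemma HasWeakDerivOn.real_mul {V W e : ℝ → ℝ} (h : HasWeakDerivOn univ V W)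
    (he : ContDiff ℝ ∞ e) :
    HasWeakDerivOn univ (fun y => e y * V y) (fun y => deriv e y * V y + e y * W y) := by
  have hd : Continuous (deriv e) := he.continuous_deriv (by norm_num)
  have hl : ∀ {a u : ℝ → ℝ}, Continuous a → LocallyIntegrableOn u univ →
      LocallyIntegrableOn (fun y => a y * u y) univ := fun ha hu =>
    hu.continuousOn_mul ha.continuousOn isOpen_univ.isLocallyClosed
  refine HasWeakDerivOn.of_integral_line (hl he.continuous h.locInt)
    ((hl hd h.locInt).add (hl he.continuous h.locInt_deriv)) fun ψ hψ hc _ => ?_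
  have hdψ : Continuous (deriv ψ) := hψ.continuous_deriv (by norm_num)
  have key := h.integral_line (hψ.mul he) hc.mul_right (subset_univ _)
  have hderiv : ∀ y, deriv (fun y => ψ y * e y) y = deriv ψ y * e y + ψ y * deriv e y := fun y =>
    deriv_fun_mul (hψ.differentiable (by norm_num) y) (he.differentiable (by norm_num) y)
  have i1 := integrable_test_mul h.locInt (hdψ.mul he.continuous) hc.deriv.mul_right (subset_univ _)
  have i2 := integrable_test_mul h.locInt (hψ.continuous.mul hd) hc.mul_right (subset_univ _)
  have i3 := integrable_test_mul h.locInt_deriv (hψ.continuous.mul he.continuous) hc.mul_right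
    (subset_univ _)
  simp only [RCLike.ofReal_real_eq_id, id_eq, hderiv, Pi.mul_apply] at key i1 i2 i3 ⊢
  have e1 : ∫ y, (deriv ψ y * e y + ψ y * deriv e y) * V y
      = (∫ y, deriv ψ y * e y * V y) + ∫ y, ψ y * deriv e y * V y := by
    rw [← integral_add i1 i2]
    exact integral_congr_ae (.of_forall fun y => by ring)
  have e2 : ∫ y, ψ y * (deriv e y * V y + e y * W y)
      = (∫ y, ψ y * deriv e y * V y) + ∫ y, ψ y * e y * W y := by
    rw [← integral_add i2 i3]
    exact integral_congr_ae (.of_forall fun y => by ring)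
  have e3 : ∫ y, deriv ψ y * (e y * V y) = ∫ y, deriv ψ y * e y * V y :=
    integral_congr_ae (.of_forall fun y => by ring)
  rw [e1] at key
  rw [e2, e3]
  linarith

lemma HasWeakDerivOn.eq_primitive {G g : ℝ → ℝ} (h : HasWeakDerivOn univ G g)
    (hG : Continuous G) (y : ℝ) : G y = G 0 + ∫ t in (0 : ℝ)..y, g t := by
  have hg : LocallyIntegrable g := locallyIntegrableOn_univ.mp h.locInt_deriv
  have hcont : Continuous fun x => ∫ t in (0 : ℝ)..x, g t :=
    intervalIntegral.continuous_primitive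
      (fun a b => (hg.integrableOn_isCompact isCompact_uIcc).intervalIntegrable) 0
  have h1 := h.sub (hasWeakDerivOn_primitive_real hg)
  simp only [sub_self] at h1
  obtain ⟨C, hC⟩ := h1.ae_eq_const isOpen_univ ordConnected_univ
  have h2 : (fun y => G y - ∫ t in (0 : ℝ)..y, g t) = fun _ => C :=
    Measure.eq_of_ae_eq (hC.mono fun y hy => hy (mem_univ y)) (hG.sub hcont) continuous_const
  have h3 := congrFun h2 y
  have h4 := congrFun h2 0
  simp only [intervalIntegral.integral_same, sub_zero] at h3 h4
  linarith

/-- Integrability of `g` gives `G` a limit at infinity, and integrability of `G` forces this limit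
to be zero. -/
lemma HasWeakDerivOn.integral_Ioi {G g : ℝ → ℝ} (h : HasWeakDerivOn univ G g)
    (hG : Continuous G) (hGi : IntegrableOn G (Ioi 0)) (hg : IntegrableOn g (Ioi 0)) :
    ∫ y in Ioi 0, g y = - G 0 := by
  have h1 : Tendsto G atTop (𝓝 (G 0 + ∫ y in Ioi 0, g y)) := by
    refine (tendsto_const_nhds.add (intervalIntegral_tendsto_integral_Ioi 0 hg
      tendsto_id)).congr fun y => (h.eq_primitive hG y).symm
  have h2 := IntegrableAtFilter.eq_zero_of_tendsto ⟨_, Ioi_mem_atTop 0, hGi⟩ (fun s hs => by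
    obtain ⟨a, ha⟩ := mem_atTop_sets.mp hs
    exact top_unique ((Real.volume_Ici (a := a)).symm.le.trans (measure_mono fun y hy => ha y hy)))
    h1
  linarith

lemma HasWeakDerivOn.integral_Iic {G g : ℝ → ℝ} (h : HasWeakDerivOn univ G g)
    (hG : Continuous G) (hGi : IntegrableOn G (Iic 0)) (hg : IntegrableOn g (Iic 0)) :
    ∫ y in Iic 0, g y = G 0 := by
  have h1 : Tendsto G atBot (𝓝 (G 0 - ∫ y in Iic 0, g y)) := by
    refine (tendsto_const_nhds.sub (intervalIntegral_tendsto_integral_Iic 0 hg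
      tendsto_id)).congr fun y => ?_
    rw [h.eq_primitive hG y, intervalIntegral.integral_symm, id, sub_neg_eq_add]
  have h2 := IntegrableAtFilter.eq_zero_of_tendsto ⟨_, Iic_mem_atBot 0, hGi⟩ (fun s hs => by
    obtain ⟨a, ha⟩ := mem_atBot_sets.mp hs
    exact top_unique ((Real.volume_Iic (a := a)).symm.le.trans (measure_mono fun y hy => ha y hy)))
    h1
  linarith

/-- Integration by parts against `sign y * e^{-κ|y|}`. -/
lemma HasWeakDerivOn.integral_sign_mul_exp {V W : ℝ → ℝ} (h : HasWeakDerivOn univ V W)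
    (hV : Continuous V) {κ : ℝ}
    (iV : Integrable fun y => Real.exp (-κ * |y|) * V y)
    (iW : Integrable fun y => Real.exp (-κ * |y|) * W y) :
    ∫ y, Real.sign y * Real.exp (-κ * |y|) * W y
      = -2 * V 0 + κ * ∫ y, Real.exp (-κ * |y|) * V y := by
  have hexp : ∀ c y : ℝ, HasDerivAt (fun y => Real.exp (c * y)) (c * Real.exp (c * y)) y :=
    fun c y => by simpa [mul_comm] using ((hasDerivAt_id y).const_mul c).exp
  have hsm : ∀ c : ℝ, ContDiff ℝ ∞ fun y : ℝ => Real.exp (c * y) := fun c => by fun_prop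
  -- On each half line the kinked exponential agrees with a smooth one, `e^{-κy}` or `e^{κy}`, to
  -- which the product rule applies on all of `ℝ`. Because of the sign factor the boundary terms of
  -- the two halves add up to `-2 V(0)`.
  have hE : ∀ c : ℝ, HasWeakDerivOn univ (fun y => Real.exp (c * y) * V y)
      (fun y => c * (Real.exp (c * y) * V y) + Real.exp (c * y) * W y) := fun c => by
    have h1 := h.real_mul (hsm c)
    simp only [(hexp c _).deriv, mul_assoc] at h1
    exact h1
  have hc : ∀ c : ℝ, Continuous fun y => Real.exp (c * y) * V y := fun c => by fun_prop
  have e1 : ∀ U : ℝ → ℝ, EqOn (fun y => Real.exp (-κ * |y|) * U y)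
      (fun y => Real.exp (-κ * y) * U y) (Ioi 0) := fun U y hy => by
    simp only [abs_of_pos (mem_Ioi.mp hy)]
  have e2 : ∀ U : ℝ → ℝ, EqOn (fun y => Real.exp (-κ * |y|) * U y)
      (fun y => Real.exp (κ * y) * U y) (Iic 0) := fun U y hy => by
    simp only [abs_of_nonpos (mem_Iic.mp hy), neg_mul_neg]
  have iV1 := (integrableOn_congr_fun (e1 V) measurableSet_Ioi).mp iV.integrableOn
  have iW1 := (integrableOn_congr_fun (e1 W) measurableSet_Ioi).mp iW.integrableOn
  have iV2 := (integrableOn_congr_fun (e2 V) measurableSet_Iic).mp iV.integrableOn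
  have iW2 := (integrableOn_congr_fun (e2 W) measurableSet_Iic).mp iW.integrableOn
  have k1 := (hE (-κ)).integral_Ioi (hc _) iV1 ((iV1.const_mul _).add iW1)
  have k2 := (hE κ).integral_Iic (hc _) iV2 ((iV2.const_mul _).add iW2)
  rw [integral_add (iV1.const_mul _) iW1, integral_const_mul] at k1
  rw [integral_add (iV2.const_mul _) iW2, integral_const_mul] at k2
  have iS : Integrable fun y => Real.sign y * Real.exp (-κ * |y|) * W y := by
    refine iW.mono ((measurable_realSign.aestronglyMeasurable.mul
      iW.aestronglyMeasurable).congr (.of_forall fun y => (mul_assoc _ _ _).symm))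
      (.of_forall fun y => ?_)
    rw [mul_assoc, norm_mul]
    exact mul_le_of_le_one_left (norm_nonneg _) (abs_realSign_le_one y)
  have s1 : ∫ y in Ioi 0, Real.sign y * Real.exp (-κ * |y|) * W y
      = ∫ y in Ioi 0, Real.exp (-κ * y) * W y :=
    setIntegral_congr_fun measurableSet_Ioi fun y hy => by
      simp only [Real.sign_of_pos (mem_Ioi.mp hy), abs_of_pos (mem_Ioi.mp hy), one_mul]
  have s2 : ∫ y in Iic 0, Real.sign y * Real.exp (-κ * |y|) * W y
      = -∫ y in Iic 0, Real.exp (κ * y) * W y := by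
    rw [← integral_neg, ← setIntegral_congr_set Iio_ae_eq_Iic,
      ← setIntegral_congr_set (f := fun y => -(Real.exp (κ * y) * W y)) Iio_ae_eq_Iic]
    refine setIntegral_congr_fun measurableSet_Iio fun y hy => ?_
    simp only [Real.sign_of_neg (mem_Iio.mp hy), abs_of_neg (mem_Iio.mp hy), neg_mul_neg]
    ring
  rw [← intervalIntegral.integral_Iic_add_Ioi iS.integrableOn iS.integrableOn (b := 0),
    ← intervalIntegral.integral_Iic_add_Ioi iV.integrableOn iV.integrableOn (b := 0), s1, s2,
    setIntegral_congr_fun measurableSet_Ioi (e1 V), setIntegral_congr_fun measurableSet_Iic (e2 V)]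
  simp only [mul_zero, Real.exp_zero, one_mul] at k1 k2
  linarith

/-! ## Sine coefficients of functions on the strip -/

/-- The sine coefficient `∫ sin(kx) F(x,y) dx` as a function of `y`. -/
def sinCoeff (k : ℕ) (F : ℝ × ℝ → ℝ) (y : ℝ) : ℝ := ∫ x, F (x, y) * Real.sin (k * x) ∂torusMeasure

lemma memLp_sin_mul (k : ℕ) {b : ℝ → ℝ} (hb : MemLp b 2 volume) :
    MemLp (fun p : ℝ × ℝ => Real.sin (k * p.1) * b p.2) 2 stripMeasure := by
  have hs : MemLp (fun x => Real.sin (k * x)) 2 torusMeasure :=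
    memLp_torus_of_continuous (by fun_prop)
  have hm : AEStronglyMeasurable (fun p : ℝ × ℝ => Real.sin (k * p.1) * b p.2) stripMeasure :=
    hs.aestronglyMeasurable.comp_fst.mul hb.aestronglyMeasurable.comp_snd
  rw [memLp_two_iff_integrable_sq hm]
  have h := hs.integrable_sq.mul_prod hb.integrable_sq
  simpa [stripMeasure, mul_pow] using h

lemma integrable_mul_sinCoeff (k : ℕ) {F : ℝ × ℝ → ℝ} (hF : MemLp F 2 stripMeasure)
    {b : ℝ → ℝ} (hb : MemLp b 2 volume) : Integrable fun y => b y * sinCoeff k F y := by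
  have h : Integrable (fun p => F p * (Real.sin (k * p.1) * b p.2)) stripMeasure :=
    hF.integrable_mul (memLp_sin_mul k hb)
  refine (Integrable.integral_prod_right h).congr (.of_forall fun y => ?_)
  simp only [sinCoeff]
  rw [← integral_const_mul]
  exact integral_congr_ae (.of_forall fun x => by ring)

lemma integral_mul_sinCoeff (k : ℕ) {F : ℝ × ℝ → ℝ} (hF : MemLp F 2 stripMeasure)
    {b : ℝ → ℝ} (hb : MemLp b 2 volume) :
    ∫ p, F p * (Real.sin (k * p.1) * b p.2) ∂stripMeasure = ∫ y, b y * sinCoeff k F y := by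
  have h : Integrable (fun p => F p * (Real.sin (k * p.1) * b p.2)) stripMeasure :=
    hF.integrable_mul (memLp_sin_mul k hb)
  unfold stripMeasure at h ⊢
  rw [integral_prod_symm _ h]
  refine integral_congr_ae (.of_forall fun y => ?_)
  simp only [sinCoeff]
  rw [← integral_const_mul]
  exact integral_congr_ae (.of_forall fun x => by ring)

lemma locallyIntegrable_sinCoeff (k : ℕ) {F : ℝ × ℝ → ℝ} (hF : MemLp F 2 stripMeasure) :
    LocallyIntegrable (sinCoeff k F) := by
  refine (locallyIntegrable_iff).mpr fun K hK => ?_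
  have hb : MemLp (K.indicator fun _ => (1 : ℝ)) 2 volume :=
    memLp_indicator_const 2 hK.measurableSet 1 (Or.inr hK.measure_lt_top.ne)
  rw [← integrable_indicator_iff hK.measurableSet]
  refine (integrable_mul_sinCoeff k hF hb).congr (.of_forall fun y => ?_)
  by_cases hy : y ∈ K <;> simp [hy]

lemma continuous_sinCoeff (k : ℕ) {v : ℝ → ℝ → ℝ} (hv : Continuous fun p : ℝ × ℝ => v p.1 p.2) :
    Continuous (sinCoeff k fun p => v p.1 p.2) := by
  have e : (sinCoeff k fun p => v p.1 p.2)
      = fun y => ∫ x in (0 : ℝ)..(2 * Real.pi), v x y * Real.sin (k * x) :=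
    funext fun y => integral_torus _
  rw [e]
  exact intervalIntegral.continuous_parametric_intervalIntegral_of_continuous'
    (f := fun y x => v x y * Real.sin (k * x))
    ((hv.comp continuous_swap).mul (by fun_prop)) _ _

/-- The functions `sin(kx) ψ(y)` are admissible on the strip; Fubini turns the identity tested with
them into the one-dimensional one. -/
lemma hasWeakDerivOn_sinCoeff (k : ℕ) {F G : ℝ × ℝ → ℝ} (hF : MemLp F 2 stripMeasure)
    (hG : MemLp G 2 stripMeasure) (h : HasWeakDy F G) :
    HasWeakDerivOn univ (sinCoeff k F) (sinCoeff k G) := by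
  refine HasWeakDerivOn.of_integral_line ((locallyIntegrable_sinCoeff k hF).locallyIntegrableOn _)
    ((locallyIntegrable_sinCoeff k hG).locallyIntegrableOn _) fun ψ hψ hc _ => ?_
  have hT : IsStripTest fun p : ℝ × ℝ => Real.sin (k * p.1) * ψ p.2 := by
    refine ⟨(Real.contDiff_sin.comp (contDiff_const.mul contDiff_fst)).mul
      (hψ.comp contDiff_snd), fun x y => ?_, ?_⟩
    · have := Real.sin_add_nat_mul_two_pi (k * x) k
      rw [← mul_add] at this
      simp only [this]
    · obtain ⟨R, hR⟩ := hc.isCompact.isBounded.subset_closedBall (0 : ℝ)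
      refine ⟨R, fun x y hy => ?_⟩
      have : ψ y = 0 := image_eq_zero_of_notMem_tsupport fun hm => by
        have := hR hm
        simp only [Metric.mem_closedBall, dist_zero_right, Real.norm_eq_abs] at this
        linarith
      simp only [this, mul_zero]
  have hd : ∀ p : ℝ × ℝ, fderiv ℝ (fun p : ℝ × ℝ => Real.sin (k * p.1) * ψ p.2) p (0, 1)
      = Real.sin (k * p.1) * deriv ψ p.2 := fun p =>
    (hasDerivAt_snd hT.smooth p.1 p.2).unique
      ((hψ.differentiable (by norm_num) p.2).hasDerivAt.const_mul (Real.sin (k * p.1)))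
  have key := h _ hT
  simp only [hd] at key
  rw [integral_mul_sinCoeff k hF ((hψ.continuous_deriv (by norm_num)).memLp_of_hasCompactSupport
    hc.deriv), integral_mul_sinCoeff k hG (hψ.continuous.memLp_of_hasCompactSupport hc)] at key
  simpa only [RCLike.ofReal_real_eq_id, id_eq] using key

/-- Reduction to the sine coefficient of `Ψ` in `y`. The continuous representative makes this
coefficient continuous, so that its value at `y = 0` is the sine coefficient of the trace. -/
lemma integral_sin_mul_exp {Ψ Ψx Ψy Ψxy : StripL2} {v : ℝ → ℝ → ℝ} (hΨ : IsH1H1 Ψ Ψx Ψy Ψxy)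
    (hv : IsContRep Ψ v) (k : ℕ) {κ : ℝ} (hκ : 0 < κ) :
    ∫ p, Ψy p * (Real.sin (k * p.1) * (Real.sign p.2 * Real.exp (-κ * |p.2|))) ∂stripMeasure
      = -2 * (∫ x, v x 0 * Real.sin (k * x) ∂torusMeasure)
        + κ * ∫ p, Ψ p * (Real.sin (k * p.1) * Real.exp (-κ * |p.2|)) ∂stripMeasure := by
  have hvL : MemLp (fun p : ℝ × ℝ => v p.1 p.2) 2 stripMeasure :=
    (memLp_congr_ae hv.ae_eq).mp (Lp.memLp Ψ)
  have hy : MemLp Ψy 2 stripMeasure := Lp.memLp Ψy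
  have hE := memLp_exp_neg_mul_abs hκ
  have hS : MemLp (fun y => Real.sign y * Real.exp (-κ * |y|)) 2 volume := by
    refine hE.mono (measurable_realSign.aestronglyMeasurable.mul hE.aestronglyMeasurable)
      (.of_forall fun y => ?_)
    rw [norm_mul]
    exact mul_le_of_le_one_left (norm_nonneg _) (abs_realSign_le_one y)
  have hw : HasWeakDy (fun p => v p.1 p.2) Ψy := hΨ.dy.congr hv.ae_eq.symm (ae_eq_refl _)
  have e : ∫ p, Ψ p * (Real.sin (k * p.1) * Real.exp (-κ * |p.2|)) ∂stripMeasure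
      = ∫ p, v p.1 p.2 * (Real.sin (k * p.1) * Real.exp (-κ * |p.2|)) ∂stripMeasure :=
    integral_congr_ae (hv.ae_eq.mono fun p hp => by simp only [hp])
  rw [e, integral_mul_sinCoeff k hy hS, integral_mul_sinCoeff k hvL hE]
  exact (hasWeakDerivOn_sinCoeff k hvL hy hw).integral_sign_mul_exp (continuous_sinCoeff k hv.cont)
    (integrable_mul_sinCoeff k hvL hE) (integrable_mul_sinCoeff k hy hE)

end DeltaWave

end

open MeasureTheory Set Filter Topology
open scoped ContDiff

noncomputable section

namespace DeltaWave

set_option maxSynthPendingDepth 3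

/-! ## The weak formulation on exponential waves -/

namespace IsProfile

variable {σ C : ℝ} {p q : ℝ → ℝ}

lemma abs_evenPart_le (h : IsProfile σ C p q) (k : ℕ) (y : ℝ) : |evenPart p k y| ≤ C := by
  refine (h.bound _ (by positivity)).trans (mul_le_of_le_one_right h.nonneg ?_)
  rw [Real.exp_le_one_iff]
  have : 0 ≤ (k : ℝ) * |y| := by positivity
  nlinarith [h.pos]

/-- The coefficients of the slice of the wave at height `y`. -/
def slice (p : ℝ → ℝ) (x : Coeff) (y : ℝ) : Coeff :=
  ∑' k : ℕ, (x k * evenPart p k y) • Coeff.basis k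

lemma norm_slice_term_le (h : IsProfile σ C p q) (x : Coeff) (y : ℝ) (k : ℕ) :
    ‖(x k * evenPart p k y) • Coeff.basis k‖ ≤ |x k| * C := by
  rw [norm_smul, Coeff.norm_basis, mul_one, norm_mul, Real.norm_eq_abs, Real.norm_eq_abs]
  gcongr
  exact h.abs_evenPart_le k y

/-- Composed with the bounded operator `torusMap`, this is the continuity of the wave as a map from
`y` into `H²(𝕋)`. -/
lemma continuous_slice (h : IsProfile σ C p q) (x : Coeff) : Continuous (slice p x) := by
  refine continuous_tsum (fun k => ?_) (x.summable_abs.mul_right C)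
    fun k y => h.norm_slice_term_le x y k
  have := h.continuous
  unfold evenPart; fun_prop

lemma eval_slice (h : IsProfile σ C p q) (x : Coeff) (θ y : ℝ) :
    Coeff.eval θ (slice p x y) = waveFn p x θ y := by
  have h1 : HasSum (fun k : ℕ => (x k * evenPart p k y) • Coeff.basis k) (slice p x y) :=
    (Summable.of_norm_bounded (x.summable_abs.mul_right C) (h.norm_slice_term_le x y)).hasSum
  refine (h1.mapL (Coeff.eval θ)).unique ?_
  have e : ∀ k : ℕ, Coeff.eval θ ((x k * evenPart p k y) • Coeff.basis k)
      = x k * ((((k : ℝ) ^ 2)⁻¹ * Real.sin (k * θ)) * evenPart p k y) := fun k => by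
    rw [map_smul, Coeff.eval, Coeff.lift_basis, smul_eq_mul, div_eq_inv_mul]; ring
  simp only [e]
  exact h.hasSum_waveFn x θ y

end IsProfile

/-- The second derivative of the sine series. -/
def torusDxx : Coeff →L[ℝ] TorusL2 :=
  torusOp (c := fun _ => -1) Real.continuous_sin neg_sin_coeff_bound

lemma dxx_torusMap (x : Coeff) : H2Torus.dxx (torusMap x) = torusDxx x := rfl

lemma oddPart_powExpDeriv_zero (s : ℝ) (k : ℕ) (y : ℝ) :
    oddPart (powExpDeriv 0 s) k y
      = -s * (Real.sign y * Real.exp (-(k * s) * |y|)) := by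
  simp only [oddPart, powExpDeriv, powExp, Nat.cast_zero, zero_mul, pow_zero, one_mul, neg_zero,
    zero_sub]
  rw [show -(s * (k * |y|)) = -(k * s) * |y| by ring]; ring

lemma evenPart_powExp_zero (s : ℝ) (k : ℕ) (y : ℝ) :
    evenPart (powExp 0 s) k y = Real.exp (-(k * s) * |y|) := by
  simp only [evenPart, powExp, pow_zero, one_mul]
  rw [show -(s * (k * |y|)) = -(k * s) * |y| by ring]

/-- The bilinear form of the linear part of the equation, on exponential waves. -/
lemma linear_form_expWave {Ψ Ψx Ψy Ψxy : StripL2} {v : ℝ → ℝ → ℝ} (hΨ : IsH1H1 Ψ Ψx Ψy Ψxy)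
    (hv : IsContRep Ψ v) {s : ℝ} (hs : 0 < s)
    (hv0 : MemLp (fun x => v x 0) 2 torusMeasure) (x : Coeff) :
    pairing (Lp.memLp Ψy) ((isProfile_powExp 0 hs).family_dy.op x)
      - s ^ 2 * pairing (Lp.memLp Ψ) ((isProfile_powExp 0 hs).family_dxx.op x)
      = - (2 * s * pairing hv0 (torusDxx (Coeff.invDiag x))) := by
  set P := isProfile_powExp 0 hs
  -- For a fixed test function both sides are bounded functionals of `x`, so a single mode suffices.
  have h : (pairing (Lp.memLp Ψy)).comp P.family_dy.op
      - s ^ 2 • (pairing (Lp.memLp Ψ)).comp P.family_dxx.op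
      = -((2 * s) • (pairing hv0).comp (torusDxx.comp Coeff.invDiag)) := by
    refine Coeff.clm_ext fun k => ?_
    change pairing _ (P.family_dy.op (Coeff.basis k))
      - s ^ 2 * pairing _ (P.family_dxx.op (Coeff.basis k))
      = -((2 * s) * pairing hv0 (torusDxx (Coeff.invDiag (Coeff.basis k))))
    rw [Coeff.invDiag, Coeff.diag_basis, map_smul, map_smul, smul_eq_mul]
    simp only [pairing_apply]
    have e1 : ∫ z, P.family_dy.op (Coeff.basis k) z * Ψy z ∂stripMeasure
        = -((k : ℝ)⁻¹ * s) * ∫ z, Ψy z * (Real.sin (k * z.1)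
          * (Real.sign z.2 * Real.exp (-(k * s) * |z.2|))) ∂stripMeasure := by
      rw [← integral_const_mul]
      refine integral_congr_ae ((P.family_dy.op_basis_ae k).mono fun z hz => ?_)
      simp only [hz, IsProfile.modeFn, oddPart_powExpDeriv_zero]; ring
    have e2 : ∫ z, P.family_dxx.op (Coeff.basis k) z * Ψ z ∂stripMeasure
        = -∫ z, Ψ z * (Real.sin (k * z.1) * Real.exp (-(k * s) * |z.2|)) ∂stripMeasure := by
      rw [← integral_neg]
      refine integral_congr_ae ((P.family_dxx.op_basis_ae k).mono fun z hz => ?_)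
      simp only [hz, IsProfile.modeFn, evenPart_powExp_zero]; ring
    have e3 : ∫ θ, torusDxx (Coeff.basis k) θ * v θ 0 ∂torusMeasure
        = -∫ θ, v θ 0 * Real.sin (k * θ) ∂torusMeasure := by
      rw [← integral_neg]
      refine integral_congr_ae ((torusOp_basis_ae Real.continuous_sin neg_sin_coeff_bound k).mono
        fun θ hθ => ?_)
      simp only [torusDxx, hθ, torusMode]; ring
    rw [e1, e2, e3]
    rcases Nat.eq_zero_or_pos k with rfl | hk
    · simp
    -- The mode solves the linear equation off `y = 0`, so the two volume integrals cancel and only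
    -- the trace term `-2 ∫ v(·,0) sin(kx)` remains.
    · rw [integral_sin_mul_exp hΨ hv k (show 0 < k * s by positivity)]
      have hk' : (k : ℝ) ≠ 0 := by positivity
      field_simp
      ring
  exact congrArg (fun A : Coeff →L[ℝ] ℝ => A x) h

/-- The volume integral equals `-2s` times the pairing of the trace of the test function with the
second derivative of the series `Coeff.invDiag x`. Applying `torusDxx` to the sequence equation and
pairing with the same trace shows that the terms at `y = 0` compensate it. -/
theorem isWeakSolution_expWave {α γ s : ℝ} (hs : 0 < s) {x : Coeff}
    (hx : (2 * s) • Coeff.invDiag x - α • x - γ • Coeff.tri x x x = 0) :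
    IsWeakSolution (fun _ => 1) (fun _ => 0) α γ (1 - s ^ 2) (expWave 0 s x) := by
  set P := isProfile_powExp 0 hs with hP
  rw [expWave_of_pos 0 hs]
  have hp0 : powExp 0 s 0 = 1 := by simp [powExp]
  refine ⟨waveFn (powExp 0 s) x, P.isContRep x, ⟨fun y => torusMap (IsProfile.slice (powExp 0 s) x y),
    torusMap.continuous.comp (P.continuous_slice x), fun y => ?_⟩, torusMap (Coeff.tri x x x), ?_, ?_⟩
  · filter_upwards [torusMap_fn_ae (IsProfile.slice (powExp 0 s) x y)] with θ hθ
    rw [hθ, P.eval_slice]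
  · filter_upwards [torusMap_fn_ae (Coeff.tri x x x)] with θ hθ
    rw [hθ, Coeff.eval_tri, P.waveFn_zero, hp0]; ring
  · intro Ψ Ψx Ψy Ψxy v hΨ hv
    have hv0 : MemLp (fun x => v x 0) 2 torusMeasure :=
      memLp_torus_of_continuous (hv.cont.comp (by fun_prop : Continuous fun x : ℝ => (x, (0 : ℝ))))
    have i1 : Integrable (fun z => P.family_dy.op x z * Ψy z) stripMeasure :=
      (Lp.memLp _).integrable_mul (Lp.memLp _)
    have i2 : Integrable (fun z => P.family_dxx.op x z * Ψ z) stripMeasure :=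
      (Lp.memLp _).integrable_mul (Lp.memLp _)
    have i3 : ∀ f : TorusL2, Integrable (fun θ => f θ * v θ 0) torusMeasure := fun f =>
      (Lp.memLp f).integrable_mul hv0
    have e1 : ∫ z, (WaveSpace.dy (P.wave x) z * Ψy z
        - (1 - (1 - s ^ 2) * 1 - 0) * WaveSpace.dxx (P.wave x) z * Ψ z) ∂stripMeasure
        = pairing (Lp.memLp Ψy) (P.family_dy.op x)
          - s ^ 2 * pairing (Lp.memLp Ψ) (P.family_dxx.op x) := by
      rw [pairing_apply, pairing_apply, ← integral_const_mul, ← integral_sub i1 (i2.const_mul _)]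
      refine integral_congr_ae (.of_forall fun z => ?_)
      change P.family_dy.op x z * Ψy z - (1 - (1 - s ^ 2) * 1 - 0) * P.family_dxx.op x z * Ψ z = _
      ring
    have e2 : ∫ θ, (α * H2Torus.dxx (WaveSpace.trace (P.wave x)) θ
        + γ * H2Torus.dxx (torusMap (Coeff.tri x x x)) θ) * v θ 0 ∂torusMeasure
        = α * pairing hv0 (torusDxx x) + γ * pairing hv0 (torusDxx (Coeff.tri x x x)) := by
      have et : WaveSpace.trace (P.wave x) = torusMap x := by
        change powExp 0 s 0 • torusMap x = _
        rw [hp0, one_smul]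
      rw [et, dxx_torusMap, dxx_torusMap, pairing_apply, pairing_apply, ← integral_const_mul,
        ← integral_const_mul, ← integral_add ((i3 _).const_mul _) ((i3 _).const_mul _)]
      exact integral_congr_ae (.of_forall fun θ => by ring)
    have e3 : 2 * s * pairing hv0 (torusDxx (Coeff.invDiag x)) - α * pairing hv0 (torusDxx x)
        - γ * pairing hv0 (torusDxx (Coeff.tri x x x)) = 0 := by
      have := congrArg (fun z => pairing hv0 (torusDxx z)) hx
      simpa only [map_sub, map_smul, smul_eq_mul, map_zero] using this
    rw [e1, e2, linear_form_expWave hΨ hv hs hv0]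
    linarith

end DeltaWave

end

open MeasureTheory Set Filter Topology
open scoped ContDiff

noncomputable section

namespace DeltaWave

set_option maxSynthPendingDepth 3

/-! ## The bifurcating curve -/

/-- The difference quotient at `0` is `h` itself, so continuity of `h` is enough. This gives the
tangent of the curve, `σ'(0)`, and the second derivative of the parameter. -/
lemma hasDerivAt_smul_zero {E : Type*} [NormedAddCommGroup E] [NormedSpace ℝ E] {h : ℝ → E}
    (hh : ContinuousAt h 0) : HasDerivAt (fun ε : ℝ => ε • h ε) (h 0) 0 := by
  rw [hasDerivAt_iff_tendsto_slope]
  refine (hh.tendsto.mono_left nhdsWithin_le_nhds).congr' ?_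
  filter_upwards [self_mem_nhdsWithin] with ε hε
  rw [slope_def_module, zero_smul, sub_zero, sub_zero, smul_smul, inv_mul_cancel₀ hε, one_smul]

lemma tendsto_sq_zero : Tendsto (fun ε : ℝ => ε ^ 2) (𝓝 0) (𝓝 0) := by
  have h : Continuous fun ε : ℝ => ε ^ 2 := by fun_prop
  simpa using h.tendsto 0

/-- Near `0` the first derivative is `ε · 2 f'(ε²)`, which has the form treated in
`hasDerivAt_smul_zero`. -/
lemma deriv_comp_sq {f : ℝ → ℝ} (hf : ContDiffAt ℝ ω f 0) :
    deriv (fun ε => f (ε ^ 2)) 0 = 0 ∧ iteratedDeriv 2 (fun ε => f (ε ^ 2)) 0 = 2 * deriv f 0 := by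
  have h1 : ∀ᶠ τ in 𝓝 0, DifferentiableAt ℝ f τ :=
    (hf.eventually (by simp)).mono fun τ hτ => hτ.differentiableAt (by simp)
  have h2 : deriv (fun ε => f (ε ^ 2)) =ᶠ[𝓝 0] fun ε => ε • (2 * deriv f (ε ^ 2)) := by
    filter_upwards [tendsto_sq_zero.eventually h1] with ε hε
    have h := HasDerivAt.comp (h := fun ε : ℝ => ε ^ 2) ε hε.hasDerivAt (hasDerivAt_pow 2 ε)
    have h' : deriv (fun ε => f (ε ^ 2)) ε = _ := h.deriv
    rw [h', smul_eq_mul]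
    push_cast
    ring
  refine ⟨by simpa using h2.eq_of_nhds, ?_⟩
  have h3 : ContinuousAt (fun ε : ℝ => 2 * deriv f (ε ^ 2)) 0 := by
    have h4 : ContinuousAt (deriv f) ((0 : ℝ) ^ 2) := by
      have h5 := (hf.fderiv_right (m := 0) (by simp)).continuousAt.clm_apply
        (continuousAt_const (y := (1 : ℝ)))
      simpa using h5
    exact continuousAt_const.mul (h4.comp (f := fun ε : ℝ => ε ^ 2) (by fun_prop))
  rw [iteratedDeriv_succ, iteratedDeriv_one, h2.deriv_eq, (hasDerivAt_smul_zero h3).deriv]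
  simp

lemma Coeff.summable_sq (x : Coeff) : Summable fun k => x k ^ 2 := by
  refine Summable.of_nonneg_of_le (fun k => sq_nonneg _) (fun k => ?_)
    (x.summable_abs.mul_left ‖x‖)
  rw [← sq_abs, pow_two]
  gcongr
  exact lp.norm_apply_le_norm one_ne_zero x k

lemma isContRep_expWave {s : ℝ} (hs : 0 < s) (x : Coeff) :
    IsContRep (WaveSpace.fn (expWave 0 s x)) (waveFn (powExp 0 s) x) := by
  rw [expWave_of_pos 0 hs]
  exact (isProfile_powExp 0 hs).isContRep x

lemma hasSum_expWave {s : ℝ} (hs : 0 < s) (x : Coeff) (θ y : ℝ) :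
    HasSum (fun k : ℕ => x k / (k : ℝ) ^ 2 * Real.exp (-(k * s * |y|)) * Real.sin (k * θ))
      (waveFn (powExp 0 s) x θ y) := by
  have e : ∀ k : ℕ, x k / (k : ℝ) ^ 2 * Real.exp (-(k * s * |y|)) * Real.sin (k * θ)
      = x k * ((((k : ℝ) ^ 2)⁻¹ * Real.sin (k * θ)) * evenPart (powExp 0 s) k y) := fun k => by
    rw [evenPart_powExp_zero, neg_mul]; ring
  simp only [e]
  exact (isProfile_powExp 0 hs).hasSum_waveFn x θ y

lemma waveFn_basis {s : ℝ} (hs : 0 < s) {κ : ℕ} (hκ : 1 ≤ κ) (θ y : ℝ) :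
    waveFn (powExp 0 s) (((κ : ℝ) ^ 2) • Coeff.basis κ) θ y
      = Real.exp (-(κ * s * |y|)) * Real.sin (κ * θ) := by
  have hκ' : (κ : ℝ) ≠ 0 := by positivity
  refine (hasSum_expWave hs _ θ y).unique ?_
  have h := hasSum_single (f := fun k : ℕ => (((κ : ℝ) ^ 2) • Coeff.basis κ : Coeff) k / (k : ℝ) ^ 2
    * Real.exp (-(k * s * |y|)) * Real.sin (k * θ)) κ fun k hk => by
      simp [Coeff.basis_apply, hk]
  convert h using 1
  simp [Coeff.basis_apply, hκ']

/-- The trace at `y = 0` is a nonzero sine. By continuity the rescaled wave then stays nonzero along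
the branch near `τ = 0`, which makes the curve nontrivial for `ε ≠ 0`. -/
lemma expWave_basis_ne_zero {s : ℝ} (hs : 0 < s) {κ : ℕ} (hκ : 1 ≤ κ) :
    expWave 0 s (((κ : ℝ) ^ 2) • Coeff.basis κ) ≠ 0 := by
  intro h0
  have hκ' : (0 : ℝ) < κ := by exact_mod_cast hκ
  have h1 : torusMap (Coeff.basis κ) = 0 := by
    have h2 : WaveSpace.trace (expWave 0 s (((κ : ℝ) ^ 2) • Coeff.basis κ)) = 0 := by
      rw [h0]; rfl
    rw [expWave_of_pos 0 hs] at h2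
    change powExp 0 s 0 • torusMap (((κ : ℝ) ^ 2) • Coeff.basis κ) = 0 at h2
    rw [map_smul] at h2
    have hp0 : powExp 0 s 0 = 1 := by simp [powExp]
    rw [hp0, one_smul] at h2
    exact (smul_eq_zero.mp h2).resolve_left (by positivity)
  have h3 : (fun θ => Coeff.eval θ (Coeff.basis κ)) =ᵐ[torusMeasure] fun _ => 0 := by
    have h4 : H2Torus.fn (torusMap (Coeff.basis κ)) =ᵐ[torusMeasure] fun _ => 0 := by
      rw [h1]; exact Lp.coeFn_zero ℝ 2 torusMeasure
    exact (torusMap_fn_ae _).symm.trans h4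
  have h5 : ∀ θ, Coeff.eval θ (Coeff.basis κ) = Real.sin (κ * θ) / (κ : ℝ) ^ 2 := fun θ =>
    Coeff.lift_basis κ
  simp only [h5] at h3
  have h6 : (fun θ => Real.sin (κ * θ) / (κ : ℝ) ^ 2)
      =ᵐ[volume.restrict (Ioo 0 (2 * Real.pi))] fun _ => 0 :=
    ae_restrict_of_ae_restrict_of_subset Ioo_subset_Ioc_self h3
  have h7 := Measure.eqOn_open_of_ae_eq h6 isOpen_Ioo (by fun_prop) (by fun_prop)
  have hκ1 : (1 : ℝ) ≤ κ := by exact_mod_cast hκ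
  have h8 := h7 (show Real.pi / 2 / κ ∈ Ioo 0 (2 * Real.pi) from ⟨by positivity, by
    rw [div_lt_iff₀ hκ']
    nlinarith [Real.pi_pos]⟩)
  simp only [mul_div_cancel₀ _ hκ'.ne', Real.sin_pi_div_two] at h8
  exact absurd h8 (by positivity)

lemma smul_combination {E : Type*} [AddCommGroup E] [Module ℝ E] (a b c ε : ℝ) (u x t : E) :
    a • ε • u - b • ε • x - c • ε • ε • ε • t = ε • (a • u - b • x - (c * ε ^ 2) • t) := by
  module

/-- The cubic term scales as `ε³ = ε · ε²`, so after division by `ε` the amplitude enters only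
through `τ = ε²`. -/
lemma equation_smul {a b c ε : ℝ} {x : Coeff}
    (h : a • Coeff.invDiag x - b • x - (c * ε ^ 2) • Coeff.tri x x x = 0) :
    a • Coeff.invDiag (ε • x) - b • ε • x - c • Coeff.tri (ε • x) (ε • x) (ε • x) = 0 := by
  simp only [map_smul, FunLike.coe_smul, Pi.smul_apply]
  rw [smul_combination, h, smul_zero]

open Coeff in
-- The curve is `X ε = ε • w (ε²)`, `S ε = σ (ε²)` with the branch from `exists_branch`: its tangent
-- at `0` is the wave of `w 0`, and the parameter is a function of `ε²`.
theorem exists_bifurcating_curve {κ : ℕ} (hκ : 1 ≤ κ) {s α : ℝ} (hs : 0 < s)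
    (hα : α = 2 * s / κ) (γ : ℝ) {U : Set ℝ} (hU : IsOpen U) (hsU : 1 - s ^ 2 ∈ U) :
    ∃ ε₀ : ℝ, 0 < ε₀ ∧ ∃ (X : ℝ → Coeff) (S : ℝ → ℝ),
      ContDiffOn ℝ ∞ (fun ε => expWave 0 (S ε) (X ε)) (Ioo (-ε₀) ε₀) ∧
      ContDiffOn ℝ ∞ (fun ε => 1 - S ε ^ 2) (Ioo (-ε₀) ε₀) ∧
      (∀ ε ∈ Ioo (-ε₀) ε₀, 0 < S ε ∧ 1 - S ε ^ 2 ∈ U ∧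
        IsWeakSolution (fun _ => 1) (fun _ => 0) α γ (1 - S ε ^ 2) (expWave 0 (S ε) (X ε)) ∧
        (ε ≠ 0 → expWave 0 (S ε) (X ε) ≠ 0)) ∧
      X 0 = 0 ∧ S 0 = s ∧
      deriv (fun ε => expWave 0 (S ε) (X ε)) 0 = expWave 0 s (((κ : ℝ) ^ 2) • basis κ) ∧
      deriv (fun ε => 1 - S ε ^ 2) 0 = 0 ∧
      iteratedDeriv 2 (fun ε => 1 - S ε ^ 2) 0 = -(3 / 2) * γ * κ * s := by
  obtain ⟨w, σ, hw, hσ, hw0, hσ0, heq⟩ := exists_branch hκ hs γ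
  have hκ' : (κ : ℝ) ≠ 0 := by positivity
  have hT : ∀ {τ : ℝ}, 0 < σ τ → ContDiffAt ℝ ∞ w τ → ContDiffAt ℝ ∞ σ τ →
      ContDiffAt ℝ ∞ (fun τ => expWave 0 (σ τ) (w τ)) τ := fun {τ} h1 h2 h3 =>
    (((contDiffOn_expWave 0).contDiffAt (Ioi_mem_nhds h1)).comp τ h3).clm_apply h2
  have hpos0 : 0 < σ 0 := hσ0 ▸ hs
  have hpos : ∀ᶠ τ in 𝓝 0, 0 < σ τ := hσ.continuousAt.eventually (lt_mem_nhds hpos0)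
  have hmem : ∀ᶠ τ in 𝓝 0, 1 - σ τ ^ 2 ∈ U :=
    (continuousAt_const.sub (hσ.continuousAt.pow 2)).eventually
      (hU.mem_nhds (show 1 - σ 0 ^ 2 ∈ U by rwa [hσ0]))
  -- Regularity of order `ω` at a point spreads to a neighbourhood. Order `∞` at a point need not,
  -- since the neighbourhoods for the finite orders may shrink.
  have hwc : ∀ᶠ τ in 𝓝 0, ContDiffAt ℝ ω w τ := hw.eventually (by simp)
  have hσc : ∀ᶠ τ in 𝓝 0, ContDiffAt ℝ ω σ τ := hσ.eventually (by simp)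
  have hTc : ContinuousAt (fun τ => expWave 0 (σ τ) (w τ)) 0 :=
    (hT hpos0 (hw.of_le le_top) (hσ.of_le le_top)).continuousAt
  have hne : ∀ᶠ τ in 𝓝 0, expWave 0 (σ τ) (w τ) ≠ 0 :=
    hTc.eventually_ne (by rw [hσ0, hw0]; exact expWave_basis_ne_zero hs hκ)
  obtain ⟨ε₀, hε₀, hball⟩ := Metric.eventually_nhds_iff_ball.mp (tendsto_sq_zero.eventually
    ((hpos.and hmem).and ((hwc.and hσc).and (hne.and heq))))
  rw [Real.ball_eq_Ioo, zero_sub, zero_add] at hball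
  have hsq : ∀ ε : ℝ, ContDiffAt ℝ ∞ (fun ε : ℝ => ε ^ 2) ε := fun ε => by fun_prop
  have hL : ContDiffAt ℝ ω (fun τ => 1 - σ τ ^ 2) 0 := contDiffAt_const.sub (hσ.pow 2)
  -- The component `κ` reads `σ = s + τ γ T_κ / (2κ)` with `T_κ = κ⁶ · 3/(4κ⁴) = (3/4) κ²` at `τ =
  -- 0`. Hence `σ'(0) = 3γκ/8`, and the derivative of `1 - σ²` is `-2s` times this.
  have hderiv : deriv (fun τ => 1 - σ τ ^ 2) 0 = -(3 / 4) * γ * κ * s := by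
    have hH : ContinuousAt (fun τ => γ * tri (w τ) (w τ) (w τ) κ / (2 * κ)) 0 := by
      have h1 : ContinuousAt (fun τ => coord κ (tri (w τ) (w τ) (w τ))) 0 :=
        (coord κ).continuous.continuousAt.comp
          (((tri.continuous.continuousAt.comp hw.continuousAt).clm_apply
            hw.continuousAt).clm_apply hw.continuousAt)
      exact (continuousAt_const.mul h1).div_const _
    have h2 : (fun τ => σ τ)
        =ᶠ[𝓝 0] fun τ => s + τ • (γ * tri (w τ) (w τ) (w τ) κ / (2 * κ)) := by
      filter_upwards [heq] with τ hτ
      have := hτ.2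
      rw [smul_eq_mul]
      field_simp
      linarith
    have h3 : HasDerivAt σ (γ * tri (w 0) (w 0) (w 0) κ / (2 * κ)) 0 :=
      ((hasDerivAt_smul_zero hH).const_add s).congr_of_eventuallyEq h2
    have h4 : tri (w 0) (w 0) (w 0) κ = 3 / 4 * (κ : ℝ) ^ 2 := by
      rw [hw0]
      simp only [map_smul, FunLike.coe_smul, Pi.smul_apply, lp.coeFn_smul, smul_eq_mul,
        tri_basis_apply_self hκ]
      field_simp
    have h5 : deriv (fun τ => 1 - σ τ ^ 2) 0 = _ := ((h3.pow 2).const_sub 1).deriv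
    rw [h5, h4, hσ0]
    push_cast
    field_simp
  obtain ⟨hd1, hd2⟩ := deriv_comp_sq hL
  refine ⟨ε₀, hε₀, fun ε => ε • w (ε ^ 2), fun ε => σ (ε ^ 2), ?_, ?_, ?_, by simp,
    by simpa using hσ0, ?_, hd1, ?_⟩
  · intro ε hε
    obtain ⟨⟨h1, -⟩, ⟨h2, h3⟩, -⟩ := hball ε hε
    have h4 : ContDiffAt ℝ ∞ (fun ε => w (ε ^ 2)) ε :=
      ContDiffAt.comp (f := fun ε : ℝ => ε ^ 2) ε (h2.of_le le_top) (hsq ε)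
    have h5 : ContDiffAt ℝ ∞ (fun ε => σ (ε ^ 2)) ε :=
      ContDiffAt.comp (f := fun ε : ℝ => ε ^ 2) ε (h3.of_le le_top) (hsq ε)
    exact ((((contDiffOn_expWave 0).contDiffAt (Ioi_mem_nhds h1)).comp ε h5).clm_apply
      (contDiffAt_id.smul h4)).contDiffWithinAt
  · intro ε hε
    obtain ⟨-, ⟨-, h3⟩, -⟩ := hball ε hε
    have h5 : ContDiffAt ℝ ∞ (fun ε => σ (ε ^ 2)) ε :=
      ContDiffAt.comp (f := fun ε : ℝ => ε ^ 2) ε (h3.of_le le_top) (hsq ε)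
    exact (contDiffAt_const.sub (h5.pow 2)).contDiffWithinAt
  · intro ε hε
    obtain ⟨⟨h1, h2⟩, -, h3, h4, -⟩ := hball ε hε
    refine ⟨h1, h2, isWeakSolution_expWave h1 ?_, fun h0 => ?_⟩
    · rw [hα]
      exact equation_smul h4
    · rw [map_smul]
      exact smul_ne_zero h0 h3
  · have h1 : ContinuousAt (fun ε : ℝ => expWave 0 (σ (ε ^ 2)) (w (ε ^ 2))) 0 :=
      ContinuousAt.comp (f := fun ε : ℝ => ε ^ 2) (g := fun τ => expWave 0 (σ τ) (w τ))
        (by simpa using hTc) (by fun_prop)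
    have h2 := (hasDerivAt_smul_zero h1).deriv
    simp only [map_smul]
    rw [h2]
    norm_num [hσ0, hw0]
  · rw [hd2, hderiv]; ring

end DeltaWave

end

/-! ### The final statement. -/

theorem corollary2p10 (γ lamstar α : ℝ) (kstar : ℕ) (hk : 1 ≤ kstar) (hlam : lamstar < 1)
    (hα : α = 2 * Real.sqrt (1 - lamstar) / kstar) :
    ∃ I Istar : Set ℝ,
      DeltaWave.BifurcationHypotheses (fun _ => 1) (fun _ => 0) α kstar lamstar I Istar
        (fun y => Real.exp (-(kstar * Real.sqrt (1 - lamstar) * |y|))) ∧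
      ∃ ε₀ : ℝ, 0 < ε₀ ∧ ∃ (Φ : ℝ → DeltaWave.WaveSpace) (lam : ℝ → ℝ),
        ContDiffOn ℝ ∞ Φ (Ioo (-ε₀) ε₀) ∧ ContDiffOn ℝ ∞ lam (Ioo (-ε₀) ε₀) ∧
        (∀ ε ∈ Ioo (-ε₀) ε₀, lam ε ∈ Istar ∧
          DeltaWave.IsWeakSolution (fun _ => 1) (fun _ => 0) α γ (lam ε) (Φ ε) ∧
          (ε ≠ 0 → Φ ε ≠ 0)) ∧
        Φ 0 = 0 ∧
        DeltaWave.IsContRep (DeltaWave.WaveSpace.fn (deriv Φ 0)) (fun x y =>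
          Real.exp (-(kstar * Real.sqrt (1 - lamstar) * |y|)) * Real.sin (kstar * x)) ∧
        lam 0 = lamstar ∧ deriv lam 0 = 0 ∧
        iteratedDeriv 2 lam 0 = -(3 / 2) * γ * kstar * Real.sqrt (1 - lamstar) ∧
        ∃ a : ℝ → ℕ → ℝ, ∀ ε ∈ Ioo (-ε₀) ε₀,
          Summable (fun k : ℕ => ((k : ℝ) ^ 2 * a ε k) ^ 2) ∧
          ∃ u : ℝ → ℝ → ℝ, DeltaWave.IsContRep (DeltaWave.WaveSpace.fn (Φ ε)) u ∧
            ∀ x y : ℝ, HasSum (fun k : ℕ =>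
              a ε k * Real.exp (-(k * Real.sqrt (1 - lam ε) * |y|)) * Real.sin (k * x)) (u x y) := by
  have hyp := DeltaWave.bifurcationHypotheses hk hlam hα
  have hs : 0 < Real.sqrt (1 - lamstar) := Real.sqrt_pos.mpr (by linarith)
  have hsq : 1 - Real.sqrt (1 - lamstar) ^ 2 = lamstar := by
    rw [Real.sq_sqrt (by linarith)]; ring
  obtain ⟨ε₀, hε₀, X, S, hΦ, hlamS, hsol, hX0, hS0, hdΦ, hd1, hd2⟩ :=
    DeltaWave.exists_bifurcating_curve hk hs hα γ hyp.isOpen_Istar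
      (by rw [hsq]; exact hyp.mem_star)
  -- The sequences carry the weight `k²`, so the sine coefficients are `X ε k / k²`; at `k = 0`
  -- division by zero gives `0`. The required square summability is the inclusion of `ℓ¹` in `ℓ²`.
  refine ⟨_, _, hyp, ε₀, hε₀, fun ε => DeltaWave.expWave 0 (S ε) (X ε), fun ε => 1 - S ε ^ 2,
    hΦ, hlamS, fun ε hε => (hsol ε hε).2, by simp only [hX0, map_zero], ?_,
    by simp only [hS0, hsq], hd1, hd2, fun ε k => X ε k / (k : ℝ) ^ 2, fun ε hε => ⟨?_, ?_⟩⟩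
  · rw [hdΦ]
    have h := DeltaWave.isContRep_expWave hs (((kstar : ℝ) ^ 2) • DeltaWave.Coeff.basis kstar)
    have e : DeltaWave.waveFn (DeltaWave.powExp 0 (Real.sqrt (1 - lamstar)))
        (((kstar : ℝ) ^ 2) • DeltaWave.Coeff.basis kstar) = fun x y =>
          Real.exp (-(kstar * Real.sqrt (1 - lamstar) * |y|)) * Real.sin (kstar * x) :=
      funext fun x => funext fun y => DeltaWave.waveFn_basis hs hk x y
    rwa [e] at h
  · refine Summable.of_nonneg_of_le (fun k => sq_nonneg _) (fun k => ?_) (X ε).summable_sq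
    rcases Nat.eq_zero_or_pos k with rfl | hk0
    · simp [sq_nonneg]
    · rw [mul_div_cancel₀ _ (by positivity)]
  · have hS := (hsol ε hε).1
    refine ⟨_, DeltaWave.isContRep_expWave hS (X ε), fun x y => ?_⟩
    rw [show 1 - (1 - S ε ^ 2) = S ε ^ 2 by ring, Real.sqrt_sq hS.le]
    exact DeltaWave.hasSum_expWave hS (X ε) x y
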